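/- **Theorem 1 (Existence and uniqueness).** Let $d\in\mathbb N$, $a,b>0$, and let $\mathcal M^s(\mathbb R^d)$ be the space of finite signed Radon measures on $\mathbb R^d$. For $\mu\in\mathcal M^s(\mathbb R^d)$ with Jordan decomposition $\mu=\mu^+-\mu^-$, write $|\mu|=\mu^+(\mathbb R^d)+\mu^-(\mathbb R^d)$, $\operatorname{supp}\mu=\operatorname{supp}(\mu^++\mu^-)$, and $$\|\mu\|^{a,b}=W_1^{a,b}(\mu^+,\mu^-),\qquad W_1^{a,b}(\rho,\sigma)=\inf_{|\tilde\rho|=|\tilde\sigma|}\Big\{a\big(|\rho-\tilde\rho|+|\sigma-\tilde\sigma|\big)+b\,W_1(\tilde\rho,\tilde\sigma)\Big\},$$ where the infimum is over finite positive measures $\tilde\rho,\tilde\sigma$ of equal mass and $W_1(\tilde\rho,\tilde\sigma)=\inf_\pi\int|x-y|\,d\pi(x,y)$ over all measures $\pi$ on $\mathbb R^d\times\mathbb R^d$ with marginals $\tilde\rho,\tilde\sigma$. Let $B_0(r)$ be the closed ball of radius $r$ around $0$. Let $v$ assign to each $\mu\in\mathcal M^s(\mathbb R^d)$ a vector field $v[\mu]:\mathbb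 R^d\to\mathbb R^d$, let $h:\mathcal M^s(\mathbb R^d)\to\mathcal M^s(\mathbb R^d)$, and let $K,L,M,Q,P,R$ be real constants, $L\ge 0$, such that for all $\mu,\nu\in\mathcal M^s(\mathbb R^d)$ and $x,y\in\mathbb R^d$: * (H-1) $\|v[\mu]-v[\nu]\|_{\mathcal C^0(\mathbb R^d)}\le K\|\mu-\nu\|^{a,b}$; * (H-2) $|v[\mu](x)-v[\mu](y)|\le L|x-y|$ and $|v[\mu](x)|\le M$; * (H-3) $\|h[\mu]-h[\nu]\|^{a,b}\le Q\|\mu-\nu\|^{a,b}$, $|h[\mu]|\le P$, $\operatorname{supp}h[\mu]\subset B_0(R)$. A solution with initial datum $\mu_0\in\mathcal M^s(\mathbb R^d)$ of $$\partial_t\mu_t+\operatorname{div}(v[\mu_t]\mu_t)=h[\mu_t],\qquad \mu_{|t=0}=\mu_0,$$ is a map $t\mapsto\mu_t$ from $[0,1]$ to $\mathcal M^s(\mathbb R^d)$, continuous for $\|\cdot\|^{a,b}$ (i.e. an element of $\mathcal C^0([0,1],\mathcal M^s(\mathbb R^d))$ with the norm $\sup_{t\in[0,1]}\|\mu_t\|^{a,b}$),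 equal to $\mu_0$ at $t=0$ and such that for every $\Phi\in\mathcal C_c^\infty(\mathbb R^d)$ and $t\in[0,1]$ (one-sided derivatives at the endpoints) $$\frac{d}{dt}\int\Phi\,d\mu_t=\int v[\mu_t]\cdot\nabla\Phi\,d\mu_t+\int\Phi\,dh[\mu_t].$$ Then: 1. For every compactly supported $\mu_0\in\mathcal M^s(\mathbb R^d)$ there is exactly one solution with initial datum $\mu_0$. 2. If $\mu_t,\nu_t$ are solutions with initial data $\mu_0,\nu_0\in\mathcal M^s(\mathbb R^d)$, then for $t\in[0,1]$ $$\|\mu_t-\nu_t\|^{a,b}\le\|\mu_0-\nu_0\|^{a,b}\,e^{C_1t},\qquad C_1=2L+2bK\big(P+\min\{|\mu_0|,|\nu_0|\}\big)+Q.$$ 3. If $\mu_0$ is compactly supported and $\mu_t$ is the solution with initial datum $\mu_0$, then for $t\in[0,1]$ $$|\mu_t|\le|\mu_0|+Pt,\qquad \operatorname{supp}\mu_t\subset B_0(R'+tM)\ \text{ whenever }\ \operatorname{supp}\mu_0\cup B_0(R)\subset B_0(R'),$$ and for $t,\tau\ge0$ with $t+\tau\le1$ $$\|\mu_{t+\tau}-\mu_t\|^{a,b}\le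 C_2\,\tau,\qquad C_2=aP+bM\big(P(t+\tau)+|\mu_0|\big).$$ -/

import Mathlib

open MeasureTheory Set Filter Topology
open scoped ENNReal ContDiff

noncomputable section

namespace SignedTransport

section Measures

variable {E : Type*} [NormedAddCommGroup E] [MeasurableSpace E] [BorelSpace E]

/-- The total mass `|μ| = μ⁺(E) + μ⁻(E)` of a finite signed measure (Jordan decomposition). -/
def mass (μ : SignedMeasure E) : ℝ := (μ.totalVariation univ).toReal

/-- The support of a signed measure: the support of `μ⁺ + μ⁻`. -/
def supp (μ : SignedMeasure E) : Set E := μ.totalVariation.support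

/-- `π` is a transference plan between `μ` and `ν`: its marginals are `μ` and `ν`. -/
def IsPlan (μ ν : FiniteMeasure E) (π : Measure (E × E)) : Prop :=
  π.fst = (μ : Measure E) ∧ π.snd = (ν : Measure E)

/-- The Wasserstein distance `W₁` between two positive measures of the same mass, with values in
`[0, ∞]` (it is infinite if every plan has infinite cost). -/
def wasserstein (μ ν : FiniteMeasure E) : ℝ≥0∞ :=
  ⨅ (π : Measure (E × E)) (_ : IsPlan μ ν π), ∫⁻ p, edist p.1 p.2 ∂π

/-- The cost `a (|μ - μ'| + |ν - ν'|) + b W₁(μ', ν')`. -/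
def removalTransportCost (a b : ℝ) (μ ν μ' ν' : FiniteMeasure E) : ℝ≥0∞ :=
  ENNReal.ofReal a *
      (((μ : Measure E).toSignedMeasure - (μ' : Measure E).toSignedMeasure).totalVariation univ +
        ((ν : Measure E).toSignedMeasure - (ν' : Measure E).toSignedMeasure).totalVariation univ) +
    ENNReal.ofReal b * wasserstein μ' ν'

/-- The generalized Wasserstein distance `W₁^{a,b}` between two finite positive measures.
The infimum is finite: `μ' = ν' = 0` has cost `a (|μ| + |ν|)`. -/
def genWasserstein (a b : ℝ) (μ ν : FiniteMeasure E) : ℝ :=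
  (⨅ (μ' : FiniteMeasure E) (ν' : FiniteMeasure E) (_ : μ'.mass = ν'.mass),
    removalTransportCost a b μ ν μ' ν').toReal

/-- The positive part of the Jordan decomposition. -/
def jordanPos (μ : SignedMeasure E) : FiniteMeasure E :=
  ⟨μ.toJordanDecomposition.posPart, inferInstance⟩

/-- The negative part of the Jordan decomposition. -/
def jordanNeg (μ : SignedMeasure E) : FiniteMeasure E :=
  ⟨μ.toJordanDecomposition.negPart, inferInstance⟩

/-- The norm `‖μ‖^{a,b} = W₁^{a,b}(μ⁺, μ⁻)` on finite signed measures. -/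
def gwNorm (a b : ℝ) (μ : SignedMeasure E) : ℝ :=
  genWasserstein a b (jordanPos μ) (jordanNeg μ)

end Measures

section Equation

variable {d : ℕ}

/-- Finite signed Borel (equivalently, Radon) measures on `ℝ^d`. -/
abbrev Ms (d : ℕ) : Type := SignedMeasure (EuclideanSpace ℝ (Fin d))

/-- (H-1): `‖v[μ] - v[ν]‖_{C⁰} ≤ K ‖μ - ν‖^{a,b}`. -/
def H1 (a b : ℝ) (v : Ms d → EuclideanSpace ℝ (Fin d) → EuclideanSpace ℝ (Fin d)) (K : ℝ) :
    Prop :=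
  ∀ μ ν : Ms d, ∀ x, ‖v μ x - v ν x‖ ≤ K * gwNorm a b (μ - ν)

/-- (H-2): every `v[μ]` is `L`-Lipschitz and bounded by `M`. (`0 ≤ L` is automatic for `1 ≤ d`.) -/
def H2 (v : Ms d → EuclideanSpace ℝ (Fin d) → EuclideanSpace ℝ (Fin d)) (L M : ℝ) : Prop :=
  0 ≤ L ∧ ∀ μ : Ms d, (∀ x y, ‖v μ x - v μ y‖ ≤ L * ‖x - y‖) ∧ ∀ x, ‖v μ x‖ ≤ M

/-- (H-3): `h` is `Q`-Lipschitz for `‖·‖^{a,b}`, with mass at most `P` and support in the closed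
ball of radius `R` around the origin. -/
def H3 (a b : ℝ) (h : Ms d → Ms d) (Q P R : ℝ) : Prop :=
  (∀ μ ν : Ms d, gwNorm a b (h μ - h ν) ≤ Q * gwNorm a b (μ - ν)) ∧
    ∀ μ : Ms d, mass (h μ) ≤ P ∧ supp (h μ) ⊆ Metric.closedBall 0 R

/-- `μ` (only its values on `[0,1]` matter) is a measure-valued weak solution on `[0,1]` of
`∂ₜ μₜ + div (v[μₜ] μₜ) = h[μₜ]` with initial datum `μ₀`. -/
structure IsWeakSolution (a b : ℝ)
    (v : Ms d → EuclideanSpace ℝ (Fin d) → EuclideanSpace ℝ (Fin d)) (h : Ms d → Ms d)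
    (μ₀ : Ms d) (μ : ℝ → Ms d) : Prop where
  /-- `μ ∈ C⁰([0,1], (M^s, ‖·‖^{a,b}))` -/
  continuous : ∀ s ∈ Icc (0 : ℝ) 1,
    Tendsto (fun t => gwNorm a b (μ t - μ s)) (𝓝[Icc 0 1] s) (𝓝 0)
  initial : μ 0 = μ₀
  /-- `d/dt ⟨Φ, μₜ⟩ = ⟨v[μₜ] · ∇Φ, μₜ⟩ + ⟨Φ, h[μₜ]⟩` for every test function `Φ`; here
  `fderiv ℝ Φ x w = w · ∇Φ(x)`, and the derivative is one-sided at `t = 0` and `t = 1`. -/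
  weak : ∀ Φ : EuclideanSpace ℝ (Fin d) → ℝ, ContDiff ℝ ∞ Φ → HasCompactSupport Φ →
    ∀ t ∈ Icc (0 : ℝ) 1,
      HasDerivWithinAt (fun s => ∫ᵛ x, Φ x ∂<•(μ s))
        ((∫ᵛ x, fderiv ℝ Φ x (v (μ t) x) ∂<•(μ t)) + ∫ᵛ x, Φ x ∂<•(h (μ t)))
        (Icc 0 1) t

end Equation

end SignedTransport

end

/-!
Everything rests on a duality: `‖μ‖^{a,b}` is the supremum of `∫ φ dμ` over the functions `φ` with
`|φ| ≤ a` and Lipschitz constant `b`. It is Kantorovich duality for the partial transport problem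
with reward `max 0 (2 a - b |x - y|)`, and follows from the Hahn-Banach and Riesz theorems. Every
estimate thereby becomes an estimate on test functions.

A solution is the limit of the explicit Euler schemes with steps `2⁻ⁿ`: halving the step moves the
scheme by `O(2⁻ⁿ)`, and since masses stay bounded, vague compactness provides limits in the norm.

For an arbitrary weak solution, with no representation along characteristics at hand, the test
function is transported backwards instead, by explicit steps of a mollified velocity. Mollification
at a fixed scale keeps the second derivatives of the test functions bounded whatever the number of
steps, so the total error of the steps tends to zero, up to an error that vanishes with the scale.
With test functions of the dual unit ball this bounds `D t = ‖μ_t - ν_t‖^{a,b}` by `exp (L (t - s))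
(D s + Γ (t - s) sup D)`, and Grönwall's inequality gives stability and uniqueness. With other test
functions it gives the bounds on mass, support and time regularity.
-/

noncomputable section

namespace SignedTransport

open scoped BoundedContinuousFunction CompactlySupported Convolution

section Functions

/-- Bounded continuous real functions, as a predicate on bare functions. -/
def IsBoundedContinuous {X : Type*} [TopologicalSpace X] (f : X → ℝ) : Prop :=
  Continuous f ∧ ∃ C, ∀ x, |f x| ≤ C

/-- Functions bounded by `B` and Lipschitz with constant `Λ`. With `B = a` and `Λ = b` these are the
competitors in the dual description of `gwNorm a b`. -/
structure IsBoundedLipschitz {E : Type*} [SeminormedAddCommGroup E] (B Λ : ℝ) (f : E → ℝ) :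
    Prop where
  bound : ∀ x, |f x| ≤ B
  lip : ∀ x y, |f x - f y| ≤ Λ * ‖x - y‖

section Continuous

variable {X Y : Type*} [TopologicalSpace X] [TopologicalSpace Y] {f g : X → ℝ}

lemma IsBoundedContinuous.add (hf : IsBoundedContinuous f) (hg : IsBoundedContinuous g) :
    IsBoundedContinuous fun x => f x + g x := by
  obtain ⟨hf, C, hC⟩ := hf
  obtain ⟨hg, D, hD⟩ := hg
  exact ⟨hf.add hg, C + D, fun x => (abs_add_le _ _).trans (add_le_add (hC x) (hD x))⟩

lemma IsBoundedContinuous.const_mul (hf : IsBoundedContinuous f) (c : ℝ) :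
    IsBoundedContinuous fun x => c * f x := by
  obtain ⟨hf, C, hC⟩ := hf
  exact ⟨continuous_const.mul hf, |c| * C, fun x => by
    rw [abs_mul]; exact mul_le_mul_of_nonneg_left (hC x) (abs_nonneg c)⟩

lemma IsBoundedContinuous.sub (hf : IsBoundedContinuous f) (hg : IsBoundedContinuous g) :
    IsBoundedContinuous fun x => f x - g x := by
  simpa [sub_eq_add_neg] using hf.add (hg.const_mul (-1))

lemma IsBoundedContinuous.comp (hf : IsBoundedContinuous f) {T : Y → X} (hT : Continuous T) :
    IsBoundedContinuous fun y => f (T y) :=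
  ⟨hf.1.comp hT, hf.2.imp fun _ h y => h (T y)⟩

lemma IsBoundedContinuous.integrable [MeasurableSpace X] [OpensMeasurableSpace X]
    (hf : IsBoundedContinuous f) (ν : Measure X) [IsFiniteMeasure ν] : Integrable f ν := by
  obtain ⟨hf, C, hC⟩ := hf
  exact Integrable.of_bound hf.measurable.aestronglyMeasurable C (Eventually.of_forall hC)

end Continuous

section Lipschitz

variable {E F : Type*} [SeminormedAddCommGroup E] [SeminormedAddCommGroup F]
  {B B' C Λ Λ' : ℝ} {f : E → ℝ}

lemma continuous_of_norm_sub_le {w : E → F} (hw : ∀ x y, ‖w x - w y‖ ≤ Λ * ‖x - y‖) :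
    Continuous w := by
  have hlip : LipschitzWith Λ.toNNReal w := LipschitzWith.of_dist_le_mul fun x y => by
    rw [dist_eq_norm_sub, dist_eq_norm_sub]
    exact (hw x y).trans (by gcongr; exact Real.le_coe_toNNReal Λ)
  exact hlip.continuous

lemma IsBoundedLipschitz.isBoundedContinuous (hf : IsBoundedLipschitz B Λ f) :
    IsBoundedContinuous f :=
  ⟨continuous_of_norm_sub_le hf.lip, B, hf.bound⟩

lemma IsBoundedLipschitz.bound_nonneg (hf : IsBoundedLipschitz B Λ f) : 0 ≤ B :=
  (abs_nonneg _).trans (hf.bound 0)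

lemma IsBoundedLipschitz.mono (hf : IsBoundedLipschitz B Λ f) (hB : B ≤ B') (hΛ : Λ ≤ Λ') :
    IsBoundedLipschitz B' Λ' f :=
  ⟨fun x => (hf.bound x).trans hB, fun x y => (hf.lip x y).trans (by gcongr)⟩

lemma IsBoundedLipschitz.const_mul (hf : IsBoundedLipschitz B Λ f) (c : ℝ) :
    IsBoundedLipschitz (|c| * B) (|c| * Λ) fun x => c * f x where
  bound x := by
    rw [abs_mul]
    exact mul_le_mul_of_nonneg_left (hf.bound x) (abs_nonneg c)
  lip x y := by
    rw [← mul_sub, abs_mul, mul_assoc]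
    exact mul_le_mul_of_nonneg_left (hf.lip x y) (abs_nonneg c)

lemma IsBoundedLipschitz.neg (hf : IsBoundedLipschitz B Λ f) :
    IsBoundedLipschitz B Λ fun x => -f x := by
  simpa using hf.const_mul (-1)

lemma IsBoundedLipschitz.comp (hf : IsBoundedLipschitz B Λ f) (hΛ : 0 ≤ Λ) {T : F → E}
    (hT : ∀ x y, ‖T x - T y‖ ≤ C * ‖x - y‖) :
    IsBoundedLipschitz B (Λ * C) fun x => f (T x) where
  bound x := hf.bound _
  lip x y := (hf.lip _ _).trans (by
    rw [mul_assoc]; exact mul_le_mul_of_nonneg_left (hT x y) hΛ)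

end Lipschitz

end Functions

section Pairing

/-- The pairing `⟨μ, f⟩ = ∫ f dμ` of a signed measure with a real function. -/
def pairing {X : Type*} [MeasurableSpace X] (μ : SignedMeasure X) (f : X → ℝ) : ℝ :=
  ∫ᵛ x, f x ∂<•μ

section Measurable

variable {X : Type*} [MeasurableSpace X]

instance instIsFiniteMeasureVariation (μ : SignedMeasure X) : IsFiniteMeasure μ.variation := by
  rw [← SignedMeasure.totalVariation_eq_variation, SignedMeasure.totalVariation]
  infer_instance

lemma pairing_const_mul (μ : SignedMeasure X) (c : ℝ) (f : X → ℝ) :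
    pairing μ (fun x => c * f x) = c * pairing μ f :=
  VectorMeasure.integral_fun_smul μ _ c f

lemma pairing_neg (μ : SignedMeasure X) (f : X → ℝ) :
    pairing μ (fun x => -f x) = -pairing μ f := by
  simpa using pairing_const_mul μ (-1) f

lemma pairing_smul_measure (c : ℝ) (μ : SignedMeasure X) (f : X → ℝ) :
    pairing (c • μ) f = c * pairing μ f :=
  VectorMeasure.integral_smul_vectorMeasure f c

lemma pairing_neg_measure (μ : SignedMeasure X) (f : X → ℝ) :
    pairing (-μ) f = -pairing μ f := by
  rw [← neg_one_smul ℝ μ, pairing_smul_measure, neg_one_mul]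

lemma pairing_toSignedMeasure (ν : Measure X) [IsFiniteMeasure ν] (f : X → ℝ) :
    pairing ν.toSignedMeasure f = ∫ x, f x ∂ν :=
  VectorMeasure.integral_toSignedMeasure

end Measurable

section Continuous

variable {X Y : Type*} [TopologicalSpace X] [MeasurableSpace X] [OpensMeasurableSpace X]
  [TopologicalSpace Y] [MeasurableSpace Y] [BorelSpace Y] {f g : X → ℝ}

lemma pairing_sub (μ : SignedMeasure X) (hf : IsBoundedContinuous f) (hg : IsBoundedContinuous g) :
    pairing μ (fun x => f x - g x) = pairing μ f - pairing μ g :=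
  VectorMeasure.integral_fun_sub (hf.integrable _) (hg.integrable _)

lemma pairing_add_measure (μ ν : SignedMeasure X) (hf : IsBoundedContinuous f) :
    pairing (μ + ν) f = pairing μ f + pairing ν f :=
  VectorMeasure.integral_add_vectorMeasure (hf.integrable _) (hf.integrable _)

lemma pairing_sub_measure (μ ν : SignedMeasure X) (hf : IsBoundedContinuous f) :
    pairing (μ - ν) f = pairing μ f - pairing ν f :=
  VectorMeasure.integral_sub_vectorMeasure (hf.integrable _) (hf.integrable _)

lemma pairing_map (μ : SignedMeasure X) {T : X → Y} (hT : Continuous T) {f : Y → ℝ}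
    (hf : IsBoundedContinuous f) : pairing (μ.map T) f = pairing μ (fun x => f (T x)) :=
  VectorMeasure.integral_map hT.measurable hf.1.measurable.aestronglyMeasurable
    ((hf.comp hT).integrable _)

lemma tendsto_pairing_of_dominated (μ : SignedMeasure X) {F : ℕ → X → ℝ} (C : ℝ)
    (hF : ∀ n, Continuous (F n)) (hC : ∀ n x, |F n x| ≤ C)
    (hlim : ∀ x, Tendsto (fun n => F n x) atTop (𝓝 (f x))) :
    Tendsto (fun n => pairing μ (F n)) atTop (𝓝 (pairing μ f)) :=
  VectorMeasure.tendsto_integral_of_dominated_convergence (fun _ => C)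
    (fun n => (hF n).measurable.aestronglyMeasurable) (integrable_const _)
    (fun n => Eventually.of_forall (hC n)) (Eventually.of_forall hlim)

end Continuous

section Mass

variable {X : Type*} [MeasurableSpace X]

lemma mass_eq_variation (μ : SignedMeasure X) : mass μ = μ.variation.real univ := by
  rw [mass, SignedMeasure.totalVariation_eq_variation, measureReal_def]

lemma mass_nonneg (μ : SignedMeasure X) : 0 ≤ mass μ := ENNReal.toReal_nonneg

lemma ofReal_mass (μ : SignedMeasure X) : ENNReal.ofReal (mass μ) = μ.totalVariation univ := by
  rw [mass, SignedMeasure.totalVariation_eq_variation, ENNReal.ofReal_toReal (measure_ne_top _ _)]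

lemma abs_pairing_le_of_ae (μ : SignedMeasure X) {f : X → ℝ} {C : ℝ}
    (hC : ∀ᵐ x ∂μ.totalVariation, |f x| ≤ C) : |pairing μ f| ≤ C * mass μ := by
  rw [SignedMeasure.totalVariation_eq_variation] at hC
  have hB : ‖(ContinuousLinearMap.lsmul ℝ ℝ (E := ℝ)).flip‖ = 1 := by
    rw [ContinuousLinearMap.opNorm_flip, ContinuousLinearMap.opNorm_lsmul]
  have hint := VectorMeasure.norm_integral_le_of_norm_le_const (μ := μ)
    (B := (ContinuousLinearMap.lsmul ℝ ℝ (E := ℝ)).flip) (f := f) (C := C) hC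
  rwa [hB, mul_one, ← mass_eq_variation] at hint

lemma abs_pairing_le (μ : SignedMeasure X) {f : X → ℝ} {C : ℝ} (hC : ∀ x, |f x| ≤ C) :
    |pairing μ f| ≤ C * mass μ := abs_pairing_le_of_ae μ (Eventually.of_forall hC)

lemma abs_pairing_le_mul_of_mass_le [Nonempty X] {μ : SignedMeasure X} {f : X → ℝ} {C m : ℝ}
    (hm : mass μ ≤ m) (hC : ∀ x, |f x| ≤ C) : |pairing μ f| ≤ C * m :=
  (abs_pairing_le μ hC).trans
    (mul_le_mul_of_nonneg_left hm ((abs_nonneg _).trans (hC (Classical.arbitrary X))))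

lemma pairing_eq_zero_of_ae (μ : SignedMeasure X) {f : X → ℝ}
    (hf : ∀ᵐ x ∂μ.totalVariation, f x = 0) : pairing μ f = 0 := by
  simpa using abs_pairing_le_of_ae (C := 0) μ (hf.mono fun x hx => by simp [hx])

lemma eq_jordanPos_sub_jordanNeg (μ : SignedMeasure X) :
    μ = (jordanPos μ : Measure X).toSignedMeasure - (jordanNeg μ : Measure X).toSignedMeasure :=
  (SignedMeasure.toSignedMeasure_toJordanDecomposition μ).symm

lemma pairing_eq_integral_sub_integral [TopologicalSpace X] [OpensMeasurableSpace X]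
    (μ : SignedMeasure X) {f : X → ℝ} (hf : IsBoundedContinuous f) :
    pairing μ f = ∫ x, f x ∂(jordanPos μ : Measure X) - ∫ x, f x ∂(jordanNeg μ : Measure X) := by
  conv_lhs => rw [eq_jordanPos_sub_jordanNeg μ]
  rw [pairing_sub_measure _ _ hf, pairing_toSignedMeasure, pairing_toSignedMeasure]

end Mass

end Pairing

section WeakDuality

variable {E : Type*} [NormedAddCommGroup E] [MeasurableSpace E]

lemma abs_integral_sub_integral_le_mass {X : Type*} [TopologicalSpace X] [MeasurableSpace X]
    [OpensMeasurableSpace X] (ρ ρ' : Measure X) [IsFiniteMeasure ρ] [IsFiniteMeasure ρ']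
    {f : X → ℝ} {C : ℝ} (hf : Continuous f) (hC : ∀ x, |f x| ≤ C) :
    |∫ x, f x ∂ρ - ∫ x, f x ∂ρ'| ≤ C * mass (ρ.toSignedMeasure - ρ'.toSignedMeasure) := by
  rw [← pairing_toSignedMeasure, ← pairing_toSignedMeasure, ← pairing_sub_measure _ _ ⟨hf, C, hC⟩]
  exact abs_pairing_le _ hC

lemma ofReal_integral_dist {π : Measure (E × E)}
    (hπ : Integrable (fun p : E × E => dist p.1 p.2) π) :
    ENNReal.ofReal (∫ p, dist p.1 p.2 ∂π) = ∫⁻ p, edist p.1 p.2 ∂π := by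
  rw [ofReal_integral_eq_lintegral_ofReal hπ (Eventually.of_forall fun p => dist_nonneg)]
  exact lintegral_congr fun p => (edist_dist _ _).symm

lemma IsPlan.isFiniteMeasure {X : Type*} [MeasurableSpace X] {ρ σ : FiniteMeasure X}
    {π : Measure (X × X)} (hπ : IsPlan ρ σ π) : IsFiniteMeasure π :=
  ⟨by rw [← Measure.fst_univ, hπ.1]; exact measure_lt_top _ _⟩

lemma IsPlan.integral_sub_le [BorelSpace E] [SecondCountableTopology E] {B b : ℝ} {f : E → ℝ}
    (hf : IsBoundedLipschitz B b f) {ρ σ : FiniteMeasure E} {π : Measure (E × E)}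
    (hπ : IsPlan ρ σ π) (hfin : ∫⁻ p, edist p.1 p.2 ∂π ≠ ⊤) :
    ∫ x, f x ∂(ρ : Measure E) - ∫ x, f x ∂(σ : Measure E) ≤
      b * (∫⁻ p, edist p.1 p.2 ∂π).toReal := by
  have := hπ.isFiniteMeasure
  have hbc := hf.isBoundedContinuous
  have hint₁ := (hbc.comp continuous_fst).integrable π
  have hint₂ := (hbc.comp continuous_snd).integrable π
  have hdist : Integrable (fun p : E × E => dist p.1 p.2) π := by
    refine ⟨continuous_dist.aestronglyMeasurable,
      (lintegral_congr fun p => ?_).trans_lt hfin.lt_top⟩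
    rw [edist_dist, Real.enorm_eq_ofReal dist_nonneg]
  rw [← ofReal_integral_dist hdist, ENNReal.toReal_ofReal (integral_nonneg fun p => dist_nonneg),
    ← integral_const_mul, ← hπ.1, ← hπ.2, Measure.fst, Measure.snd,
    integral_map measurable_fst.aemeasurable hbc.1.aestronglyMeasurable,
    integral_map measurable_snd.aemeasurable hbc.1.aestronglyMeasurable, ← integral_sub hint₁ hint₂]
  refine integral_mono (hint₁.sub hint₂) (hdist.const_mul b) fun p => ?_
  simpa [dist_eq_norm_sub] using (le_abs_self _).trans (hf.lip p.1 p.2)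

variable {a b : ℝ} {f : E → ℝ}

lemma ofReal_integral_sub_le_removalTransportCost [BorelSpace E] [SecondCountableTopology E]
    (ha : 0 < a) (hb : 0 < b) (hf : IsBoundedLipschitz a b f) (ρ σ ρ' σ' : FiniteMeasure E) :
    ENNReal.ofReal (∫ x, f x ∂(ρ : Measure E) - ∫ x, f x ∂(σ : Measure E)) ≤
      removalTransportCost a b ρ σ ρ' σ' := by
  have hb' : ENNReal.ofReal b ≠ 0 := by simpa using hb
  rw [removalTransportCost, ← tsub_le_iff_left, mul_comm (ENNReal.ofReal b),
    ← ENNReal.div_le_iff_le_mul (Or.inl hb') (Or.inl ENNReal.ofReal_ne_top), wasserstein]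
  refine le_iInf₂ fun π hπ => ?_
  rw [ENNReal.div_le_iff_le_mul (Or.inl hb') (Or.inl ENNReal.ofReal_ne_top), tsub_le_iff_left]
  by_cases hfin : ∫⁻ p, edist p.1 p.2 ∂π = ⊤
  · rw [hfin, ENNReal.top_mul hb', add_top]
    exact le_top
  have hbc := hf.isBoundedContinuous
  have hρ := (le_abs_self _).trans
    (abs_integral_sub_integral_le_mass (ρ : Measure E) ρ' hbc.1 hf.bound)
  have hσ := (neg_le_abs _).trans
    (abs_integral_sub_integral_le_mass (σ : Measure E) σ' hbc.1 hf.bound)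
  have htransport := hπ.integral_sub_le hf hfin
  rw [← ofReal_mass, ← ofReal_mass, ← ENNReal.ofReal_toReal hfin,
    ← ENNReal.ofReal_add (mass_nonneg _) (mass_nonneg _), ← ENNReal.ofReal_mul ha.le,
    ← ENNReal.ofReal_mul ENNReal.toReal_nonneg, ← ENNReal.ofReal_add
      (mul_nonneg ha.le (add_nonneg (mass_nonneg _) (mass_nonneg _)))
      (mul_nonneg ENNReal.toReal_nonneg hb.le)]
  exact ENNReal.ofReal_le_ofReal (by linarith)

lemma wasserstein_zero : wasserstein (0 : FiniteMeasure E) 0 = 0 :=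
  le_antisymm
    (iInf₂_le_of_le 0 ⟨by simp [Measure.fst], by simp [Measure.snd]⟩ (by simp)) bot_le

lemma iInf_removalTransportCost_ne_top (a b : ℝ) (ρ σ : FiniteMeasure E) :
    (⨅ (ρ' : FiniteMeasure E) (σ' : FiniteMeasure E) (_ : ρ'.mass = σ'.mass),
      removalTransportCost a b ρ σ ρ' σ') ≠ ⊤ := by
  refine ne_top_of_le_ne_top ?_ (iInf_le_of_le 0 (iInf_le_of_le 0 (iInf_le_of_le rfl le_rfl)))
  rw [removalTransportCost, wasserstein_zero, mul_zero, add_zero, ← ofReal_mass, ← ofReal_mass]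
  finiteness

lemma integral_sub_le_genWasserstein [BorelSpace E] [SecondCountableTopology E] (ha : 0 < a)
    (hb : 0 < b) (hf : IsBoundedLipschitz a b f) (ρ σ : FiniteMeasure E) :
    ∫ x, f x ∂(ρ : Measure E) - ∫ x, f x ∂(σ : Measure E) ≤ genWasserstein a b ρ σ :=
  (ENNReal.ofReal_le_iff_le_toReal (iInf_removalTransportCost_ne_top _ _ _ _)).1 <|
    le_iInf fun ρ' => le_iInf fun σ' => le_iInf fun _ =>
      ofReal_integral_sub_le_removalTransportCost ha hb hf ρ σ ρ' σ'

lemma gwNorm_nonneg (a b : ℝ) (μ : SignedMeasure E) : 0 ≤ gwNorm a b μ := ENNReal.toReal_nonneg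

lemma pairing_le_gwNorm [BorelSpace E] [SecondCountableTopology E] (ha : 0 < a) (hb : 0 < b)
    (μ : SignedMeasure E) (hf : IsBoundedLipschitz a b f) : pairing μ f ≤ gwNorm a b μ := by
  rw [pairing_eq_integral_sub_integral μ hf.isBoundedContinuous]
  exact integral_sub_le_genWasserstein ha hb hf _ _

lemma pairing_le_mul_gwNorm [BorelSpace E] [SecondCountableTopology E] (ha : 0 < a) (hb : 0 < b)
    (μ : SignedMeasure E) {c : ℝ} (hc : 0 ≤ c) (hf : IsBoundedLipschitz (c * a) (c * b) f) :
    pairing μ f ≤ c * gwNorm a b μ := by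
  rcases hc.eq_or_lt with rfl | hc
  · simpa using (le_abs_self _).trans (abs_pairing_le μ (C := 0) fun x => by simpa using hf.bound x)
  have hscaled : IsBoundedLipschitz a b fun x => c⁻¹ * f x := by
    simpa only [abs_of_pos (inv_pos.2 hc), inv_mul_cancel_left₀ hc.ne'] using hf.const_mul c⁻¹
  rw [← inv_mul_le_iff₀ hc, ← pairing_const_mul]
  exact pairing_le_gwNorm ha hb μ hscaled

lemma abs_pairing_le_mul_gwNorm [BorelSpace E] [SecondCountableTopology E] (ha : 0 < a)
    (hb : 0 < b) (μ : SignedMeasure E) {c : ℝ} (hc : 0 ≤ c)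
    (hf : IsBoundedLipschitz (c * a) (c * b) f) : |pairing μ f| ≤ c * gwNorm a b μ := by
  have hneg := pairing_le_mul_gwNorm ha hb μ hc hf.neg
  rw [pairing_neg] at hneg
  exact abs_le.2 ⟨by linarith, pairing_le_mul_gwNorm ha hb μ hc hf⟩

end WeakDuality

section PartialTransport

variable {X Y : Type*} [TopologicalSpace X] [MeasurableSpace X] [TopologicalSpace Y]
  [MeasurableSpace Y]

/-- The set of values `∫ φ dρ + ∫ ψ dσ` over the nonnegative pairs with `f (x, y) ≤ φ x + ψ y`: the
dual of the partial transport problem of maximizing `∫ f dπ` over the measures `π` whose marginals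
are dominated by `ρ` and `σ`. -/
def dualValues (ρ : Measure X) (σ : Measure Y) (f : X × Y →ᵇ ℝ) : Set ℝ :=
  {r | ∃ (φ : X →ᵇ ℝ) (ψ : Y →ᵇ ℝ), (∀ x, 0 ≤ φ x) ∧ (∀ y, 0 ≤ ψ y) ∧
    (∀ x y, f (x, y) ≤ φ x + ψ y) ∧ r = ∫ x, φ x ∂ρ + ∫ y, ψ y ∂σ}

/-- The optimal value of the dual partial transport problem for the reward `f`. It is sublinear in
`f`, which is what the Hahn-Banach argument below needs. -/
def dualInf (ρ : Measure X) (σ : Measure Y) (f : X × Y →ᵇ ℝ) : ℝ := sInf (dualValues ρ σ f)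

section Sublinear

variable (ρ : Measure X) (σ : Measure Y)

lemma dualValues_nonneg {f : X × Y →ᵇ ℝ} {r : ℝ} (hr : r ∈ dualValues ρ σ f) : 0 ≤ r := by
  obtain ⟨φ, ψ, hφ, hψ, -, rfl⟩ := hr
  exact add_nonneg (integral_nonneg hφ) (integral_nonneg hψ)

lemma dualValues_nonempty (f : X × Y →ᵇ ℝ) : (dualValues ρ σ f).Nonempty :=
  ⟨_, BoundedContinuousFunction.const X ‖f‖, 0, fun _ => norm_nonneg f, fun _ => le_rfl,
    fun x y => by simpa using (le_abs_self _).trans (f.norm_coe_le_norm (x, y)), rfl⟩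

lemma dualInf_nonneg (f : X × Y →ᵇ ℝ) : 0 ≤ dualInf ρ σ f :=
  le_csInf (dualValues_nonempty ρ σ f) fun _ => dualValues_nonneg ρ σ

lemma dualInf_le {f : X × Y →ᵇ ℝ} (φ : X →ᵇ ℝ) (ψ : Y →ᵇ ℝ) (hφ : ∀ x, 0 ≤ φ x)
    (hψ : ∀ y, 0 ≤ ψ y) (h : ∀ x y, f (x, y) ≤ φ x + ψ y) :
    dualInf ρ σ f ≤ ∫ x, φ x ∂ρ + ∫ y, ψ y ∂σ :=
  csInf_le ⟨0, fun _ => dualValues_nonneg ρ σ⟩ ⟨φ, ψ, hφ, hψ, h, rfl⟩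

lemma dualInf_nonpos {f : X × Y →ᵇ ℝ} (hf : ∀ p, f p ≤ 0) : dualInf ρ σ f ≤ 0 := by
  simpa using dualInf_le ρ σ 0 0 (fun _ => le_rfl) (fun _ => le_rfl)
    fun x y => by simpa using hf (x, y)

lemma dualInf_zero : dualInf ρ σ 0 = 0 :=
  le_antisymm (dualInf_nonpos ρ σ fun _ => le_rfl) (dualInf_nonneg ρ σ 0)

lemma dualInf_smul_le {c : ℝ} (hc : 0 < c) (f : X × Y →ᵇ ℝ) :
    dualInf ρ σ (c • f) ≤ c * dualInf ρ σ f := by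
  rw [← inv_mul_le_iff₀ hc]
  refine le_csInf (dualValues_nonempty ρ σ f) ?_
  rintro r ⟨φ, ψ, hφ, hψ, h, rfl⟩
  rw [inv_mul_le_iff₀ hc]
  refine (dualInf_le ρ σ (c • φ) (c • ψ) (fun x => mul_nonneg hc.le (hφ x))
    (fun x => mul_nonneg hc.le (hψ x)) fun x y => ?_).trans (le_of_eq ?_)
  · simpa [mul_add] using mul_le_mul_of_nonneg_left (h x y) hc.le
  · simp [integral_const_mul, mul_add]

lemma dualInf_smul {c : ℝ} (hc : 0 < c) (f : X × Y →ᵇ ℝ) :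
    dualInf ρ σ (c • f) = c * dualInf ρ σ f := by
  refine le_antisymm (dualInf_smul_le ρ σ hc f) ?_
  simpa only [inv_smul_smul₀ hc.ne', le_inv_mul_iff₀ hc] using
    dualInf_smul_le ρ σ (inv_pos.2 hc) (c • f)

variable [OpensMeasurableSpace X] [OpensMeasurableSpace Y] [IsFiniteMeasure ρ] [IsFiniteMeasure σ]

lemma dualInf_add_le (f g : X × Y →ᵇ ℝ) :
    dualInf ρ σ (f + g) ≤ dualInf ρ σ f + dualInf ρ σ g := by
  rw [← sub_le_iff_le_add]
  refine le_csInf (dualValues_nonempty ρ σ f) ?_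
  rintro r ⟨φ, ψ, hφ, hψ, h, rfl⟩
  rw [sub_le_comm]
  refine le_csInf (dualValues_nonempty ρ σ g) ?_
  rintro s ⟨φ', ψ', hφ', hψ', h', rfl⟩
  rw [sub_le_iff_le_add]
  refine (dualInf_le ρ σ (φ + φ') (ψ + ψ') (fun x => add_nonneg (hφ x) (hφ' x))
    (fun x => add_nonneg (hψ x) (hψ' x)) fun x y => ?_).trans (le_of_eq ?_)
  · simp only [BoundedContinuousFunction.coe_add, Pi.add_apply]
    linarith [h x y, h' x y]
  · simp only [BoundedContinuousFunction.coe_add, Pi.add_apply]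
    rw [integral_add (φ.integrable ρ) (φ'.integrable ρ),
      integral_add (ψ.integrable σ) (ψ'.integrable σ)]
    ring

lemma mul_dualInf_le_dualInf_smul (c : ℝ) (f : X × Y →ᵇ ℝ) :
    c * dualInf ρ σ f ≤ dualInf ρ σ (c • f) := by
  rcases lt_trichotomy c 0 with hc | rfl | hc
  · have hadd := dualInf_add_le ρ σ (c • f) ((-c) • f)
    rw [← add_smul, add_neg_cancel, zero_smul, dualInf_zero, dualInf_smul ρ σ (neg_pos.2 hc)]
      at hadd
    linarith
  · simp [dualInf_zero]
  · rw [dualInf_smul ρ σ hc]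

lemma exists_linearMap_le_dualInf (f₀ : X × Y →ᵇ ℝ) :
    ∃ Λ : (X × Y →ᵇ ℝ) →ₗ[ℝ] ℝ, Λ f₀ = dualInf ρ σ f₀ ∧ ∀ f, Λ f ≤ dualInf ρ σ f := by
  rcases eq_or_ne f₀ 0 with rfl | hf₀
  · exact ⟨0, by simp [dualInf_zero], fun f => by simpa using dualInf_nonneg ρ σ f⟩
  obtain ⟨Λ, hΛ₀, hΛ⟩ := exists_extension_of_le_sublinear
    (LinearPMap.mkSpanSingleton f₀ (dualInf ρ σ f₀) hf₀) (dualInf ρ σ)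
    (fun c hc f => dualInf_smul ρ σ hc f) (dualInf_add_le ρ σ) (by
      rintro ⟨x, hx⟩
      obtain ⟨c, rfl⟩ := Submodule.mem_span_singleton.1 hx
      have happ : LinearPMap.mkSpanSingleton f₀ (dualInf ρ σ f₀) hf₀ ⟨c • f₀, hx⟩ =
          c • dualInf ρ σ f₀ := LinearPMap.mkSpanSingleton'_apply _ _ _ c hx
      rw [happ]
      exact mul_dualInf_le_dualInf_smul ρ σ c f₀)
  exact ⟨Λ, (hΛ₀ ⟨f₀, Submodule.mem_span_singleton_self f₀⟩).trans
    (LinearPMap.mkSpanSingleton_apply ℝ ℝ hf₀ (dualInf ρ σ f₀)), hΛ⟩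

end Sublinear

lemma linearMap_nonneg_of_le_dualInf {ρ : Measure X} {σ : Measure Y} {Λ : (X × Y →ᵇ ℝ) →ₗ[ℝ] ℝ}
    (hΛ : ∀ f, Λ f ≤ dualInf ρ σ f) {f : X × Y →ᵇ ℝ} (hf : ∀ p, 0 ≤ f p) : 0 ≤ Λ f := by
  have hneg := (hΛ (-f)).trans (dualInf_nonpos ρ σ fun p => by simpa using hf p)
  rwa [map_neg, neg_nonpos] at hneg

/-- The inclusion of `C_c(X)` into the bounded continuous functions, as a linear map. -/
def ofCompactSupport {X : Type*} [TopologicalSpace X] : C_c(X, ℝ) →ₗ[ℝ] (X →ᵇ ℝ) where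
  toFun f := f.toBoundedContinuousFunction
  map_add' _ _ := rfl
  map_smul' _ _ := rfl

@[simp]
lemma ofCompactSupport_apply {X : Type*} [TopologicalSpace X] (f : C_c(X, ℝ)) (x : X) :
    ofCompactSupport f x = f x := rfl

lemma exists_bump_of_isCompact {X : Type*} [TopologicalSpace X] [T2Space X] [LocallyCompactSpace X]
    {K U : Set X} (hK : IsCompact K) (hU : IsOpen U) (hKU : K ⊆ U) :
    ∃ f : C_c(X, ℝ), (∀ x ∈ K, f x = 1) ∧ (∀ x, 0 ≤ f x) ∧ (∀ x, f x ≤ 1) ∧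
      ∀ x ∉ U, f x = 0 := by
  obtain ⟨f, hone, hcompact, hsupp, hIcc⟩ :=
    exists_continuousMap_one_of_isCompact_subset_isOpen hK hU hKU
  exact ⟨⟨f, hcompact⟩, fun x hx => hone hx, fun x => (hIcc x).1, fun x => (hIcc x).2,
    fun x hx => image_eq_zero_of_notMem_tsupport fun h => hx (hsupp h)⟩

lemma exists_bump_one_sub_le_add {X Y : Type*} [TopologicalSpace X] [T2Space X]
    [LocallyCompactSpace X] [TopologicalSpace Y] [T2Space Y] [LocallyCompactSpace Y]
    (f : C_c(X, ℝ)) (g : C_c(Y, ℝ)) (hf : ∀ x, f x ≤ 1) (hg : ∀ y, g y ≤ 1) :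
    ∃ χ : C_c(X × Y, ℝ), (∀ p, χ p ≤ 1) ∧
      ∀ x y, 1 - χ (x, y) ≤ (1 - f x) + (1 - g y) := by
  obtain ⟨χ, hχ_one, hχ_nonneg, hχ_le, -⟩ := exists_bump_of_isCompact
    (f.hasCompactSupport.isCompact.prod g.hasCompactSupport.isCompact) isOpen_univ (subset_univ _)
  refine ⟨χ, hχ_le, fun x y => ?_⟩
  by_cases hx : x ∈ tsupport f
  · by_cases hy : y ∈ tsupport g
    · linarith [hχ_one (x, y) ⟨hx, hy⟩, hf x, hg y]
    · linarith [image_eq_zero_of_notMem_tsupport hy, hχ_nonneg (x, y), hf x]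
  · linarith [image_eq_zero_of_notMem_tsupport hx, hχ_nonneg (x, y), hg y]

lemma integral_le_measureReal_of_le_one [OpensMeasurableSpace X] {ν : Measure X}
    [IsFiniteMeasure ν] {U : Set X} (hU : IsOpen U) (f : X →ᵇ ℝ) (hle : ∀ x, f x ≤ 1)
    (hzero : ∀ x ∉ U, f x = 0) : ∫ x, f x ∂ν ≤ ν.real U := by
  rw [← integral_indicator_one hU.measurableSet]
  refine integral_mono (f.integrable ν)
    ((integrable_const (1 : ℝ)).indicator hU.measurableSet) fun x => ?_
  by_cases hx : x ∈ U
  · simp [hx, hle x]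
  · simp [hx, hzero x hx]

lemma measure_le_of_forall_isOpen {ν ν' : Measure X} [ν'.OuterRegular]
    (h : ∀ U, IsOpen U → ν U ≤ ν' U) : ν ≤ ν' := by
  refine Measure.le_iff.2 fun s _ => ?_
  rw [s.measure_eq_iInf_isOpen ν']
  exact le_iInf₂ fun U hsU => le_iInf fun hU => (measure_mono hsU).trans (h U hU)

lemma exists_isCompact_measureReal_compl_le [T2Space X] [OpensMeasurableSpace X] (ν : Measure X)
    [IsFiniteMeasure ν] [ν.InnerRegularCompactLTTop] {δ : ℝ} (hδ : 0 < δ) :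
    ∃ K : Set X, IsCompact K ∧ ν.real Kᶜ ≤ δ := by
  obtain ⟨K, -, hK, hlt⟩ := MeasurableSet.univ.exists_isCompact_lt_add
    (measure_ne_top ν univ) (ε := ENNReal.ofReal δ) (by simpa using hδ)
  refine ⟨K, hK, ?_⟩
  rw [measureReal_compl hK.measurableSet, measureReal_def, measureReal_def, sub_le_iff_le_add',
    ← ENNReal.toReal_ofReal hδ.le,
    ← ENNReal.toReal_add (measure_ne_top _ _) ENNReal.ofReal_ne_top]
  exact ENNReal.toReal_mono (by finiteness) hlt.le

lemma map_rieszMeasure_le {Z : Type*} [TopologicalSpace Z] [T2Space Z] [LocallyCompactSpace Z]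
    [MeasurableSpace Z] [BorelSpace Z] [T2Space X] [LocallyCompactSpace X] [BorelSpace X]
    (Λ : C_c(Z, ℝ) →ₚ[ℝ] ℝ) {T : Z → X} (hT : Continuous T) (ρ : Measure X) [IsFiniteMeasure ρ]
    [ρ.OuterRegular]
    (hΛ : ∀ (u : C_c(Z, ℝ)) (w : C_c(X, ℝ)), (∀ x, 0 ≤ w x) → (∀ z, u z ≤ w (T z)) →
      Λ u ≤ ∫ x, w x ∂ρ) :
    (RealRMK.rieszMeasure Λ).map T ≤ ρ := by
  refine measure_le_of_forall_isOpen fun U hU => ?_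
  rw [Measure.map_apply hT.measurable hU.measurableSet, (hU.preimage hT).measure_eq_iSup_isCompact]
  refine iSup₂_le fun K hKU => iSup_le fun hK => ?_
  obtain ⟨w, hw_one, hw_nonneg, hw_le, hw_zero⟩ :=
    exists_bump_of_isCompact (hK.image hT) hU (image_subset_iff.2 hKU)
  obtain ⟨χ, hχ_one, hχ_nonneg, hχ_le, -⟩ :=
    exists_bump_of_isCompact hK isOpen_univ (subset_univ K)
  let u : C_c(Z, ℝ) := ⟨⟨fun z => w (T z) * χ z, by fun_prop⟩, χ.hasCompactSupport.mul_left⟩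
  have hu : ∀ z, u z = w (T z) * χ z := fun _ => rfl
  refine (RealRMK.rieszMeasure_le_of_eq_one Λ (f := u)
    (fun z => mul_nonneg (hw_nonneg _) (hχ_nonneg _)) hK fun z hz => ?_).trans ?_
  · rw [hu, hw_one _ (mem_image_of_mem T hz), hχ_one _ hz, one_mul]
  · refine ENNReal.ofReal_le_of_le_toReal ((hΛ u w hw_nonneg fun z => ?_).trans
      (integral_le_measureReal_of_le_one hU (ofCompactSupport w) hw_le hw_zero))
    exact (hu z).le.trans (mul_le_of_le_one_right (hw_nonneg _) (hχ_le _))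

lemma integral_const_mul_one_sub_le [T2Space X] [OpensMeasurableSpace X] (ν : Measure X)
    [IsFiniteMeasure ν] {K : Set X} (hK : IsCompact K) {C : ℝ} (hC : 0 ≤ C) {w : C_c(X, ℝ)}
    (hw_one : ∀ x ∈ K, w x = 1) (hw_nonneg : ∀ x, 0 ≤ w x) :
    ∫ x, (C • (BoundedContinuousFunction.const X (1 : ℝ) - ofCompactSupport w)) x ∂ν ≤
      C * ν.real Kᶜ := by
  have hint := integral_le_measureReal_of_le_one (ν := ν) hK.isClosed.isOpen_compl
    (BoundedContinuousFunction.const X (1 : ℝ) - ofCompactSupport w)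
    (fun x => by simpa using hw_nonneg x) (fun x hx => by simp [hw_one x (not_not.1 hx)])
  refine le_trans (le_of_eq ?_) (mul_le_mul_of_nonneg_left hint hC)
  exact integral_const_mul _ _

variable [T2Space X] [LocallyCompactSpace X] [T2Space Y] [LocallyCompactSpace Y]
  [BorelSpace X] [BorelSpace Y]

lemma exists_compactlySupported_dualInf_sub_le (ρ : Measure X) (σ : Measure Y) [IsFiniteMeasure ρ]
    [IsFiniteMeasure σ] [ρ.InnerRegularCompactLTTop] [σ.InnerRegularCompactLTTop]
    {f₀ : X × Y →ᵇ ℝ} (hf₀ : ∀ p, 0 ≤ f₀ p) {ε : ℝ} (hε : 0 < ε) :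
    ∃ u : C_c(X × Y, ℝ), (∀ p, u p ≤ f₀ p) ∧ dualInf ρ σ (f₀ - ofCompactSupport u) ≤ ε := by
  obtain ⟨C, hC, hf₀C⟩ : ∃ C > 0, ∀ p, f₀ p ≤ C := ⟨‖f₀‖ + 1, by positivity, fun p =>
    ((le_abs_self _).trans (f₀.norm_coe_le_norm p)).trans (by linarith)⟩
  obtain ⟨K₁, hK₁, hρ⟩ := exists_isCompact_measureReal_compl_le ρ (δ := ε / (2 * C)) (by positivity)
  obtain ⟨K₂, hK₂, hσ⟩ := exists_isCompact_measureReal_compl_le σ (δ := ε / (2 * C)) (by positivity)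
  obtain ⟨f, hf_one, hf_nonneg, hf_le, -⟩ :=
    exists_bump_of_isCompact hK₁ isOpen_univ (subset_univ _)
  obtain ⟨g, hg_one, hg_nonneg, hg_le, -⟩ :=
    exists_bump_of_isCompact hK₂ isOpen_univ (subset_univ _)
  obtain ⟨χ, hχ_le, hχ⟩ := exists_bump_one_sub_le_add f g hf_le hg_le
  refine ⟨⟨⟨fun p => f₀ p * χ p, by fun_prop⟩, χ.hasCompactSupport.mul_left⟩,
    fun p => mul_le_of_le_one_right (hf₀ p) (hχ_le p), ?_⟩
  refine (dualInf_le ρ σ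
    (C • (BoundedContinuousFunction.const X (1 : ℝ) - ofCompactSupport f))
    (C • (BoundedContinuousFunction.const Y (1 : ℝ) - ofCompactSupport g))
    (fun x => mul_nonneg hC.le (sub_nonneg.2 (hf_le x)))
    (fun y => mul_nonneg hC.le (sub_nonneg.2 (hg_le y))) fun x y => ?_).trans ?_
  · change f₀ (x, y) - f₀ (x, y) * χ (x, y) ≤ C * (1 - f x) + C * (1 - g y)
    calc f₀ (x, y) - f₀ (x, y) * χ (x, y) = f₀ (x, y) * (1 - χ (x, y)) := by ring
      _ ≤ C * (1 - χ (x, y)) := by gcongr; exacts [sub_nonneg.2 (hχ_le _), hf₀C _]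
      _ ≤ C * ((1 - f x) + (1 - g y)) := by gcongr; exact hχ x y
      _ = C * (1 - f x) + C * (1 - g y) := by ring
  · calc _ ≤ C * ρ.real K₁ᶜ + C * σ.real K₂ᶜ :=
          add_le_add (integral_const_mul_one_sub_le ρ hK₁ hC.le hf_one hf_nonneg)
            (integral_const_mul_one_sub_le σ hK₂ hC.le hg_one hg_nonneg)
      _ ≤ C * (ε / (2 * C)) + C * (ε / (2 * C)) := by gcongr
      _ = ε := by field_simp; ring

theorem exists_partial_plan [SecondCountableTopology X] [SecondCountableTopology Y]
    (ρ : Measure X) (σ : Measure Y) [IsFiniteMeasure ρ] [IsFiniteMeasure σ]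
    {f₀ : X × Y →ᵇ ℝ} (hf₀ : ∀ p, 0 ≤ f₀ p) :
    ∃ π : Measure (X × Y), π.fst ≤ ρ ∧ π.snd ≤ σ ∧ dualInf ρ σ f₀ ≤ ∫ p, f₀ p ∂π := by
  obtain ⟨Λ, hΛ₀, hΛ⟩ := exists_linearMap_le_dualInf ρ σ f₀
  let Λc : C_c(X × Y, ℝ) →ₚ[ℝ] ℝ := PositiveLinearMap.mk₀ (Λ ∘ₗ ofCompactSupport)
    fun f hf => linearMap_nonneg_of_le_dualInf hΛ fun p => hf p
  set π := RealRMK.rieszMeasure Λc with hπ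
  have hfst : π.fst ≤ ρ := map_rieszMeasure_le Λc continuous_fst ρ fun u w hw huw =>
    (hΛ _).trans <| by
      simpa using dualInf_le ρ σ (ofCompactSupport w) 0 hw (fun _ => le_rfl)
        fun x y => by simpa using huw (x, y)
  have hsnd : π.snd ≤ σ := map_rieszMeasure_le Λc continuous_snd σ fun u w hw huw =>
    (hΛ _).trans <| by
      simpa using dualInf_le ρ σ 0 (ofCompactSupport w) (fun _ => le_rfl) hw
        fun x y => by simpa using huw (x, y)
  have hfin : IsFiniteMeasure π := ⟨by
    rw [← Measure.fst_univ]; exact (hfst univ).trans_lt (measure_lt_top ρ univ)⟩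
  refine ⟨π, hfst, hsnd, hΛ₀ ▸ le_of_forall_pos_le_add fun ε hε => ?_⟩
  obtain ⟨u, hu, hu_sub⟩ := exists_compactlySupported_dualInf_sub_le ρ σ hf₀ hε
  calc Λ f₀ = Λ (ofCompactSupport u) + Λ (f₀ - ofCompactSupport u) := by
        rw [← map_add, add_sub_cancel]
    _ ≤ ∫ p, u p ∂π + ε := by
        rw [hπ, RealRMK.integral_rieszMeasure]
        exact add_le_add le_rfl ((hΛ _).trans hu_sub)
    _ ≤ ∫ p, f₀ p ∂π + ε := by
        exact add_le_add
          (integral_mono ((ofCompactSupport u).integrable π) (f₀.integrable π) hu) le_rfl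

end PartialTransport

section StrongDuality

variable {E : Type*} [NormedAddCommGroup E] [MeasurableSpace E]

lemma mass_toSignedMeasure_sub_of_le {X : Type*} [MeasurableSpace X] {ρ ρ' : Measure X}
    [IsFiniteMeasure ρ] [IsFiniteMeasure ρ'] (h : ρ' ≤ ρ) :
    mass (ρ.toSignedMeasure - ρ'.toSignedMeasure) = ρ.real univ - ρ'.real univ := by
  rw [mass, SignedMeasure.totalVariation, Measure.toJordanDecomposition_toSignedMeasure_sub,
    Measure.jordanDecompositionOfToSignedMeasureSub_posPart,
    Measure.jordanDecompositionOfToSignedMeasureSub_negPart, Measure.sub_eq_zero_of_le h, add_zero,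
    Measure.sub_apply MeasurableSet.univ h, ENNReal.toReal_sub_of_le (h univ) (measure_ne_top _ _)]
  rfl

lemma fst_real_univ {X Y : Type*} [MeasurableSpace X] [MeasurableSpace Y] (π : Measure (X × Y)) :
    π.fst.real univ = π.real univ := by
  rw [measureReal_def, Measure.fst_univ, measureReal_def]

lemma snd_real_univ {X Y : Type*} [MeasurableSpace X] [MeasurableSpace Y] (π : Measure (X × Y)) :
    π.snd.real univ = π.real univ := by
  rw [measureReal_def, Measure.snd_univ, measureReal_def]

lemma wasserstein_fst_snd_le (π : Measure (E × E)) [IsFiniteMeasure π]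
    (hπ : Integrable (fun p : E × E => dist p.1 p.2) π) :
    wasserstein (⟨π.fst, inferInstance⟩ : FiniteMeasure E) ⟨π.snd, inferInstance⟩ ≤
      ENNReal.ofReal (∫ p, dist p.1 p.2 ∂π) :=
  (iInf₂_le π ⟨rfl, rfl⟩).trans (ofReal_integral_dist hπ).ge

lemma genWasserstein_le_of_partial_plan {a b : ℝ} (ha : 0 ≤ a) (hb : 0 ≤ b)
    (ρ σ : FiniteMeasure E) (π : Measure (E × E)) [IsFiniteMeasure π]
    (hρ : π.fst ≤ ρ) (hσ : π.snd ≤ σ)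
    (hπ : Integrable (fun p : E × E => dist p.1 p.2) π) :
    genWasserstein a b ρ σ ≤ a * ((ρ : Measure E).real univ + (σ : Measure E).real univ) -
      (2 * a * π.real univ - b * ∫ p, dist p.1 p.2 ∂π) := by
  let ρ' : FiniteMeasure E := ⟨π.fst, inferInstance⟩
  let σ' : FiniteMeasure E := ⟨π.snd, inferInstance⟩
  have hmass : ρ'.mass = σ'.mass :=
    congrArg ENNReal.toNNReal (Measure.fst_univ.trans Measure.snd_univ.symm)
  have hρ_removed : mass ((ρ : Measure E).toSignedMeasure - (ρ' : Measure E).toSignedMeasure) =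
      (ρ : Measure E).real univ - π.real univ :=
    (mass_toSignedMeasure_sub_of_le (ρ' := (ρ' : Measure E)) hρ).trans
      (congrArg _ (fst_real_univ π))
  have hσ_removed : mass ((σ : Measure E).toSignedMeasure - (σ' : Measure E).toSignedMeasure) =
      (σ : Measure E).real univ - π.real univ :=
    (mass_toSignedMeasure_sub_of_le (ρ' := (σ' : Measure E)) hσ).trans
      (congrArg _ (snd_real_univ π))
  have hremoval : 0 ≤ a * (mass ((ρ : Measure E).toSignedMeasure - (ρ' : Measure E).toSignedMeasure)
      + mass ((σ : Measure E).toSignedMeasure - (σ' : Measure E).toSignedMeasure)) :=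
    mul_nonneg ha (add_nonneg (mass_nonneg _) (mass_nonneg _))
  have htransport : 0 ≤ b * ∫ p, dist p.1 p.2 ∂π :=
    mul_nonneg hb (integral_nonneg fun _ => dist_nonneg)
  have hcost : removalTransportCost a b ρ σ ρ' σ' ≤ ENNReal.ofReal
      (a * (mass ((ρ : Measure E).toSignedMeasure - (ρ' : Measure E).toSignedMeasure) +
        mass ((σ : Measure E).toSignedMeasure - (σ' : Measure E).toSignedMeasure)) +
        b * ∫ p, dist p.1 p.2 ∂π) := by
    rw [removalTransportCost, ENNReal.ofReal_add hremoval htransport, ENNReal.ofReal_mul ha,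
      ENNReal.ofReal_mul hb, ENNReal.ofReal_add (mass_nonneg _) (mass_nonneg _), ofReal_mass,
      ofReal_mass]
    gcongr
    exact wasserstein_fst_snd_le π hπ
  refine (ENNReal.toReal_le_of_le_ofReal (add_nonneg hremoval htransport)
    ((iInf_le_of_le ρ' (iInf_le_of_le σ' (iInf_le_of_le hmass le_rfl))).trans hcost)).trans_eq ?_
  rw [hρ_removed, hσ_removed]
  ring

section Reward

variable {a b : ℝ} (ha : 0 < a) (hb : 0 < b)

/-- The gain `max 0 (2 a - b |x - y|)` from transporting a unit of mass from `x` to `y` rather than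
removing it at both ends. -/
def transportReward (E : Type*) [NormedAddCommGroup E] {a b : ℝ} (ha : 0 < a) (hb : 0 < b) :
    E × E →ᵇ ℝ :=
  BoundedContinuousFunction.ofNormedAddCommGroup (fun p => max 0 (2 * a - b * dist p.1 p.2))
    (by fun_prop) (2 * a) fun p => by
      rw [Real.norm_eq_abs, abs_of_nonneg (le_max_left _ _)]
      exact max_le (by positivity) (sub_le_self _ (by positivity))

variable [OpensMeasurableSpace E] [SecondCountableTopology E]

lemma measurableSet_mul_dist_le (a b : ℝ) : MeasurableSet {p : E × E | b * dist p.1 p.2 ≤ 2 * a} :=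
  (isClosed_le (by fun_prop) (by fun_prop)).measurableSet

include hb in
lemma integrableOn_dist_of_mul_dist_le (π : Measure (E × E)) [IsFiniteMeasure π] :
    IntegrableOn (fun p : E × E => dist p.1 p.2) {p | b * dist p.1 p.2 ≤ 2 * a} π := by
  refine Integrable.of_bound continuous_dist.aestronglyMeasurable (2 * a / b)
    ((ae_restrict_iff' (measurableSet_mul_dist_le a b)).2 (Eventually.of_forall fun p hp => ?_))
  rw [Real.norm_eq_abs, abs_of_nonneg dist_nonneg, le_div_iff₀ hb, mul_comm]
  exact hp

lemma integral_transportReward (π : Measure (E × E)) [IsFiniteMeasure π] :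
    ∫ p, transportReward E ha hb p ∂π =
      2 * a * π.real {p | b * dist p.1 p.2 ≤ 2 * a} -
        b * ∫ p in {p | b * dist p.1 p.2 ≤ 2 * a}, dist p.1 p.2 ∂π := by
  set S : Set (E × E) := {p | b * dist p.1 p.2 ≤ 2 * a}
  have hzero : ∀ p ∉ S, transportReward E ha hb p = 0 := fun p hp =>
    max_eq_left (sub_nonpos.2 (not_le.1 hp).le)
  calc ∫ p, transportReward E ha hb p ∂π
      = ∫ p in S, transportReward E ha hb p ∂π :=
        (setIntegral_eq_integral_of_forall_compl_eq_zero hzero).symm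
    _ = ∫ p in S, (2 * a - b * dist p.1 p.2) ∂π :=
        setIntegral_congr_fun (measurableSet_mul_dist_le a b) fun p hp =>
          max_eq_right (sub_nonneg.2 hp)
    _ = 2 * a * π.real S - b * ∫ p in S, dist p.1 p.2 ∂π := by
        rw [integral_sub (integrable_const _)
          ((integrableOn_dist_of_mul_dist_le hb π).const_mul b), integral_const_mul b,
          setIntegral_const, smul_eq_mul, mul_comm (2 * a)]

lemma genWasserstein_le_sub_integral_transportReward (ρ σ : FiniteMeasure E)
    (π : Measure (E × E)) (hρ : π.fst ≤ ρ) (hσ : π.snd ≤ σ) :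
    genWasserstein a b ρ σ ≤ a * ((ρ : Measure E).real univ + (σ : Measure E).real univ) -
      ∫ p, transportReward E ha hb p ∂π := by
  have hfinite : IsFiniteMeasure π := ⟨by
    rw [← Measure.fst_univ]; exact (hρ univ).trans_lt (measure_lt_top _ univ)⟩
  rw [integral_transportReward]
  simpa only [measureReal_restrict_apply_univ] using
    genWasserstein_le_of_partial_plan ha.le hb.le ρ σ
      (π.restrict {p | b * dist p.1 p.2 ≤ 2 * a})
      ((Measure.map_mono Measure.restrict_le_self measurable_fst).trans hρ)
      ((Measure.map_mono Measure.restrict_le_self measurable_snd).trans hσ)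
      (integrableOn_dist_of_mul_dist_le hb π)

end Reward

lemma exists_isBoundedLipschitz_between {E : Type*} [SeminormedAddCommGroup E] {a b : ℝ}
    (ha : 0 ≤ a) (hb : 0 ≤ b) {φ ψ : E → ℝ} (hφ : ∀ x, 0 ≤ φ x) (hψ : ∀ y, 0 ≤ ψ y)
    (h : ∀ x y, 2 * a - b * dist x y ≤ φ x + ψ y) :
    ∃ g : E → ℝ, IsBoundedLipschitz a b g ∧ (∀ x, a - φ x ≤ g x) ∧ ∀ x, g x ≤ ψ x - a := by
  have hbelow : ∀ x y, -a ≤ b * dist x y + ψ y - a := fun x y => by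
    linarith [hψ y, mul_nonneg hb (dist_nonneg (x := x) (y := y))]
  have hbdd : ∀ x, BddBelow (range fun y => b * dist x y + ψ y - a) := fun x =>
    ⟨-a, forall_mem_range.2 (hbelow x)⟩
  set u : E → ℝ := fun x => ⨅ y, (b * dist x y + ψ y - a)
  have hlip : ∀ x x', u x ≤ u x' + b * dist x x' := fun x x' => by
    rw [← sub_le_iff_le_add]
    refine le_ciInf fun y => ?_
    have htriangle : b * dist x y ≤ b * (dist x x' + dist x' y) := by
      gcongr; exact dist_triangle _ _ _
    linarith [ciInf_le (hbdd x) y]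
  refine ⟨fun x => min a (u x), ⟨fun x => abs_le.2 ⟨le_min (by linarith) (le_ciInf (hbelow x)),
    min_le_left _ _⟩, fun x y => ?_⟩, fun x => le_min (by linarith [hφ x]) (le_ciInf fun y => ?_),
    fun x => (min_le_right _ _).trans ?_⟩
  · refine (abs_min_sub_min_le_max a (u x) a (u y)).trans ?_
    rw [sub_self, abs_zero, ← dist_eq_norm_sub]
    have hlip' := hlip y x
    rw [dist_comm] at hlip'
    exact max_le (by positivity) (abs_le.2 ⟨by linarith, by linarith [hlip x y]⟩)
  · linarith [h x y]
  · simpa using ciInf_le (hbdd x) x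

variable [BorelSpace E] [ProperSpace E]

theorem genWasserstein_le_of_forall_isBoundedLipschitz {a b : ℝ} (ha : 0 < a) (hb : 0 < b)
    (ρ σ : FiniteMeasure E) {c : ℝ} (h : ∀ f : E → ℝ, IsBoundedLipschitz a b f →
      ∫ x, f x ∂(ρ : Measure E) - ∫ x, f x ∂(σ : Measure E) ≤ c) :
    genWasserstein a b ρ σ ≤ c := by
  obtain ⟨π, hπρ, hπσ, hdual⟩ := exists_partial_plan (ρ : Measure E) (σ : Measure E)
    (f₀ := transportReward E ha hb) fun p => le_max_left _ _
  refine (genWasserstein_le_sub_integral_transportReward ha hb ρ σ π hπρ hπσ).trans ?_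
  refine sub_le_comm.1 (le_trans (le_csInf (dualValues_nonempty _ _ _) ?_) hdual)
  rintro r ⟨φ, ψ, hφ, hψ, hle, rfl⟩
  obtain ⟨g, hg, hφg, hgψ⟩ := exists_isBoundedLipschitz_between ha.le hb.le hφ hψ fun x y =>
    (le_max_right _ _).trans (hle x y)
  have hgρ : ∫ x, (a - φ x) ∂(ρ : Measure E) ≤ ∫ x, g x ∂(ρ : Measure E) :=
    integral_mono ((integrable_const a).sub (φ.integrable _))
      (hg.isBoundedContinuous.integrable _) hφg
  have hgσ : ∫ x, g x ∂(σ : Measure E) ≤ ∫ x, (ψ x - a) ∂(σ : Measure E) :=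
    integral_mono (hg.isBoundedContinuous.integrable _)
      ((ψ.integrable _).sub (integrable_const a)) hgψ
  rw [integral_sub (integrable_const a) (φ.integrable _), integral_const, smul_eq_mul] at hgρ
  rw [integral_sub (ψ.integrable _) (integrable_const a), integral_const, smul_eq_mul] at hgσ
  linarith [h g hg]

theorem gwNorm_le_of_forall_isBoundedLipschitz {a b : ℝ} (ha : 0 < a) (hb : 0 < b)
    (μ : SignedMeasure E) {c : ℝ}
    (h : ∀ f : E → ℝ, IsBoundedLipschitz a b f → pairing μ f ≤ c) : gwNorm a b μ ≤ c :=
  genWasserstein_le_of_forall_isBoundedLipschitz ha hb _ _ fun f hf =>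
    (pairing_eq_integral_sub_integral μ hf.isBoundedContinuous).symm.trans_le (h f hf)

end StrongDuality

section Mollification

variable {E F : Type*} [NormedAddCommGroup E] [NormedSpace ℝ E] [NormedAddCommGroup F]
  [NormedSpace ℝ F]

lemma norm_convolution_sub_le {E F G H : Type*} [NormedAddCommGroup E] [MeasurableSpace E]
    [OpensMeasurableSpace E] [NormedAddCommGroup F] [NormedSpace ℝ F] [NormedAddCommGroup G]
    [NormedSpace ℝ G] [NormedAddCommGroup H] [NormedSpace ℝ H] (ν : Measure E)
    [IsFiniteMeasureOnCompacts ν] (B : G →L[ℝ] F →L[ℝ] H) {k : E → G} (hk : Continuous k)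
    (hk_supp : HasCompactSupport k) {w : E → F} {Λ : ℝ}
    (hw : ∀ x y, ‖w x - w y‖ ≤ Λ * ‖x - y‖) (x y : E) :
    ‖(k ⋆[B, ν] w) x - (k ⋆[B, ν] w) y‖ ≤ (‖B‖ * ∫ t, ‖k t‖ ∂ν) * (Λ * ‖x - y‖) := by
  have hint : ∀ z, Integrable (fun t => B (k t) (w (z - t))) ν := fun z =>
    ((B.continuous₂.comp (hk.prodMk ((continuous_of_norm_sub_le hw).comp
      (continuous_sub_left z)))).integrable_of_hasCompactSupport
        (hk_supp.mono fun t ht hzero => ht (by simp [hzero])))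
  have hkint : Integrable (fun t => ‖k t‖) ν := (hk.integrable_of_hasCompactSupport hk_supp).norm
  rw [convolution_def, convolution_def, ← integral_sub (hint x) (hint y), ← integral_const_mul,
    ← integral_mul_const]
  refine norm_integral_le_of_norm_le ((hkint.const_mul _).mul_const _)
    (Eventually.of_forall fun t => ?_)
  have hshift := hw (x - t) (y - t)
  rw [sub_sub_sub_cancel_right] at hshift
  rw [← map_sub]
  exact (B.le_opNorm₂ _ _).trans (by gcongr)

section Convolution

variable [FiniteDimensional ℝ E] [MeasurableSpace E] [BorelSpace E]

/-- A smooth nonnegative kernel supported in the unit ball, with integral one. -/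
def unitKernel (E : Type*) [NormedAddCommGroup E] [NormedSpace ℝ E] [FiniteDimensional ℝ E]
    [MeasurableSpace E] [BorelSpace E] : E → ℝ :=
  ContDiffBump.normed (⟨1 / 2, 1, by norm_num, by norm_num⟩ : ContDiffBump (0 : E))
    Measure.addHaar

lemma unitKernel_contDiff : ContDiff ℝ ∞ (unitKernel E) := ContDiffBump.contDiff_normed _

lemma unitKernel_hasCompactSupport : HasCompactSupport (unitKernel E) :=
  ContDiffBump.hasCompactSupport_normed _

lemma unitKernel_nonneg (x : E) : 0 ≤ unitKernel E x := ContDiffBump.nonneg_normed _ x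

lemma integral_unitKernel : ∫ x, unitKernel E x ∂Measure.addHaar = 1 :=
  ContDiffBump.integral_normed _

lemma integral_norm_unitKernel : ∫ x, ‖unitKernel E x‖ ∂Measure.addHaar = 1 := by
  simpa only [Real.norm_of_nonneg (unitKernel_nonneg _)] using integral_unitKernel (E := E)

lemma support_unitKernel : Function.support (unitKernel E) = Metric.ball 0 1 :=
  ContDiffBump.support_normed_eq _

/-- Convolution with the unit kernel. -/
def mollify (w : E → F) : E → F :=
  unitKernel E ⋆[ContinuousLinearMap.lsmul ℝ ℝ, Measure.addHaar] w

variable {w : E → F}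

lemma norm_mollify_sub_le {Λ : ℝ} (hw : ∀ x y, ‖w x - w y‖ ≤ Λ * ‖x - y‖) (x y : E) :
    ‖mollify w x - mollify w y‖ ≤ Λ * ‖x - y‖ := by
  refine (norm_convolution_sub_le Measure.addHaar (ContinuousLinearMap.lsmul ℝ ℝ)
    unitKernel_contDiff.continuous unitKernel_hasCompactSupport hw x y).trans ?_
  rw [integral_norm_unitKernel, mul_one]
  exact mul_le_of_le_one_left ((norm_nonneg _).trans (hw x y))
    ContinuousLinearMap.opNorm_lsmul_le

lemma mollify_contDiff (hw : Continuous w) : ContDiff ℝ ∞ (mollify w) :=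
  unitKernel_hasCompactSupport.contDiff_convolution_left _ unitKernel_contDiff
    hw.locallyIntegrable

variable [CompleteSpace F]

lemma dist_mollify_le (hw : Continuous w) {x : E} {z : F} {δ : ℝ} (hδ : 0 ≤ δ)
    (h : ∀ y ∈ Metric.ball x 1, dist (w y) z ≤ δ) : dist (mollify w x) z ≤ δ :=
  dist_convolution_le hδ support_unitKernel.subset unitKernel_nonneg integral_unitKernel
    hw.aestronglyMeasurable h

set_option maxSynthPendingDepth 3 in
lemma exists_norm_fderiv_mollify_sub_le (E F : Type*) [NormedAddCommGroup E] [NormedSpace ℝ E]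
    [FiniteDimensional ℝ E] [MeasurableSpace E] [BorelSpace E]
    [NormedAddCommGroup F] [NormedSpace ℝ F] :
    ∃ c : ℝ, 0 ≤ c ∧ ∀ (w : E → F) (Λ : ℝ), (∀ x y, ‖w x - w y‖ ≤ Λ * ‖x - y‖) → ∀ x y,
      ‖fderiv ℝ (mollify w) x - fderiv ℝ (mollify w) y‖ ≤ c * (Λ * ‖x - y‖) := by
  refine ⟨‖(ContinuousLinearMap.lsmul ℝ ℝ : ℝ →L[ℝ] F →L[ℝ] F).precompL E‖ *
    ∫ t, ‖fderiv ℝ (unitKernel E) t‖ ∂Measure.addHaar, by positivity, fun w Λ hw x y => ?_⟩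
  have hfderiv : ∀ x, fderiv ℝ (mollify w) x = (fderiv ℝ (unitKernel E)
      ⋆[(ContinuousLinearMap.lsmul ℝ ℝ : ℝ →L[ℝ] F →L[ℝ] F).precompL E, Measure.addHaar] w) x :=
    fun x => (unitKernel_hasCompactSupport.hasFDerivAt_convolution_left _
      (unitKernel_contDiff.of_le (by norm_cast))
      (continuous_of_norm_sub_le hw).locallyIntegrable x).fderiv
  rw [hfderiv, hfderiv]
  exact norm_convolution_sub_le _ _ (unitKernel_contDiff.continuous_fderiv (by simp))
    (unitKernel_hasCompactSupport.fderiv ℝ) hw x y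

end Convolution

/-- Conjugation of a map by the dilation of ratio `ε`. It preserves Lipschitz constants. -/
def rescale (ε : ℝ) (w : E → F) : E → F := fun x => ε • w (ε⁻¹ • x)

lemma norm_rescale_sub_le {ε Λ : ℝ} (hε : 0 < ε) {w : E → F}
    (hw : ∀ x y, ‖w x - w y‖ ≤ Λ * ‖x - y‖) (x y : E) :
    ‖rescale ε w x - rescale ε w y‖ ≤ Λ * ‖x - y‖ := by
  have hinv := hw (ε⁻¹ • x) (ε⁻¹ • y)
  rw [← smul_sub, norm_smul, Real.norm_of_nonneg (inv_nonneg.2 hε.le)] at hinv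
  rw [rescale, rescale, ← smul_sub, norm_smul, Real.norm_of_nonneg hε.le]
  calc ε * ‖w (ε⁻¹ • x) - w (ε⁻¹ • y)‖ ≤ ε * (Λ * (ε⁻¹ * ‖x - y‖)) := by gcongr
    _ = Λ * ‖x - y‖ := by field_simp

lemma fderiv_rescale {ε : ℝ} (hε : ε ≠ 0) {w : E → F} (hw : Differentiable ℝ w) (x : E) :
    fderiv ℝ (rescale ε w) x = fderiv ℝ w (ε⁻¹ • x) := by
  have hscale : HasFDerivAt (fun x : E => ε⁻¹ • x) (ε⁻¹ • ContinuousLinearMap.id ℝ E) x :=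
    (hasFDerivAt_id x).const_smul ε⁻¹
  refine (((hw (ε⁻¹ • x)).hasFDerivAt.comp x hscale).const_smul ε).fderiv.trans ?_
  ext z
  simp [smul_smul, hε]

lemma dist_rescale_le {ε δ : ℝ} (hε : 0 < ε) {w : E → F} {z : F} {x : E}
    (h : dist (w (ε⁻¹ • x)) (ε⁻¹ • z) ≤ δ) : dist (rescale ε w x) z ≤ δ * ε := by
  rw [rescale, ← smul_inv_smul₀ hε.ne' z, dist_smul₀, Real.norm_of_nonneg hε.le, mul_comm]
  gcongr

section MollifyAt

variable [FiniteDimensional ℝ E] [MeasurableSpace E] [BorelSpace E]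

/-- Mollification at scale `ε`, obtained from the mollification at scale one by rescaling. -/
def mollifyAt (ε : ℝ) (w : E → F) : E → F := rescale ε (mollify (rescale ε⁻¹ w))

variable {w : E → F} {ε : ℝ}

lemma norm_mollifyAt_sub_le {Λ : ℝ} (hε : 0 < ε) (hw : ∀ x y, ‖w x - w y‖ ≤ Λ * ‖x - y‖)
    (x y : E) : ‖mollifyAt ε w x - mollifyAt ε w y‖ ≤ Λ * ‖x - y‖ :=
  norm_rescale_sub_le hε (norm_mollify_sub_le (norm_rescale_sub_le (inv_pos.2 hε) hw)) x y

lemma contDiff_mollifyAt (hw : Continuous w) : ContDiff ℝ ∞ (mollifyAt ε w) := by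
  have hrescaled : Continuous (rescale ε⁻¹ w) := by unfold rescale; fun_prop
  exact ((mollify_contDiff hrescaled).comp (contDiff_const_smul ε⁻¹)).const_smul ε

variable [CompleteSpace F]

lemma dist_mollifyAt_le (hε : 0 < ε) (hw : Continuous w) {x : E} {z : F} {δ : ℝ} (hδ : 0 ≤ δ)
    (h : ∀ y ∈ Metric.ball x ε, dist (w y) z ≤ δ) : dist (mollifyAt ε w x) z ≤ δ := by
  have hrescaled : Continuous (rescale ε⁻¹ w) := by unfold rescale; fun_prop
  suffices dist (mollify (rescale ε⁻¹ w) (ε⁻¹ • x)) (ε⁻¹ • z) ≤ δ * ε⁻¹ by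
    simpa [mollifyAt, hε.ne'] using dist_rescale_le hε this
  refine dist_mollify_le hrescaled (by positivity) fun y hy =>
    dist_rescale_le (inv_pos.2 hε) ?_
  simp only [inv_inv, smul_inv_smul₀ hε.ne']
  refine h (ε • y) ?_
  rw [Metric.mem_ball, ← smul_inv_smul₀ hε.ne' x, dist_smul₀, Real.norm_of_nonneg hε.le]
  exact mul_lt_of_lt_one_right hε hy

end MollifyAt

/-- `W` is a smooth approximation at scale `ε` of `w`, where `w` is bounded by `M` and
`L`-Lipschitz: the bounds of `w` are kept and the second derivative is at most `c L / ε`. -/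
structure IsSmoothApprox (c L M ε : ℝ) (w W : E → F) : Prop where
  contDiff : ContDiff ℝ ∞ W
  bound : ∀ x, ‖W x‖ ≤ M
  fderiv_bound : ∀ x, ‖fderiv ℝ W x‖ ≤ L
  fderiv_lip : ∀ x y, ‖fderiv ℝ W x - fderiv ℝ W y‖ ≤ c * L / ε * ‖x - y‖
  close : ∀ x, ‖W x - w x‖ ≤ L * ε
  support : ∀ r, (∀ x, r ≤ ‖x‖ → w x = 0) → ∀ x, r + ε ≤ ‖x‖ → W x = 0

lemma exists_isSmoothApprox (E F : Type*) [NormedAddCommGroup E] [NormedSpace ℝ E]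
    [FiniteDimensional ℝ E] [NormedAddCommGroup F] [NormedSpace ℝ F] [CompleteSpace F] :
    ∃ c : ℝ, 0 ≤ c ∧ ∀ (w : E → F) (L M ε : ℝ), 0 < ε → 0 ≤ L →
      (∀ x, ‖w x‖ ≤ M) → (∀ x y, ‖w x - w y‖ ≤ L * ‖x - y‖) →
      ∃ W : E → F, IsSmoothApprox c L M ε w W := by
  borelize E
  obtain ⟨c, hc, hfderiv⟩ := exists_norm_fderiv_mollify_sub_le E F
  refine ⟨c, hc, fun w L M ε hε hL hM hw => ⟨mollifyAt ε w, contDiff_mollifyAt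
    (continuous_of_norm_sub_le hw), fun x => ?_, fun x => ?_, fun x y => ?_, fun x => ?_,
    fun r hr x hx => ?_⟩⟩
  · rw [← dist_zero_right]
    exact dist_mollifyAt_le hε (continuous_of_norm_sub_le hw) ((norm_nonneg _).trans (hM 0))
      fun y _ => by simpa using hM y
  · exact norm_fderiv_le_of_lip' ℝ hL (Eventually.of_forall fun y =>
      norm_mollifyAt_sub_le hε hw y x)
  · have hrescaled := norm_rescale_sub_le (inv_pos.2 hε) hw
    have hdiff := (mollify_contDiff (continuous_of_norm_sub_le hrescaled)).differentiable (by simp)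
    rw [mollifyAt, fderiv_rescale hε.ne' hdiff, fderiv_rescale hε.ne' hdiff]
    refine (hfderiv _ L hrescaled _ _).trans (le_of_eq ?_)
    rw [← smul_sub, norm_smul, Real.norm_of_nonneg (inv_nonneg.2 hε.le)]
    ring
  · rw [← dist_eq_norm_sub]
    refine dist_mollifyAt_le hε (continuous_of_norm_sub_le hw) (by positivity) fun y hy => ?_
    rw [dist_eq_norm_sub]
    exact (hw y x).trans (by gcongr; exact (mem_ball_iff_norm.1 hy).le)
  · refine dist_le_zero.1 (dist_mollifyAt_le hε (continuous_of_norm_sub_le hw) le_rfl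
      fun y hy => ?_)
    rw [hr y (by linarith [norm_sub_norm_le x y, mem_ball_iff_norm'.1 hy]), dist_self]

end Mollification

section SmoothDuality

/-- The function `f` clamped between `±b (r - ‖x‖)⁺`: a compactly supported version of `f` with
slopes at most those of `f` or `b`. -/
def clampToBall {E : Type*} [SeminormedAddCommGroup E] (b r : ℝ) (f : E → ℝ) : E → ℝ :=
  fun x => max (-max 0 (b * (r - ‖x‖))) (min (f x) (max 0 (b * (r - ‖x‖))))

section Clamp

variable {E : Type*} [SeminormedAddCommGroup E] {a b r : ℝ} {f : E → ℝ} {x : E}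

lemma clampToBall_eq_zero (hb : 0 ≤ b) (hx : r ≤ ‖x‖) : clampToBall b r f x = 0 := by
  have hcone : max 0 (b * (r - ‖x‖)) = 0 :=
    max_eq_left (mul_nonpos_of_nonneg_of_nonpos hb (sub_nonpos.2 hx))
  simp only [clampToBall, hcone, neg_zero, inf_le_right, sup_of_le_left]

lemma clampToBall_eq_self (hb : 0 < b) (hf : |f x| ≤ a) (hx : a / b + ‖x‖ ≤ r) :
    clampToBall b r f x = f x := by
  have hcone : a ≤ max 0 (b * (r - ‖x‖)) := le_max_of_le_right (by
    rw [← div_le_iff₀' hb]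
    linarith)
  have hf' := abs_le.1 hf
  rw [clampToBall, min_eq_left (by linarith), max_eq_right (by linarith)]

lemma abs_clampToBall_le (x : E) : |clampToBall b r f x| ≤ |f x| := by
  rw [clampToBall]
  set g := max 0 (b * (r - ‖x‖))
  have hg : 0 ≤ g := le_max_left _ _
  rcases le_total g (f x) with h | h
  · rw [min_eq_right h, max_eq_right (by linarith)]
    exact abs_le_abs_of_nonneg hg h
  · rw [min_eq_left h]
    exact abs_le.2 ⟨le_max_of_le_right (neg_abs_le _),
      max_le ((neg_nonpos.2 hg).trans (abs_nonneg _)) (le_abs_self _)⟩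

lemma abs_max_cone_sub_le (hb : 0 ≤ b) (x y : E) :
    |max 0 (b * (r - ‖x‖)) - max 0 (b * (r - ‖y‖))| ≤ b * ‖x - y‖ := by
  refine (abs_max_sub_max_le_max _ _ _ _).trans ?_
  rw [sub_self, abs_zero, ← mul_sub, abs_mul, abs_of_nonneg hb, sub_sub_sub_cancel_left,
    abs_sub_comm]
  exact max_le (by positivity) (by gcongr; exact abs_norm_sub_norm_le x y)

lemma IsBoundedLipschitz.clampToBall (hb : 0 ≤ b) (hf : IsBoundedLipschitz a b f) :
    IsBoundedLipschitz a b (clampToBall b r f) where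
  bound x := (abs_clampToBall_le x).trans (hf.bound x)
  lip x y := (abs_max_sub_max_le_max _ _ _ _).trans <| max_le
    (by rw [neg_sub_neg, abs_sub_comm]; exact abs_max_cone_sub_le hb x y)
    ((abs_min_sub_min_le_max _ _ _ _).trans (max_le (hf.lip x y) (abs_max_cone_sub_le hb x y)))

end Clamp

variable {E : Type*} [NormedAddCommGroup E] [NormedSpace ℝ E]

/-- Smooth compactly supported test functions. -/
def IsTestFunction (φ : E → ℝ) : Prop := ContDiff ℝ ∞ φ ∧ HasCompactSupport φ

lemma norm_sub_le_of_norm_fderiv_le {F : Type*} [NormedAddCommGroup F] [NormedSpace ℝ F]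
    {φ : E → F} (hφ : Differentiable ℝ φ) {Λ : ℝ} (h : ∀ x, ‖fderiv ℝ φ x‖ ≤ Λ) (x y : E) :
    ‖φ x - φ y‖ ≤ Λ * ‖x - y‖ :=
  convex_univ.norm_image_sub_le_of_norm_fderiv_le (fun z _ => hφ z) (fun z _ => h z)
    (mem_univ y) (mem_univ x)

lemma hasCompactSupport_of_forall_norm {E : Type*} [SeminormedAddCommGroup E] [ProperSpace E]
    {φ : E → ℝ} {r : ℝ} (h : ∀ x, r ≤ ‖x‖ → φ x = 0) : HasCompactSupport φ :=
  HasCompactSupport.of_support_subset_isCompact (isCompact_closedBall (0 : E) r) fun x hx =>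
    mem_closedBall_zero_iff.2 (not_lt.1 fun hr => hx (h x hr.le))

variable [FiniteDimensional ℝ E] {a b : ℝ}

lemma exists_seq_isTestFunction_tendsto (hb : 0 < b) {f : E → ℝ} (hf : IsBoundedLipschitz a b f) :
    ∃ φ : ℕ → E → ℝ, (∀ n, IsTestFunction (φ n) ∧ IsBoundedLipschitz a b (φ n)) ∧
      ∀ x, Tendsto (fun n => φ n x) atTop (𝓝 (f x)) := by
  have : ProperSpace E := FiniteDimensional.proper ℝ E
  obtain ⟨c, -, hc⟩ := exists_isSmoothApprox E ℝ
  have hclamp : ∀ n : ℕ, IsBoundedLipschitz a b (clampToBall b n f) := fun n =>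
    hf.clampToBall hb.le
  choose φ hφ using fun n : ℕ => hc (clampToBall b n f) b a (1 / ((n : ℝ) + 1)) (by positivity)
    hb.le (hclamp n).bound (hclamp n).lip
  refine ⟨φ, fun n => ⟨⟨(hφ n).contDiff, hasCompactSupport_of_forall_norm
    ((hφ n).support n fun x => clampToBall_eq_zero hb.le)⟩, (hφ n).bound,
      norm_sub_le_of_norm_fderiv_le ((hφ n).contDiff.differentiable (by simp))
        (hφ n).fderiv_bound⟩, fun x => ?_⟩
  have hlim : Tendsto (fun n : ℕ => b * (1 / ((n : ℝ) + 1))) atTop (𝓝 0) := by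
    simpa using tendsto_one_div_add_atTop_nhds_zero_nat.const_mul b
  rw [tendsto_iff_norm_sub_tendsto_zero]
  refine squeeze_zero' (Eventually.of_forall fun n => norm_nonneg _) ?_ hlim
  filter_upwards [tendsto_natCast_atTop_atTop.eventually_ge_atTop (a / b + ‖x‖)] with n hn
  rw [← clampToBall_eq_self hb (hf.bound x) hn]
  exact (hφ n).close x

theorem gwNorm_le_of_forall_isTestFunction [MeasurableSpace E] [BorelSpace E] (ha : 0 < a)
    (hb : 0 < b) (μ : SignedMeasure E) {c : ℝ}
    (h : ∀ φ : E → ℝ, IsTestFunction φ → IsBoundedLipschitz a b φ → pairing μ φ ≤ c) :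
    gwNorm a b μ ≤ c := by
  have : ProperSpace E := FiniteDimensional.proper ℝ E
  refine gwNorm_le_of_forall_isBoundedLipschitz ha hb μ fun f hf => ?_
  obtain ⟨φ, hφ, hlim⟩ := exists_seq_isTestFunction_tendsto hb hf
  exact le_of_tendsto' (tendsto_pairing_of_dominated μ a (fun n => (hφ n).1.1.continuous)
    (fun n => (hφ n).2.bound) hlim) fun n => h _ (hφ n).1 (hφ n).2

end SmoothDuality

section TotalVariation

variable {E : Type*} [NormedAddCommGroup E] [NormedSpace ℝ E]

lemma IsTestFunction.sub {f g : E → ℝ} (hf : IsTestFunction f) (hg : IsTestFunction g) :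
    IsTestFunction fun x => f x - g x :=
  ⟨hf.1.sub hg.1, by
    simp only [sub_eq_add_neg]
    exact hf.2.add hg.2.neg⟩

lemma IsTestFunction.isBoundedContinuous {f : E → ℝ} (hf : IsTestFunction f) :
    IsBoundedContinuous f :=
  ⟨hf.1.continuous, hf.2.exists_bound_of_continuous hf.1.continuous⟩

lemma IsTestFunction.exists_norm_fderiv_le {φ : E → ℝ} (hφ : IsTestFunction φ) :
    ∃ Λ, 0 ≤ Λ ∧ ∀ x, ‖fderiv ℝ φ x‖ ≤ Λ := by
  obtain ⟨Λ, hΛ⟩ := (hφ.2.fderiv ℝ).exists_bound_of_continuous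
    (hφ.1.continuous_fderiv (by simp))
  exact ⟨Λ, (norm_nonneg _).trans (hΛ 0), hΛ⟩

lemma IsTestFunction.exists_isBoundedLipschitz {φ : E → ℝ} (hφ : IsTestFunction φ) :
    ∃ B Λ, 0 ≤ Λ ∧ IsBoundedLipschitz B Λ φ := by
  obtain ⟨-, B, hB⟩ := hφ.isBoundedContinuous
  obtain ⟨Λ, h0, hΛ⟩ := hφ.exists_norm_fderiv_le
  exact ⟨B, Λ, h0, hB, norm_sub_le_of_norm_fderiv_le (hφ.1.differentiable (by simp)) hΛ⟩

lemma totalVariation_real_eq {X : Type*} [MeasurableSpace X] (μ : SignedMeasure X) (s : Set X) :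
    μ.totalVariation.real s =
      (jordanPos μ : Measure X).real s + (jordanNeg μ : Measure X).real s :=
  measureReal_add_apply

lemma exists_isCompact_subset_sdiff_measureReal_le {X : Type*} [TopologicalSpace X]
    [MeasurableSpace X] (ν : Measure X) [IsFiniteMeasure ν] [ν.InnerRegularCompactLTTop]
    {U S : Set X} (hU : MeasurableSet U) (hS : MeasurableSet S)
    (hS0 : ν S = 0) {ε : ℝ} (hε : 0 < ε) :
    ∃ K ⊆ U \ S, IsCompact K ∧ ν.real U ≤ ν.real K + ε := by
  obtain ⟨K, hKU, hK, hlt⟩ := (hU.diff hS).exists_isCompact_lt_add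
    (measure_ne_top ν _) (ε := ENNReal.ofReal ε) (by simpa using hε)
  refine ⟨K, hKU, hK, ?_⟩
  rw [measureReal_def, measureReal_def, ← measure_sdiff_null hS0, ← ENNReal.toReal_ofReal hε.le,
    ← ENNReal.toReal_add (measure_ne_top _ _) ENNReal.ofReal_ne_top]
  exact ENNReal.toReal_mono (by finiteness) hlt.le

lemma two_mul_measureReal_sub_le_integral {X : Type*} [TopologicalSpace X] [MeasurableSpace X]
    [OpensMeasurableSpace X] {ν : Measure X} [IsFiniteMeasure ν] {K U : Set X}
    (hK : MeasurableSet K) (hU : MeasurableSet U) {φ : X → ℝ} (hφ : IsBoundedContinuous φ)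
    (h1 : ∀ x ∈ K, φ x = 1) (h2 : ∀ x, -1 ≤ φ x) (h0 : ∀ x ∉ U, φ x = 0) :
    2 * ν.real K - ν.real U ≤ ∫ x, φ x ∂ν := by
  have iK : Integrable (K.indicator (1 : X → ℝ)) ν := (integrable_const (1 : ℝ)).indicator hK
  have iU : Integrable (U.indicator (1 : X → ℝ)) ν := (integrable_const (1 : ℝ)).indicator hU
  have h : ∫ x, (2 * K.indicator (1 : X → ℝ) x - U.indicator (1 : X → ℝ) x) ∂ν ≤ ∫ x, φ x ∂ν := by
    refine integral_mono ((iK.const_mul 2).sub iU) (hφ.integrable ν) fun x => ?_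
    by_cases hxK : x ∈ K
    · by_cases hxU : x ∈ U
      · simp only [hxK, hxU, indicator_of_mem, Pi.one_apply]
        linarith [h1 x hxK]
      · exact absurd (h1 x hxK) (by rw [h0 x hxU]; norm_num)
    · by_cases hxU : x ∈ U
      · simp only [hxK, hxU, indicator_of_mem, indicator_of_notMem, not_false_eq_true,
          Pi.one_apply]
        linarith [h2 x]
      · simp [hxK, hxU, h0 x hxU]
  rwa [integral_sub (iK.const_mul 2) iU, integral_const_mul, integral_indicator_one hK,
    integral_indicator_one hU] at h

section Separation

variable [FiniteDimensional ℝ E]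

lemma exists_smooth_bump {K U : Set E} (hK : IsCompact K) (hU : IsOpen U) (hKU : K ⊆ U) :
    ∃ f : E → ℝ, IsTestFunction f ∧ (∀ x ∈ K, f x = 1) ∧ (∀ x, 0 ≤ f x) ∧ (∀ x, f x ≤ 1) ∧
      ∀ x ∉ U, f x = 0 := by
  have : ProperSpace E := FiniteDimensional.proper ℝ E
  obtain ⟨r, hr⟩ := hK.isBounded.subset_ball 0
  obtain ⟨f, h0, h1, hf⟩ := exists_contMDiffMap_zero_one_of_isClosed (n := (⊤ : ℕ∞))
    (modelWithCornersSelf ℝ E) (s := (U ∩ Metric.ball 0 r)ᶜ) (t := K)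
    (hU.inter Metric.isOpen_ball).isClosed_compl hK.isClosed
    (disjoint_compl_left_iff_subset.2 (subset_inter hKU hr))
  refine ⟨f, ⟨contMDiff_iff_contDiff.1 f.contMDiff, hasCompactSupport_of_forall_norm (r := r)
    fun x hx => h0 fun h => ?_⟩, fun x hx => h1 hx, fun x => (hf x).1, fun x => (hf x).2,
    fun x hx => h0 fun h => hx h.1⟩
  exact absurd (mem_ball_zero_iff.1 h.2) (not_lt.2 hx)

lemma exists_isTestFunction_separating {K₁ K₂ U : Set E} (hK₁ : IsCompact K₁) (hK₂ : IsCompact K₂)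
    (hdisj : Disjoint K₁ K₂) (hU : IsOpen U) (h₁ : K₁ ⊆ U) (h₂ : K₂ ⊆ U) :
    ∃ φ : E → ℝ, IsTestFunction φ ∧ (∀ x, |φ x| ≤ 1) ∧ (∀ x ∉ U, φ x = 0) ∧
      (∀ x ∈ K₁, φ x = 1) ∧ ∀ x ∈ K₂, φ x = -1 := by
  obtain ⟨V₁, V₂, hV₁, hV₂, hKV₁, hKV₂, hV⟩ := SeparatedNhds.of_isCompact_isCompact hK₁ hK₂ hdisj
  obtain ⟨f, hft, hf1, hf0, hfle, hfU⟩ :=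
    exists_smooth_bump hK₁ (hV₁.inter hU) (subset_inter hKV₁ h₁)
  obtain ⟨g, hgt, hg1, hg0, hgle, hgU⟩ :=
    exists_smooth_bump hK₂ (hV₂.inter hU) (subset_inter hKV₂ h₂)
  refine ⟨fun x => f x - g x, hft.sub hgt, fun x => abs_le.2
    ⟨by linarith [hf0 x, hgle x], by linarith [hg0 x, hfle x]⟩, fun x hx => ?_, fun x hx => ?_,
    fun x hx => ?_⟩
  · simp only [hfU x fun h => hx h.2, hgU x fun h => hx h.2, sub_zero]
  · simp only [hf1 x hx, hgU x fun h => Set.disjoint_left.1 hV (hKV₁ hx) h.1, sub_zero]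
  · simp only [hg1 x hx, hfU x fun h => Set.disjoint_left.1 hV h.1 (hKV₂ hx), zero_sub]

end Separation

variable [FiniteDimensional ℝ E] [MeasurableSpace E] [BorelSpace E]

theorem totalVariation_real_le_of_forall_isTestFunction (μ : SignedMeasure E) {U : Set E}
    (hU : IsOpen U) {c : ℝ} (h : ∀ φ : E → ℝ, IsTestFunction φ → (∀ x, |φ x| ≤ 1) →
      (∀ x ∉ U, φ x = 0) → pairing μ φ ≤ c) : μ.totalVariation.real U ≤ c := by
  have : ProperSpace E := FiniteDimensional.proper ℝ E
  obtain ⟨A, hA, hpA, hnA⟩ := μ.toJordanDecomposition.mutuallySingular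
  rw [totalVariation_real_eq]
  refine le_of_forall_pos_le_add fun ε hε => ?_
  obtain ⟨K₁, hK₁U, hK₁, hp⟩ := exists_isCompact_subset_sdiff_measureReal_le
    (jordanPos μ : Measure E) hU.measurableSet hA hpA (show 0 < ε / 4 by positivity)
  obtain ⟨K₂, hK₂U, hK₂, hn⟩ := exists_isCompact_subset_sdiff_measureReal_le
    (jordanNeg μ : Measure E) hU.measurableSet hA.compl hnA (show 0 < ε / 4 by positivity)
  obtain ⟨φ, hφ, hb, hout, h1, h2⟩ := exists_isTestFunction_separating hK₁ hK₂
    (Set.disjoint_left.2 fun x hx₁ hx₂ => (hK₂U hx₂).2 (hK₁U hx₁).2) hU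
    (hK₁U.trans sdiff_subset) (hK₂U.trans sdiff_subset)
  have hpos := two_mul_measureReal_sub_le_integral (ν := jordanPos μ) hK₁.measurableSet
    hU.measurableSet hφ.isBoundedContinuous h1 (fun x => (abs_le.1 (hb x)).1) hout
  have hneg := two_mul_measureReal_sub_le_integral (ν := jordanNeg μ) hK₂.measurableSet
    hU.measurableSet (φ := fun x => -φ x) (by simpa using hφ.isBoundedContinuous.const_mul (-1))
    (fun x hx => by rw [h2 x hx, neg_neg]) (fun x => neg_le_neg (abs_le.1 (hb x)).2)
    (fun x hx => by rw [hout x hx, neg_zero])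
  have hle := h φ hφ hb hout
  rw [pairing_eq_integral_sub_integral μ hφ.isBoundedContinuous] at hle
  rw [integral_neg] at hneg
  linarith

lemma mass_le_of_forall_isTestFunction (μ : SignedMeasure E) {c : ℝ}
    (h : ∀ φ : E → ℝ, IsTestFunction φ → (∀ x, |φ x| ≤ 1) → pairing μ φ ≤ c) : mass μ ≤ c :=
  totalVariation_real_le_of_forall_isTestFunction μ isOpen_univ fun φ h1 h2 _ => h φ h1 h2

lemma eq_zero_of_mass_le_zero {X : Type*} [MeasurableSpace X]
    {μ : SignedMeasure X} (h : mass μ ≤ 0) : μ = 0 := by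
  refine VectorMeasure.ext fun i _ => ?_
  have h0 : μ.totalVariation univ = 0 := by
    rw [← ofReal_mass, ENNReal.ofReal_eq_zero]
    exact h
  exact μ.null_of_totalVariation_zero (measure_mono_null (subset_univ i) h0)

lemma supp_subset_of_forall_isTestFunction (μ : SignedMeasure E) {C : Set E} (hC : IsClosed C)
    (h : ∀ φ : E → ℝ, IsTestFunction φ → (∀ x ∈ C, φ x = 0) → pairing μ φ = 0) : supp μ ⊆ C := by
  have hle : μ.totalVariation.real Cᶜ ≤ 0 :=
    totalVariation_real_le_of_forall_isTestFunction μ hC.isOpen_compl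
      fun φ hφ _ h0 => (h φ hφ fun x hx => h0 x fun h => h hx).le
  have hfin : μ.totalVariation Cᶜ ≠ ⊤ := by
    rw [SignedMeasure.totalVariation_eq_variation]
    exact measure_ne_top _ _
  exact Measure.support_subset_of_isClosed hC
    ((measureReal_eq_zero_iff hfin).1 (le_antisymm hle measureReal_nonneg))

lemma pairing_eq_zero_of_forall_mem_supp {E : Type*} [NormedAddCommGroup E] [MeasurableSpace E]
    [SecondCountableTopology E] (μ : SignedMeasure E) {f : E → ℝ}
    (h : ∀ x ∈ supp μ, f x = 0) : pairing μ f = 0 := by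
  refine pairing_eq_zero_of_ae μ ?_
  filter_upwards [Measure.support_mem_ae (μ := μ.totalVariation)] with x hx using h x hx

end TotalVariation

section Norm

variable {E : Type*} [NormedAddCommGroup E] [NormedSpace ℝ E] [FiniteDimensional ℝ E]
  [MeasurableSpace E] [BorelSpace E] {a b : ℝ}

lemma abs_pairing_le_div_add_div_mul_gwNorm (ha : 0 < a) (hb : 0 < b) (μ : SignedMeasure E)
    {B Λ : ℝ} {f : E → ℝ} (hΛ : 0 ≤ Λ) (hf : IsBoundedLipschitz B Λ f) :
    |pairing μ f| ≤ (B / a + Λ / b) * gwNorm a b μ := by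
  have : ProperSpace E := FiniteDimensional.proper ℝ E
  have hB := hf.bound_nonneg
  refine abs_pairing_le_mul_gwNorm ha hb μ (by positivity) (hf.mono ?_ ?_)
  · rw [add_mul, div_mul_cancel₀ _ ha.ne']
    exact le_add_of_nonneg_right (by positivity)
  · rw [add_mul, div_mul_cancel₀ _ hb.ne']
    exact le_add_of_nonneg_left (by positivity)

lemma gwNorm_le_mass (ha : 0 < a) (hb : 0 < b) (μ : SignedMeasure E) :
    gwNorm a b μ ≤ a * mass μ :=
  gwNorm_le_of_forall_isTestFunction ha hb μ fun _ _ h =>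
    (le_abs_self _).trans (abs_pairing_le μ h.bound)

lemma gwNorm_zero (ha : 0 < a) (hb : 0 < b) : gwNorm a b (0 : SignedMeasure E) = 0 := by
  refine le_antisymm ((gwNorm_le_mass ha hb 0).trans_eq ?_) (gwNorm_nonneg _ _ _)
  rw [mass, SignedMeasure.totalVariation_zero, Measure.coe_zero, Pi.zero_apply,
    ENNReal.toReal_zero, mul_zero]

lemma gwNorm_add_le (ha : 0 < a) (hb : 0 < b) (μ ν : SignedMeasure E) :
    gwNorm a b (μ + ν) ≤ gwNorm a b μ + gwNorm a b ν := by
  have : ProperSpace E := FiniteDimensional.proper ℝ E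
  refine gwNorm_le_of_forall_isTestFunction ha hb _ fun φ _ h => ?_
  rw [pairing_add_measure _ _ h.isBoundedContinuous]
  exact add_le_add (pairing_le_gwNorm ha hb μ h) (pairing_le_gwNorm ha hb ν h)

lemma gwNorm_neg (ha : 0 < a) (hb : 0 < b) (μ : SignedMeasure E) :
    gwNorm a b (-μ) = gwNorm a b μ := by
  have : ProperSpace E := FiniteDimensional.proper ℝ E
  have hle : ∀ ν : SignedMeasure E, gwNorm a b (-ν) ≤ gwNorm a b ν := fun ν =>
    gwNorm_le_of_forall_isTestFunction ha hb _ fun φ _ h => by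
      rw [pairing_neg_measure, ← pairing_neg]
      exact pairing_le_gwNorm ha hb ν h.neg
  exact le_antisymm (hle μ) (by simpa using hle (-μ))

lemma gwNorm_sub_comm (ha : 0 < a) (hb : 0 < b) (μ ν : SignedMeasure E) :
    gwNorm a b (μ - ν) = gwNorm a b (ν - μ) := by
  rw [← gwNorm_neg ha hb, neg_sub]

lemma gwNorm_sub_le (ha : 0 < a) (hb : 0 < b) (μ ν ρ : SignedMeasure E) :
    gwNorm a b (μ - ρ) ≤ gwNorm a b (μ - ν) + gwNorm a b (ν - ρ) := by
  have := gwNorm_add_le ha hb (μ - ν) (ν - ρ)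
  rwa [sub_add_sub_cancel] at this

lemma eq_zero_of_gwNorm_le_zero (ha : 0 < a) (hb : 0 < b) {μ : SignedMeasure E}
    (h : gwNorm a b μ ≤ 0) : μ = 0 := by
  refine eq_zero_of_mass_le_zero (mass_le_of_forall_isTestFunction μ fun φ hφ _ => ?_)
  obtain ⟨B, Λ, hΛ, hφ'⟩ := hφ.exists_isBoundedLipschitz
  have hle := abs_pairing_le_div_add_div_mul_gwNorm ha hb μ hΛ hφ'
  rw [le_antisymm h (gwNorm_nonneg _ _ _), mul_zero] at hle
  exact (le_abs_self _).trans hle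

/-- The pseudometric `(μ, ν) ↦ ‖μ - ν‖^{a,b}`; it makes Mathlib's notions of continuity available
for curves of signed measures, which carry no global metric. -/
abbrev gwPseudoMetric (ha : 0 < a) (hb : 0 < b) : PseudoMetricSpace (SignedMeasure E) where
  dist μ ν := gwNorm a b (μ - ν)
  dist_self μ := by rw [sub_self, gwNorm_zero ha hb]
  dist_comm := gwNorm_sub_comm ha hb
  dist_triangle := gwNorm_sub_le ha hb

end Norm

section WeakCompactness

section Vague

variable {X : Type*} [TopologicalSpace X] [MeasurableSpace X]

variable {ρ : ℕ → FiniteMeasure X} {m : ℝ}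

lemma exists_tendsto_integral_hyperfilter (hm : ∀ n, (ρ n : Measure X).real univ ≤ m)
    (φ : C_c(X, ℝ)) :
    ∃ r, Tendsto (fun n => ∫ x, φ x ∂(ρ n : Measure X)) (hyperfilter ℕ) (𝓝 r) := by
  obtain ⟨C, hC⟩ := φ.hasCompactSupport.exists_bound_of_continuous φ.continuous
  have hle : ∀ n, |∫ x, φ x ∂(ρ n : Measure X)| ≤ max C 0 * m := fun n =>
    (norm_integral_le_of_norm_le_const (f := φ)
      (Eventually.of_forall fun x => (hC x).trans (le_max_left C 0))).trans
        (mul_le_mul_of_nonneg_left (hm n) (le_max_right _ _))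
  obtain ⟨r, -, hr⟩ := (isCompact_Icc (a := -(max C 0 * m)) (b := max C 0 * m)).ultrafilter_le_nhds
    ((hyperfilter ℕ).map fun n => ∫ x, φ x ∂(ρ n : Measure X))
    (le_principal_iff.2 (mem_map.2 (Eventually.of_forall fun n => abs_le.1 (hle n))))
  exact ⟨r, hr⟩

variable [BorelSpace X]

lemma exists_positiveLinearMap_tendsto_integral (hm : ∀ n, (ρ n : Measure X).real univ ≤ m) :
    ∃ Λ : C_c(X, ℝ) →ₚ[ℝ] ℝ, ∀ φ : C_c(X, ℝ),
      Tendsto (fun n => ∫ x, φ x ∂(ρ n : Measure X)) (hyperfilter ℕ) (𝓝 (Λ φ)) := by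
  choose Λ hΛ using exists_tendsto_integral_hyperfilter hm
  exact ⟨PositiveLinearMap.mk₀
    { toFun := Λ
      map_add' := fun φ ψ => tendsto_nhds_unique (hΛ (φ + ψ)) (((hΛ φ).add (hΛ ψ)).congr
        fun n => (integral_add φ.integrable ψ.integrable).symm)
      map_smul' := fun c φ => tendsto_nhds_unique (hΛ (c • φ)) (((hΛ φ).const_mul c).congr
        fun n => (integral_const_mul c _).symm) }
    fun φ hφ => ge_of_tendsto' (hΛ φ) fun n => integral_nonneg hφ, hΛ⟩

lemma exists_vague_limit [T2Space X] [LocallyCompactSpace X]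
    (hm : ∀ n, (ρ n : Measure X).real univ ≤ m) :
    ∃ ρ' : FiniteMeasure X, ∀ φ : C_c(X, ℝ), Tendsto (fun n => ∫ x, φ x ∂(ρ n : Measure X))
      (hyperfilter ℕ) (𝓝 (∫ x, φ x ∂(ρ' : Measure X))) := by
  obtain ⟨Λ, hΛ⟩ := exists_positiveLinearMap_tendsto_integral hm
  have hfin : IsFiniteMeasure (RealRMK.rieszMeasure Λ) := ⟨by
    refine lt_of_le_of_lt ?_ (ENNReal.ofReal_lt_top (r := m))
    rw [isOpen_univ.measure_eq_iSup_isCompact]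
    refine iSup₂_le fun K _ => iSup_le fun hK => ?_
    obtain ⟨f, hf1, hf0, hfle, -⟩ := exists_bump_of_isCompact hK isOpen_univ (subset_univ _)
    refine (RealRMK.rieszMeasure_le_of_eq_one Λ hf0 hK hf1).trans
      (ENNReal.ofReal_le_ofReal (le_of_tendsto' (hΛ f) fun n => ?_))
    exact (integral_le_measureReal_of_le_one isOpen_univ (ofCompactSupport f) hfle
      (by simp)).trans (hm n)⟩
  refine ⟨⟨RealRMK.rieszMeasure Λ, hfin⟩, fun φ => ?_⟩
  rw [FiniteMeasure.toMeasure_mk, RealRMK.integral_rieszMeasure]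
  exact hΛ φ

lemma jordanPos_real_univ_le_mass {X : Type*} [MeasurableSpace X] (μ : SignedMeasure X) :
    (jordanPos μ : Measure X).real univ ≤ mass μ :=
  (le_add_of_nonneg_right measureReal_nonneg).trans_eq (totalVariation_real_eq μ univ).symm

lemma jordanNeg_real_univ_le_mass {X : Type*} [MeasurableSpace X] (μ : SignedMeasure X) :
    (jordanNeg μ : Measure X).real univ ≤ mass μ :=
  (le_add_of_nonneg_left measureReal_nonneg).trans_eq (totalVariation_real_eq μ univ).symm

end Vague

variable {E : Type*} [NormedAddCommGroup E] [NormedSpace ℝ E] [FiniteDimensional ℝ E]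
  [MeasurableSpace E] [BorelSpace E] {μ : ℕ → SignedMeasure E} {m : ℝ}

lemma exists_signed_vague_limit (hm : ∀ n, mass (μ n) ≤ m) :
    ∃ ν : SignedMeasure E, ∀ φ : E → ℝ, IsTestFunction φ →
      Tendsto (fun n => pairing (μ n) φ) (hyperfilter ℕ) (𝓝 (pairing ν φ)) := by
  have : ProperSpace E := FiniteDimensional.proper ℝ E
  obtain ⟨ρ, hρ⟩ := exists_vague_limit fun n => (jordanPos_real_univ_le_mass (μ n)).trans (hm n)
  obtain ⟨σ, hσ⟩ := exists_vague_limit fun n => (jordanNeg_real_univ_le_mass (μ n)).trans (hm n)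
  refine ⟨(ρ : Measure E).toSignedMeasure - (σ : Measure E).toSignedMeasure, fun φ hφ => ?_⟩
  have hbc := hφ.isBoundedContinuous
  rw [pairing_sub_measure _ _ hbc, pairing_toSignedMeasure, pairing_toSignedMeasure]
  let φc : C_c(E, ℝ) := ⟨⟨φ, hφ.1.continuous⟩, hφ.2⟩
  exact ((hρ φc).sub (hσ φc)).congr fun n => (pairing_eq_integral_sub_integral (μ n) hbc).symm

theorem exists_gwNorm_limit {a b : ℝ} (ha : 0 < a) (hb : 0 < b) (hm : ∀ n, mass (μ n) ≤ m)
    {δ : ℕ → ℝ} (hδ : ∀ n k, n ≤ k → gwNorm a b (μ n - μ k) ≤ δ n) :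
    ∃ ν : SignedMeasure E, ∀ n, gwNorm a b (μ n - ν) ≤ δ n := by
  have : ProperSpace E := FiniteDimensional.proper ℝ E
  obtain ⟨ν, hν⟩ := exists_signed_vague_limit hm
  refine ⟨ν, fun n => gwNorm_le_of_forall_isTestFunction ha hb _ fun φ hφ hφ' => ?_⟩
  have hbc := hφ.isBoundedContinuous
  rw [pairing_sub_measure _ _ hbc]
  refine le_of_tendsto ((hν φ hφ).const_sub (pairing (μ n) φ)) ?_
  filter_upwards [Nat.hyperfilter_le_atTop (eventually_ge_atTop n)] with k hk
  rw [← pairing_sub_measure _ _ hbc]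
  exact (pairing_le_gwNorm ha hb _ hφ').trans (hδ n k hk)

end WeakCompactness

section TestFunctionBounds

variable {E : Type*} [NormedAddCommGroup E] [NormedSpace ℝ E]

/-- `φ` is bounded by `B`, has slopes at most `Λ`, and its derivative is `A`-Lipschitz. The error
terms of all the discretizations below depend on the test function only through `B`, `Λ`, `A`. -/
structure IsC11Bounded (B Λ A : ℝ) (φ : E → ℝ) : Prop where
  bound : ∀ x, |φ x| ≤ B
  fderiv_bound : ∀ x, ‖fderiv ℝ φ x‖ ≤ Λ
  fderiv_lip : ∀ x y, ‖fderiv ℝ φ x - fderiv ℝ φ y‖ ≤ A * ‖x - y‖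

variable {B Λ A : ℝ} {φ : E → ℝ}

lemma IsC11Bounded.mono {Λ' A' : ℝ} (h : IsC11Bounded B Λ A φ) (hΛ : Λ ≤ Λ') (hA : A ≤ A') :
    IsC11Bounded B Λ' A' φ where
  bound := h.bound
  fderiv_bound x := (h.fderiv_bound x).trans hΛ
  fderiv_lip x y := (h.fderiv_lip x y).trans (by gcongr)

lemma IsTestFunction.differentiable (hφ : IsTestFunction φ) : Differentiable ℝ φ :=
  hφ.1.differentiable (by simp)

lemma IsTestFunction.exists_isC11Bounded (hφ : IsTestFunction φ) :
    ∃ B Λ A, 0 ≤ B ∧ 0 ≤ Λ ∧ 0 ≤ A ∧ IsC11Bounded B Λ A φ := by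
  obtain ⟨B, Λ, -, hφ'⟩ := hφ.exists_isBoundedLipschitz
  obtain ⟨Λ', hΛ'_nonneg, hΛ'⟩ := hφ.exists_norm_fderiv_le
  have hderiv : ContDiff ℝ 1 (fderiv ℝ φ) := hφ.1.fderiv_right (m := 1) (by norm_cast)
  obtain ⟨A, hA⟩ := hderiv.lipschitzWith_of_hasCompactSupport (hφ.2.fderiv ℝ) one_ne_zero
  exact ⟨B, Λ', A, hφ'.bound_nonneg, hΛ'_nonneg, A.2, hφ'.bound, hΛ',
    fun x y => hA.norm_sub_le x y⟩

lemma IsC11Bounded.isBoundedLipschitz (h : IsC11Bounded B Λ A φ) (hφ : Differentiable ℝ φ) :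
    IsBoundedLipschitz B Λ φ :=
  ⟨h.bound, norm_sub_le_of_norm_fderiv_le hφ h.fderiv_bound⟩

lemma IsC11Bounded.abs_add_sub_sub_fderiv_le (h : IsC11Bounded B Λ A φ)
    (hφ : Differentiable ℝ φ) (hA : 0 ≤ A) (x u : E) :
    |φ (x + u) - φ x - fderiv ℝ φ x u| ≤ A * ‖u‖ ^ 2 := by
  have hbound := (convex_closedBall x ‖u‖).norm_image_sub_le_of_norm_hasFDerivWithin_le'
    (f := φ) (f' := fderiv ℝ φ) (φ := fderiv ℝ φ x) (C := A * ‖u‖)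
    (fun z _ => (hφ z).hasFDerivAt.hasFDerivWithinAt)
    (fun z hz => (h.fderiv_lip z x).trans
      (mul_le_mul_of_nonneg_left (mem_closedBall_iff_norm.1 hz) hA))
    (Metric.mem_closedBall_self (norm_nonneg u)) (y := x + u) (by simp)
  rwa [add_sub_cancel_left, mul_assoc, ← sq] at hbound

lemma IsC11Bounded.fderiv_apply {L M : ℝ} (h : IsC11Bounded B Λ A φ) {w : E → E}
    (hΛ : 0 ≤ Λ) (hA : 0 ≤ A) (hM : ∀ x, ‖w x‖ ≤ M)
    (hL : ∀ x y, ‖w x - w y‖ ≤ L * ‖x - y‖) :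
    IsBoundedLipschitz (Λ * M) (Λ * L + A * M) (fun x => fderiv ℝ φ x (w x)) where
  bound x := ((fderiv ℝ φ x).le_opNorm _).trans
    (mul_le_mul (h.fderiv_bound x) (hM x) (norm_nonneg _) hΛ)
  lip x y := by
    have hw : |fderiv ℝ φ x (w x - w y)| ≤ Λ * (L * ‖x - y‖) :=
      ((fderiv ℝ φ x).le_opNorm _).trans
        (mul_le_mul (h.fderiv_bound x) (hL x y) (norm_nonneg _) hΛ)
    have hdφ : |(fderiv ℝ φ x - fderiv ℝ φ y) (w y)| ≤ A * ‖x - y‖ * M :=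
      ((fderiv ℝ φ x - fderiv ℝ φ y).le_opNorm _).trans
        (mul_le_mul (h.fderiv_lip x y) (hM y) (norm_nonneg _) (by positivity))
    calc |fderiv ℝ φ x (w x) - fderiv ℝ φ y (w y)|
        = |fderiv ℝ φ x (w x - w y) + (fderiv ℝ φ x - fderiv ℝ φ y) (w y)| := by
          rw [map_sub, sub_apply, sub_add_sub_cancel]
      _ ≤ (Λ * L + A * M) * ‖x - y‖ := (abs_add_le _ _).trans (by linarith)

lemma norm_add_smul_sub_le {w : E → E} {τ L : ℝ} (hτ : 0 ≤ τ)
    (hw : ∀ x y, ‖w x - w y‖ ≤ L * ‖x - y‖) (x y : E) :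
    ‖(x + τ • w x) - (y + τ • w y)‖ ≤ (1 + τ * L) * ‖x - y‖ := by
  rw [add_sub_add_comm, ← smul_sub]
  refine (norm_add_le _ _).trans ?_
  rw [norm_smul, Real.norm_of_nonneg hτ]
  linarith [mul_le_mul_of_nonneg_left (hw x y) hτ]

lemma IsBoundedLipschitz.abs_add_smul_sub_add_smul_le {τ δ : ℝ} (hφ : IsBoundedLipschitz B Λ φ)
    (hΛ : 0 ≤ Λ) (hτ : 0 ≤ τ) {u w : E} (huw : ‖u - w‖ ≤ δ) (x : E) :
    |φ (x + τ • u) - φ (x + τ • w)| ≤ Λ * (τ * δ) := by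
  refine (hφ.lip _ _).trans ?_
  rw [add_sub_add_left_eq_sub, ← smul_sub, norm_smul, Real.norm_of_nonneg hτ]
  gcongr

lemma IsBoundedLipschitz.abs_add_smul_sub_le {τ δ : ℝ} (hφ : IsBoundedLipschitz B Λ φ)
    (hΛ : 0 ≤ Λ) (hτ : 0 ≤ τ) {u : E} (hu : ‖u‖ ≤ δ) (x : E) :
    |φ (x + τ • u) - φ x| ≤ Λ * (τ * δ) := by
  simpa using hφ.abs_add_smul_sub_add_smul_le hΛ hτ (w := 0) (by simpa using hu) x

end TestFunctionBounds

section Coefficients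

variable {E : Type*} [NormedAddCommGroup E] [NormedSpace ℝ E] [MeasurableSpace E]

/-- The hypotheses (H-1), (H-2), (H-3) on a velocity `v` and a source `h`, without the condition on
the supports of the sources, and with the signs of all constants recorded. -/
structure LipschitzCoefficients (a b : ℝ) (v : SignedMeasure E → E → E)
    (h : SignedMeasure E → SignedMeasure E) (K L M Q P : ℝ) : Prop where
  a_pos : 0 < a
  b_pos : 0 < b
  K_nonneg : 0 ≤ K
  L_nonneg : 0 ≤ L
  M_nonneg : 0 ≤ M
  Q_nonneg : 0 ≤ Q
  P_nonneg : 0 ≤ P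
  v_sub : ∀ μ ν x, ‖v μ x - v ν x‖ ≤ K * gwNorm a b (μ - ν)
  v_lip : ∀ μ x y, ‖v μ x - v μ y‖ ≤ L * ‖x - y‖
  v_bound : ∀ μ x, ‖v μ x‖ ≤ M
  h_sub : ∀ μ ν, gwNorm a b (h μ - h ν) ≤ Q * gwNorm a b (μ - ν)
  h_mass : ∀ μ, mass (h μ) ≤ P

/-- The right-hand side `⟨v[μ] · ∇φ, μ⟩ + ⟨φ, h[μ]⟩` of the weak formulation tested against `φ`. -/
def weakRhs (v : SignedMeasure E → E → E) (h : SignedMeasure E → SignedMeasure E) (φ : E → ℝ)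
    (μ : SignedMeasure E) : ℝ :=
  pairing μ (fun x => fderiv ℝ φ x (v μ x)) + pairing (h μ) φ

/-- One step of length `τ` of the explicit Euler scheme: transport along `v[μ]`, then add
`τ h[μ]`. -/
def eulerStep (v : SignedMeasure E → E → E) (h : SignedMeasure E → SignedMeasure E) (τ : ℝ)
    (μ : SignedMeasure E) : SignedMeasure E :=
  μ.map (fun x => x + τ • v μ x) + τ • h μ

variable {a b K L M Q P : ℝ} {v : SignedMeasure E → E → E} {h : SignedMeasure E → SignedMeasure E}

namespace LipschitzCoefficients

omit [NormedSpace ℝ E] in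
lemma continuous (H : LipschitzCoefficients a b v h K L M Q P) (μ : SignedMeasure E) :
    Continuous (v μ) :=
  continuous_of_norm_sub_le (H.v_lip μ)

lemma isBoundedContinuous_comp (H : LipschitzCoefficients a b v h K L M Q P) {f : E → ℝ}
    (hf : IsBoundedContinuous f) (τ : ℝ) (μ : SignedMeasure E) :
    IsBoundedContinuous (fun x => f (x + τ • v μ x)) := by
  have hv := H.continuous μ
  exact hf.comp (T := fun x => x + τ • v μ x) (by fun_prop)

variable [BorelSpace E]

lemma weakRhs_sub (H : LipschitzCoefficients a b v h K L M Q P) {B Λ A : ℝ} {φ : E → ℝ}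
    (hφ : Differentiable ℝ φ) (hb : IsC11Bounded B Λ A φ) (hΛ : 0 ≤ Λ) (hA : 0 ≤ A)
    (μ ν : SignedMeasure E) : weakRhs v h φ μ - weakRhs v h φ ν =
      pairing (μ - ν) (fun x => fderiv ℝ φ x (v μ x)) +
      pairing ν (fun x => fderiv ℝ φ x (v μ x - v ν x)) + pairing (h μ - h ν) φ := by
  have hv := fun ρ => (hb.fderiv_apply hΛ hA (H.v_bound ρ) (H.v_lip ρ)).isBoundedContinuous
  simp only [map_sub]
  rw [pairing_sub_measure μ ν (hv μ), pairing_sub ν (hv μ) (hv ν),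
    pairing_sub_measure (h μ) (h ν) (hb.isBoundedLipschitz hφ).isBoundedContinuous, weakRhs,
    weakRhs]
  ring

lemma pairing_eulerStep (H : LipschitzCoefficients a b v h K L M Q P) (τ : ℝ)
    (μ : SignedMeasure E) {f : E → ℝ} (hf : IsBoundedContinuous f) :
    pairing (eulerStep v h τ μ) f =
      pairing μ (fun x => f (x + τ • v μ x)) + τ * pairing (h μ) f := by
  have hv := H.continuous μ
  rw [eulerStep, pairing_add_measure _ _ hf, pairing_smul_measure, pairing_map μ (by fun_prop) hf]

variable [FiniteDimensional ℝ E]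

lemma mass_eulerStep_le (H : LipschitzCoefficients a b v h K L M Q P) {τ : ℝ} (hτ : 0 ≤ τ)
    (μ : SignedMeasure E) : mass (eulerStep v h τ μ) ≤ mass μ + τ * P := by
  have : ProperSpace E := FiniteDimensional.proper ℝ E
  refine mass_le_of_forall_isTestFunction _ fun φ hφ hφ1 => ?_
  have htransport : pairing μ (fun x => φ (x + τ • v μ x)) ≤ 1 * mass μ :=
    (le_abs_self _).trans (abs_pairing_le μ fun x => hφ1 _)
  have hsource : pairing (h μ) φ ≤ 1 * P :=
    (le_abs_self _).trans (abs_pairing_le_mul_of_mass_le (H.h_mass μ) hφ1)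
  rw [H.pairing_eulerStep τ μ hφ.isBoundedContinuous]
  linarith [mul_le_mul_of_nonneg_left hsource hτ]

lemma gwNorm_eulerStep_sub_le (H : LipschitzCoefficients a b v h K L M Q P) {τ : ℝ} (hτ : 0 ≤ τ)
    (μ : SignedMeasure E) :
    gwNorm a b (eulerStep v h τ μ - μ) ≤ τ * (b * M * mass μ + a * P) := by
  have : ProperSpace E := FiniteDimensional.proper ℝ E
  refine gwNorm_le_of_forall_isTestFunction H.a_pos H.b_pos _ fun φ _ hφ => ?_
  have hφc := hφ.isBoundedContinuous
  have htransport : pairing μ (fun x => φ (x + τ • v μ x) - φ x) ≤ b * (τ * M) * mass μ :=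
    (le_abs_self _).trans (abs_pairing_le μ fun x =>
      hφ.abs_add_smul_sub_le H.b_pos.le hτ (H.v_bound μ x) x)
  have hsource : pairing (h μ) φ ≤ a * P :=
    (le_abs_self _).trans (abs_pairing_le_mul_of_mass_le (H.h_mass μ) hφ.bound)
  rw [pairing_sub μ (H.isBoundedContinuous_comp hφc τ μ) hφc] at htransport
  rw [pairing_sub_measure _ _ hφc, H.pairing_eulerStep τ μ hφc]
  linarith [mul_le_mul_of_nonneg_left hsource hτ]

lemma gwNorm_eulerStep_sub_eulerStep_le (H : LipschitzCoefficients a b v h K L M Q P) {τ : ℝ}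
    (hτ : 0 ≤ τ) (μ ν : SignedMeasure E) {m : ℝ} (hm : mass ν ≤ m) :
    gwNorm a b (eulerStep v h τ μ - eulerStep v h τ ν) ≤
      (1 + τ * (L + b * K * m + Q)) * gwNorm a b (μ - ν) := by
  have : ProperSpace E := FiniteDimensional.proper ℝ E
  refine gwNorm_le_of_forall_isTestFunction H.a_pos H.b_pos _ fun φ _ hφ => ?_
  have hφc := hφ.isBoundedContinuous
  have hμ := H.isBoundedContinuous_comp hφc τ μ
  have hν := H.isBoundedContinuous_comp hφc τ ν
  have hτL : 0 ≤ τ * L := mul_nonneg hτ H.L_nonneg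
  have htransport : pairing (μ - ν) (fun x => φ (x + τ • v μ x)) ≤
      (1 + τ * L) * gwNorm a b (μ - ν) := by
    refine (le_abs_self _).trans (abs_pairing_le_mul_gwNorm H.a_pos H.b_pos _ (by positivity) ?_)
    exact (hφ.comp H.b_pos.le (norm_add_smul_sub_le hτ (H.v_lip μ))).mono
      (le_mul_of_one_le_left H.a_pos.le (le_add_of_nonneg_right hτL)) (mul_comm _ _).le
  have hvelocity : pairing ν (fun x => φ (x + τ • v μ x) - φ (x + τ • v ν x)) ≤
      b * (τ * (K * gwNorm a b (μ - ν))) * m :=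
    (le_abs_self _).trans (abs_pairing_le_mul_of_mass_le hm fun x =>
      hφ.abs_add_smul_sub_add_smul_le H.b_pos.le hτ (H.v_sub μ ν x) x)
  have hsource : pairing (h μ - h ν) φ ≤ Q * gwNorm a b (μ - ν) :=
    (pairing_le_gwNorm H.a_pos H.b_pos _ hφ).trans (H.h_sub μ ν)
  rw [pairing_sub_measure μ ν hμ] at htransport
  rw [pairing_sub ν hμ hν] at hvelocity
  rw [pairing_sub_measure (h μ) (h ν) hφc] at hsource
  rw [pairing_sub_measure _ _ hφc, H.pairing_eulerStep τ μ hφc, H.pairing_eulerStep τ ν hφc]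
  linarith [mul_le_mul_of_nonneg_left hsource hτ]

omit [FiniteDimensional ℝ E] [BorelSpace E] in
lemma norm_two_steps_sub_le (H : LipschitzCoefficients a b v h K L M Q P) {τ δ : ℝ} (hτ : 0 ≤ τ)
    {μ ν : SignedMeasure E} (hδ : gwNorm a b (ν - μ) ≤ δ) (x : E) :
    ‖x + τ • v μ x + τ • v ν (x + τ • v μ x) - (x + (2 * τ) • v μ x)‖ ≤
      τ * (K * δ + L * (τ * M)) := by
  set y := x + τ • v μ x with hy
  have hyx : ‖y - x‖ ≤ τ * M := by
    rw [hy, add_sub_cancel_left, norm_smul, Real.norm_of_nonneg hτ]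
    exact mul_le_mul_of_nonneg_left (H.v_bound μ x) hτ
  have hmeasure : ‖v ν y - v μ y‖ ≤ K * δ :=
    (H.v_sub ν μ y).trans (mul_le_mul_of_nonneg_left hδ H.K_nonneg)
  have hspace : ‖v μ y - v μ x‖ ≤ L * (τ * M) :=
    (H.v_lip μ y x).trans (mul_le_mul_of_nonneg_left hyx H.L_nonneg)
  have hsplit : y + τ • v ν y - (x + (2 * τ) • v μ x) =
      τ • ((v ν y - v μ y) + (v μ y - v μ x)) := by
    rw [hy, two_mul, add_smul, smul_add, smul_sub, smul_sub]
    abel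
  rw [hsplit, norm_smul, Real.norm_of_nonneg hτ]
  exact mul_le_mul_of_nonneg_left ((norm_add_le _ _).trans (add_le_add hmeasure hspace)) hτ

lemma gwNorm_eulerStep_eulerStep_sub_le (H : LipschitzCoefficients a b v h K L M Q P) {τ : ℝ}
    (hτ : 0 ≤ τ) (μ : SignedMeasure E) {m : ℝ} (hm : mass μ ≤ m) :
    gwNorm a b (eulerStep v h τ (eulerStep v h τ μ) - eulerStep v h (2 * τ) μ) ≤
      τ ^ 2 * (b * (K * (b * M * m + a * P) + L * M) * m + b * M * P +
        Q * (b * M * m + a * P)) := by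
  have : ProperSpace E := FiniteDimensional.proper ℝ E
  set ν := eulerStep v h τ μ with hν
  have hδ : gwNorm a b (ν - μ) ≤ τ * (b * M * m + a * P) := by
    have := H.b_pos
    have := H.M_nonneg
    exact (H.gwNorm_eulerStep_sub_le hτ μ).trans (by gcongr)
  refine gwNorm_le_of_forall_isTestFunction H.a_pos H.b_pos _ fun φ _ hφ => ?_
  have hφc := hφ.isBoundedContinuous
  have hone := H.isBoundedContinuous_comp hφc τ ν
  have htwo : IsBoundedContinuous (fun x => φ (x + τ • v μ x + τ • v ν (x + τ • v μ x))) :=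
    H.isBoundedContinuous_comp hone τ μ
  have hdouble := H.isBoundedContinuous_comp hφc (2 * τ) μ
  have htransport : pairing μ (fun x => φ (x + τ • v μ x + τ • v ν (x + τ • v μ x)) -
      φ (x + (2 * τ) • v μ x)) ≤ b * (τ * (K * (τ * (b * M * m + a * P)) + L * (τ * M))) * m :=
    (le_abs_self _).trans (abs_pairing_le_mul_of_mass_le hm fun x => (hφ.lip _ _).trans
      (mul_le_mul_of_nonneg_left (H.norm_two_steps_sub_le hτ hδ x) H.b_pos.le))
  have hshift : pairing (h μ) (fun x => φ (x + τ • v ν x) - φ x) ≤ b * (τ * M) * P :=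
    (le_abs_self _).trans (abs_pairing_le_mul_of_mass_le (H.h_mass μ) fun x =>
      hφ.abs_add_smul_sub_le H.b_pos.le hτ (H.v_bound ν x) x)
  have hsource : pairing (h ν - h μ) φ ≤ Q * (τ * (b * M * m + a * P)) :=
    (pairing_le_gwNorm H.a_pos H.b_pos _ hφ).trans
      ((H.h_sub ν μ).trans (mul_le_mul_of_nonneg_left hδ H.Q_nonneg))
  rw [pairing_sub μ htwo hdouble] at htransport
  rw [pairing_sub (h μ) hone hφc] at hshift
  rw [pairing_sub_measure (h ν) (h μ) hφc] at hsource
  rw [pairing_sub_measure _ _ hφc, H.pairing_eulerStep τ ν hφc, hν, H.pairing_eulerStep τ μ hone,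
    H.pairing_eulerStep (2 * τ) μ hφc, ← hν]
  linarith [mul_le_mul_of_nonneg_left hshift hτ, mul_le_mul_of_nonneg_left hsource hτ]

end LipschitzCoefficients

end Coefficients

section EulerScheme

lemma le_of_affine_recursion {e : ℕ → ℝ} {α β : ℝ} (hα : 0 ≤ α) (hβ : 0 ≤ β) (h0 : e 0 ≤ 0)
    {k : ℕ} (he : ∀ j < k, e (j + 1) ≤ β + (1 + α) * e j) : e k ≤ k * β * (1 + α) ^ k := by
  induction k with
  | zero => simpa using h0
  | succ k ih =>
    have hstep := he k k.lt_succ_self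
    have hprev : (1 + α) * e k ≤ (1 + α) * (k * β * (1 + α) ^ k) :=
      mul_le_mul_of_nonneg_left (ih fun j hj => he j (by omega)) (by positivity)
    have hβpow : β ≤ β * (1 + α) ^ (k + 1) :=
      le_mul_of_one_le_right hβ (one_le_pow₀ (by linarith))
    calc e (k + 1) ≤ β * (1 + α) ^ (k + 1) + (1 + α) * (k * β * (1 + α) ^ k) := by linarith
      _ = _ := by push_cast; ring

lemma le_mul_exp_of_affine_recursion {e : ℕ → ℝ} {α β τ : ℝ} (hα : 0 ≤ α) (hβ : 0 ≤ β)
    (hτ : 0 ≤ τ) (h0 : e 0 ≤ 0) {k : ℕ} (hk : k * τ ≤ 1)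
    (he : ∀ j < k, e (j + 1) ≤ β * τ ^ 2 + (1 + τ * α) * e j) :
    e k ≤ β * Real.exp α * τ := by
  have hpow : (1 + τ * α) ^ k ≤ Real.exp α := by
    calc (1 + τ * α) ^ k ≤ Real.exp (τ * α) ^ k := by
          gcongr
          rw [add_comm]
          exact Real.add_one_le_exp _
      _ = Real.exp (k * τ * α) := by rw [← Real.exp_nat_mul, mul_assoc]
      _ ≤ Real.exp α := Real.exp_le_exp.2 (mul_le_of_le_one_left hα hk)
  calc e k ≤ k * (β * τ ^ 2) * (1 + τ * α) ^ k :=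
        le_of_affine_recursion (by positivity) (by positivity) h0 he
    _ = k * τ * (β * τ * (1 + τ * α) ^ k) := by ring
    _ ≤ 1 * (β * τ * Real.exp α) := by gcongr
    _ = β * Real.exp α * τ := by ring

variable {E : Type*} [NormedAddCommGroup E] [NormedSpace ℝ E] [MeasurableSpace E]

/-- The `k`-th iterate of the Euler scheme with step `2⁻ⁿ` started at `μ₀`. -/
def eulerScheme (v : SignedMeasure E → E → E) (h : SignedMeasure E → SignedMeasure E)
    (μ₀ : SignedMeasure E) (n k : ℕ) : SignedMeasure E :=
  (eulerStep v h ((1 / 2 : ℝ) ^ n))^[k] μ₀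

variable {a b K L M Q P : ℝ} {v : SignedMeasure E → E → E} {h : SignedMeasure E → SignedMeasure E}

lemma eulerScheme_succ (μ₀ : SignedMeasure E) (n k : ℕ) : eulerScheme v h μ₀ n (k + 1) =
    eulerStep v h ((1 / 2 : ℝ) ^ n) (eulerScheme v h μ₀ n k) :=
  Function.iterate_succ_apply' _ _ _

namespace LipschitzCoefficients

variable [BorelSpace E]

lemma abs_pairing_eulerStep_sub_le (H : LipschitzCoefficients a b v h K L M Q P) {B Λ A : ℝ}
    {φ : E → ℝ} (hφ : IsTestFunction φ) (hb : IsC11Bounded B Λ A φ) (hΛ : 0 ≤ Λ) (hA : 0 ≤ A)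
    {τ m : ℝ} (hτ : 0 ≤ τ) {μ : SignedMeasure E} (hm : mass μ ≤ m) :
    |pairing (eulerStep v h τ μ) φ - pairing μ φ - τ * weakRhs v h φ μ| ≤
      A * (τ * M) ^ 2 * m := by
  have hφc := hφ.isBoundedContinuous
  have htransported := H.isBoundedContinuous_comp hφc τ μ
  have hderiv := (hb.fderiv_apply hΛ hA (H.v_bound μ) (H.v_lip μ)).isBoundedContinuous
  have hremainder : pairing (eulerStep v h τ μ) φ - pairing μ φ - τ * weakRhs v h φ μ =
      pairing μ (fun x => φ (x + τ • v μ x) - φ x - τ * fderiv ℝ φ x (v μ x)) := by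
    rw [pairing_sub μ (htransported.sub hφc) (hderiv.const_mul τ), pairing_sub μ htransported hφc,
      pairing_const_mul, H.pairing_eulerStep τ μ hφc, weakRhs]
    ring
  rw [hremainder]
  refine abs_pairing_le_mul_of_mass_le hm fun x => ?_
  have htaylor := hb.abs_add_sub_sub_fderiv_le hφ.differentiable hA x (τ • v μ x)
  rw [map_smul, smul_eq_mul, norm_smul, Real.norm_of_nonneg hτ] at htaylor
  have := H.v_bound μ x
  exact htaylor.trans (by gcongr)

variable [FiniteDimensional ℝ E]

lemma exists_abs_weakRhs_sub_le (H : LipschitzCoefficients a b v h K L M Q P) {φ : E → ℝ}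
    (hφ : IsTestFunction φ) {m : ℝ} (hm : 0 ≤ m) :
    ∃ C, 0 ≤ C ∧ ∀ μ ν : SignedMeasure E, mass ν ≤ m →
      |weakRhs v h φ μ - weakRhs v h φ ν| ≤ C * gwNorm a b (μ - ν) := by
  obtain ⟨B, Λ, A, hB, hΛ, hA, hb⟩ := hφ.exists_isC11Bounded
  have ha := H.a_pos
  have hb' := H.b_pos
  have hK := H.K_nonneg
  have hL := H.L_nonneg
  have hM := H.M_nonneg
  have hQ := H.Q_nonneg
  refine ⟨Λ * M / a + (Λ * L + A * M) / b + Λ * K * m + (B / a + Λ / b) * Q, by positivity,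
    fun μ ν hν => ?_⟩
  have hmeasure := abs_pairing_le_div_add_div_mul_gwNorm ha hb' (μ - ν) (by positivity)
    (hb.fderiv_apply hΛ hA (H.v_bound μ) (H.v_lip μ))
  have hvelocity : |pairing ν (fun x => fderiv ℝ φ x (v μ x - v ν x))| ≤
      Λ * (K * gwNorm a b (μ - ν)) * m :=
    abs_pairing_le_mul_of_mass_le hν fun x => ((fderiv ℝ φ x).le_opNorm _).trans
      (mul_le_mul (hb.fderiv_bound x) (H.v_sub μ ν x) (norm_nonneg _) hΛ)
  have hsource : |pairing (h μ - h ν) φ| ≤ (B / a + Λ / b) * (Q * gwNorm a b (μ - ν)) :=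
    (abs_pairing_le_div_add_div_mul_gwNorm ha hb' (h μ - h ν) hΛ
      (hb.isBoundedLipschitz hφ.differentiable)).trans
      (mul_le_mul_of_nonneg_left (H.h_sub μ ν) (by positivity))
  rw [H.weakRhs_sub hφ.differentiable hb hΛ hA]
  exact (abs_add_three _ _ _).trans (by linarith)

variable (μ₀ : SignedMeasure E)

lemma mass_eulerScheme_le (H : LipschitzCoefficients a b v h K L M Q P) {n k : ℕ}
    (hk : (k : ℝ) * (1 / 2 : ℝ) ^ n ≤ 1) : mass (eulerScheme v h μ₀ n k) ≤ mass μ₀ + P := by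
  have hsteps : mass (eulerScheme v h μ₀ n k) ≤ mass μ₀ + k * (1 / 2 : ℝ) ^ n * P := by
    clear hk
    induction k with
    | zero => simp [eulerScheme]
    | succ k ih =>
      rw [eulerScheme_succ]
      refine (H.mass_eulerStep_le (by positivity) _).trans ?_
      push_cast
      linarith
  linarith [mul_le_mul_of_nonneg_right hk H.P_nonneg]

lemma gwNorm_eulerScheme_sub_le (H : LipschitzCoefficients a b v h K L M Q P) {n j k : ℕ}
    (hk : ((j + k : ℕ) : ℝ) * (1 / 2 : ℝ) ^ n ≤ 1) :
    gwNorm a b (eulerScheme v h μ₀ n (j + k) - eulerScheme v h μ₀ n j) ≤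
      k * (1 / 2 : ℝ) ^ n * (b * M * (mass μ₀ + P) + a * P) := by
  have hb := H.b_pos
  have hM := H.M_nonneg
  induction k with
  | zero => simp [gwNorm_zero H.a_pos H.b_pos]
  | succ k ih =>
    have hk' : ((j + k : ℕ) : ℝ) * (1 / 2 : ℝ) ^ n ≤ 1 :=
      le_trans (by gcongr; omega) hk
    have hstep : gwNorm a b (eulerScheme v h μ₀ n (j + k + 1) - eulerScheme v h μ₀ n (j + k)) ≤
        (1 / 2 : ℝ) ^ n * (b * M * (mass μ₀ + P) + a * P) := by
      rw [eulerScheme_succ]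
      have := H.mass_eulerScheme_le μ₀ hk'
      exact (H.gwNorm_eulerStep_sub_le (by positivity) _).trans (by gcongr)
    have htri := gwNorm_sub_le H.a_pos H.b_pos (eulerScheme v h μ₀ n (j + k + 1))
      (eulerScheme v h μ₀ n (j + k)) (eulerScheme v h μ₀ n j)
    rw [← add_assoc]
    push_cast
    linarith [ih hk']

lemma exists_gwNorm_eulerScheme_refine_succ_le (H : LipschitzCoefficients a b v h K L M Q P) :
    ∃ α β, 0 ≤ α ∧ 0 ≤ β ∧ ∀ n k : ℕ, (k : ℝ) * (1 / 2 : ℝ) ^ n ≤ 1 →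
      gwNorm a b (eulerScheme v h μ₀ (n + 1) (2 * (k + 1)) - eulerScheme v h μ₀ n (k + 1)) ≤
        β * ((1 / 2 : ℝ) ^ n) ^ 2 + (1 + (1 / 2 : ℝ) ^ n * α) *
          gwNorm a b (eulerScheme v h μ₀ (n + 1) (2 * k) - eulerScheme v h μ₀ n k) := by
  have ha := H.a_pos
  have hb := H.b_pos
  have hK := H.K_nonneg
  have hL := H.L_nonneg
  have hM := H.M_nonneg
  have hQ := H.Q_nonneg
  have hP := H.P_nonneg
  set m := mass μ₀ + P
  have hm : 0 ≤ m := add_nonneg (mass_nonneg _) hP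
  refine ⟨L + b * K * m + Q, (b * (K * (b * M * m + a * P) + L * M) * m + b * M * P +
    Q * (b * M * m + a * P)) / 4, by positivity, by positivity, fun n k hk => ?_⟩
  have hhalf : (1 / 2 : ℝ) ^ n = 2 * (1 / 2 : ℝ) ^ (n + 1) := by rw [pow_succ]; ring
  have hfine : mass (eulerScheme v h μ₀ (n + 1) (2 * k)) ≤ m := by
    refine H.mass_eulerScheme_le μ₀ ?_
    rw [hhalf] at hk
    push_cast
    linarith
  have hlocal := H.gwNorm_eulerStep_eulerStep_sub_le (τ := (1 / 2 : ℝ) ^ (n + 1)) (by positivity)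
    _ hfine
  have hstable := H.gwNorm_eulerStep_sub_eulerStep_le (τ := (1 / 2 : ℝ) ^ n) (by positivity)
    (eulerScheme v h μ₀ (n + 1) (2 * k)) _ (H.mass_eulerScheme_le μ₀ hk)
  rw [← hhalf] at hlocal
  rw [show 2 * (k + 1) = 2 * k + 1 + 1 by ring, eulerScheme_succ, eulerScheme_succ,
    eulerScheme_succ]
  refine (gwNorm_sub_le ha hb _ _ _).trans ((add_le_add hlocal hstable).trans_eq ?_)
  rw [hhalf]
  ring

lemma exists_gwNorm_eulerScheme_refine_le (H : LipschitzCoefficients a b v h K L M Q P) :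
    ∃ A, 0 ≤ A ∧ ∀ n k : ℕ, (k : ℝ) * (1 / 2 : ℝ) ^ n ≤ 1 →
      gwNorm a b (eulerScheme v h μ₀ (n + 1) (2 * k) - eulerScheme v h μ₀ n k) ≤
        A * (1 / 2 : ℝ) ^ n := by
  obtain ⟨α, β, hα, hβ, hrec⟩ := H.exists_gwNorm_eulerScheme_refine_succ_le μ₀
  refine ⟨β * Real.exp α, by positivity, fun n k hk => ?_⟩
  refine le_mul_exp_of_affine_recursion
    (e := fun k => gwNorm a b (eulerScheme v h μ₀ (n + 1) (2 * k) - eulerScheme v h μ₀ n k))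
    hα hβ (by positivity) (by simp [eulerScheme, gwNorm_zero H.a_pos H.b_pos]) hk
    fun j hj => hrec n j (le_trans ?_ hk)
  gcongr

lemma exists_abs_pairing_eulerScheme_succ_sub_le (H : LipschitzCoefficients a b v h K L M Q P)
    {φ : E → ℝ} (hφ : IsTestFunction φ) :
    ∃ C, 0 ≤ C ∧ ∀ n j k : ℕ, ((j + k : ℕ) : ℝ) * (1 / 2 : ℝ) ^ n ≤ 1 →
      |pairing (eulerScheme v h μ₀ n (j + k + 1)) φ - pairing (eulerScheme v h μ₀ n (j + k)) φ -
        (1 / 2 : ℝ) ^ n * weakRhs v h φ (eulerScheme v h μ₀ n j)| ≤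
          C * (k + 1) * ((1 / 2 : ℝ) ^ n) ^ 2 := by
  have ha := H.a_pos
  have hb := H.b_pos
  have hM := H.M_nonneg
  have hP := H.P_nonneg
  set m := mass μ₀ + P
  have hm0 : 0 ≤ m := add_nonneg (mass_nonneg _) hP
  obtain ⟨B, Λ, A, -, hΛ, hA, hφb⟩ := hφ.exists_isC11Bounded
  obtain ⟨C, hC, hrhs⟩ := H.exists_abs_weakRhs_sub_le hφ hm0
  refine ⟨A * M ^ 2 * m + C * (b * M * m + a * P), by positivity, fun n j k hk => ?_⟩
  set τ := (1 / 2 : ℝ) ^ n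
  have hτ : 0 ≤ τ := by positivity
  have hj : (j : ℝ) * τ ≤ 1 := le_trans (by gcongr; omega) hk
  have hstep := H.abs_pairing_eulerStep_sub_le hφ hφb hΛ hA hτ (H.mass_eulerScheme_le μ₀ hk)
  have hdrift : |τ * (weakRhs v h φ (eulerScheme v h μ₀ n (j + k)) -
      weakRhs v h φ (eulerScheme v h μ₀ n j))| ≤ τ * (C * (k * τ * (b * M * m + a * P))) := by
    rw [abs_mul, abs_of_nonneg hτ]
    gcongr
    exact (hrhs _ _ (H.mass_eulerScheme_le μ₀ hj)).trans
      (mul_le_mul_of_nonneg_left (H.gwNorm_eulerScheme_sub_le μ₀ hk) hC)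
  rw [← eulerScheme_succ] at hstep
  calc _ ≤ A * (τ * M) ^ 2 * m + τ * (C * (k * τ * (b * M * m + a * P))) := by
        refine le_trans (le_of_eq ?_) ((abs_add_le _ _).trans (add_le_add hstep hdrift))
        congr 1
        ring
    _ ≤ _ := by
        have hlocal : 0 ≤ A * (τ * M) ^ 2 * m * k := by positivity
        have hspeed : 0 ≤ τ ^ 2 * C * (b * M * m + a * P) := by positivity
        linarith

lemma exists_abs_pairing_eulerScheme_sub_le (H : LipschitzCoefficients a b v h K L M Q P)
    {φ : E → ℝ} (hφ : IsTestFunction φ) :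
    ∃ C, ∀ n j k : ℕ, ((j + k : ℕ) : ℝ) * (1 / 2 : ℝ) ^ n ≤ 1 →
      |pairing (eulerScheme v h μ₀ n (j + k)) φ - pairing (eulerScheme v h μ₀ n j) φ -
        k * (1 / 2 : ℝ) ^ n * weakRhs v h φ (eulerScheme v h μ₀ n j)| ≤
          C * (k * (1 / 2 : ℝ) ^ n) ^ 2 := by
  obtain ⟨C, hC, hsucc⟩ := H.exists_abs_pairing_eulerScheme_succ_sub_le μ₀ hφ
  refine ⟨C, fun n j k hk => ?_⟩
  induction k with
  | zero => simp
  | succ k ih =>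
    have hk' : ((j + k : ℕ) : ℝ) * (1 / 2 : ℝ) ^ n ≤ 1 :=
      le_trans (by gcongr; omega) hk
    refine le_trans (le_of_eq ?_) (((abs_add_le _ _).trans
      (add_le_add (hsucc n j k hk') (ih hk'))).trans ?_)
    · congr 1
      push_cast
      rw [← add_assoc]
      ring
    · have : 0 ≤ C * k * ((1 / 2 : ℝ) ^ n) ^ 2 := by positivity
      push_cast
      linarith

end LipschitzCoefficients

end EulerScheme

section Existence

/-- The number of steps of length `2⁻ⁿ` that fit before time `t`. -/
def dyadicIndex (n : ℕ) (t : ℝ) : ℕ := ⌊t * 2 ^ n⌋₊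

/-- The last multiple of `2⁻ⁿ` before time `t`. -/
def dyadicTime (n : ℕ) (t : ℝ) : ℝ := dyadicIndex n t * (1 / 2 : ℝ) ^ n

lemma dyadicTime_eq_div (n : ℕ) (t : ℝ) : dyadicTime n t = ⌊t * 2 ^ n⌋₊ / 2 ^ n := by
  rw [dyadicTime, one_div, inv_pow, ← div_eq_mul_inv, dyadicIndex]

lemma dyadicTime_le (n : ℕ) {t : ℝ} (ht : 0 ≤ t) : dyadicTime n t ≤ t := by
  rw [dyadicTime_eq_div, div_le_iff₀ (by positivity)]
  exact Nat.floor_le (by positivity)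

lemma lt_dyadicTime_add (n : ℕ) (t : ℝ) : t < dyadicTime n t + (1 / 2 : ℝ) ^ n := by
  rw [dyadicTime_eq_div, one_div, inv_pow, inv_eq_one_div, ← add_div, lt_div_iff₀ (by positivity)]
  exact Nat.lt_floor_add_one _

lemma dyadicIndex_mono (n : ℕ) {s t : ℝ} (hst : s ≤ t) : dyadicIndex n s ≤ dyadicIndex n t :=
  Nat.floor_mono (by gcongr)

lemma dyadicIndex_succ (n : ℕ) (t : ℝ) :
    ∃ r ≤ 1, dyadicIndex (n + 1) t = 2 * dyadicIndex n t + r := by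
  have hhalf : dyadicIndex n t = dyadicIndex (n + 1) t / 2 := by
    rw [dyadicIndex, dyadicIndex, ← Nat.floor_div_ofNat, pow_succ, ← mul_assoc,
      mul_div_cancel_right₀ _ (by norm_num)]
  exact ⟨dyadicIndex (n + 1) t % 2, by omega, by omega⟩

lemma tendsto_const_mul_half_pow (C : ℝ) :
    Tendsto (fun n : ℕ => C * (1 / 2 : ℝ) ^ n) atTop (𝓝 0) := by
  simpa using (tendsto_pow_atTop_nhds_zero_of_lt_one (r := (1 / 2 : ℝ)) (by norm_num)
    (by norm_num)).const_mul C

lemma tendsto_of_abs_sub_le {u : ℕ → ℝ} {l C : ℝ} (hu : ∀ n, |u n - l| ≤ C * (1 / 2 : ℝ) ^ n) :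
    Tendsto u atTop (𝓝 l) :=
  tendsto_iff_norm_sub_tendsto_zero.2
    (squeeze_zero (fun _ => norm_nonneg _) hu (tendsto_const_mul_half_pow C))

lemma tendsto_dyadicTime {t : ℝ} (ht : 0 ≤ t) :
    Tendsto (fun n => dyadicTime n t) atTop (𝓝 t) :=
  tendsto_of_abs_sub_le (C := 1) fun n => by
    rw [abs_sub_comm, abs_of_nonneg (sub_nonneg.2 (dyadicTime_le n ht)), one_mul]
    linarith [lt_dyadicTime_add n t]

lemma hasDerivWithinAt_of_abs_sub_sub_le_sq {F : ℝ → ℝ} {g C t : ℝ} {S : Set ℝ}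
    (hF : ∀ s ∈ S, |F s - F t - (s - t) * g| ≤ C * (s - t) ^ 2) : HasDerivWithinAt F g S t := by
  rw [hasDerivWithinAt_iff_isLittleO]
  have hquad : (fun s => F s - F t - (s - t) • g) =O[𝓝[S] t] fun s => ‖s - t‖ ^ 2 := by
    refine Asymptotics.IsBigO.of_bound C ?_
    filter_upwards [self_mem_nhdsWithin] with s hs
    rw [norm_pow, norm_norm, Real.norm_eq_abs, Real.norm_eq_abs, sq_abs]
    exact hF s hs
  exact hquad.trans_isLittleO
    ((Asymptotics.isLittleO_pow_sub_sub t one_lt_two).mono nhdsWithin_le_nhds)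

variable {E : Type*} [NormedAddCommGroup E] [NormedSpace ℝ E] [MeasurableSpace E]

/-- The Euler approximation with step `2⁻ⁿ` as a piecewise constant function of time. -/
def eulerCurve (v : SignedMeasure E → E → E) (h : SignedMeasure E → SignedMeasure E)
    (μ₀ : SignedMeasure E) (n : ℕ) (t : ℝ) : SignedMeasure E :=
  eulerScheme v h μ₀ n (dyadicIndex n t)

/-- On `[0, 1]` the curve `σ` is the uniform limit of the Euler approximations, at the rate
`C 2⁻ⁿ`. -/
def IsEulerLimit (a b : ℝ) (v : SignedMeasure E → E → E) (h : SignedMeasure E → SignedMeasure E)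
    (μ₀ : SignedMeasure E) (C : ℝ) (σ : ℝ → SignedMeasure E) : Prop :=
  ∀ t ∈ Icc (0 : ℝ) 1, ∀ n, gwNorm a b (eulerCurve v h μ₀ n t - σ t) ≤ C * (1 / 2 : ℝ) ^ n

variable {a b K L M Q P : ℝ} {v : SignedMeasure E → E → E} {h : SignedMeasure E → SignedMeasure E}

lemma exists_eulerCurve_eq (μ₀ : SignedMeasure E) (n : ℕ) {s t : ℝ} (hs : 0 ≤ s) (hst : s ≤ t)
    (ht : t ≤ 1) : ∃ k : ℕ,
      eulerCurve v h μ₀ n t = eulerScheme v h μ₀ n (dyadicIndex n s + k) ∧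
      ((dyadicIndex n s + k : ℕ) : ℝ) * (1 / 2 : ℝ) ^ n ≤ 1 ∧
      dyadicTime n t - dyadicTime n s = k * (1 / 2 : ℝ) ^ n := by
  obtain ⟨k, hk⟩ := Nat.exists_eq_add_of_le (dyadicIndex_mono n hst)
  refine ⟨k, by rw [eulerCurve, hk], hk ▸ (dyadicTime_le n (hs.trans hst)).trans ht, ?_⟩
  rw [dyadicTime, dyadicTime, hk]
  push_cast
  ring

variable [FiniteDimensional ℝ E] [BorelSpace E] (μ₀ : SignedMeasure E)

namespace LipschitzCoefficients

lemma mass_eulerCurve_le (H : LipschitzCoefficients a b v h K L M Q P) (n : ℕ) {t : ℝ}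
    (ht : t ∈ Icc (0 : ℝ) 1) : mass (eulerCurve v h μ₀ n t) ≤ mass μ₀ + P :=
  H.mass_eulerScheme_le μ₀ ((dyadicTime_le n ht.1).trans ht.2)

lemma gwNorm_eulerCurve_sub_le (H : LipschitzCoefficients a b v h K L M Q P) (n : ℕ) {s t : ℝ}
    (hs : 0 ≤ s) (hst : s ≤ t) (ht : t ≤ 1) :
    gwNorm a b (eulerCurve v h μ₀ n t - eulerCurve v h μ₀ n s) ≤
      (b * M * (mass μ₀ + P) + a * P) * (dyadicTime n t - dyadicTime n s) := by
  obtain ⟨k, hk, hk1, htime⟩ := exists_eulerCurve_eq (v := v) (h := h) μ₀ n hs hst ht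
  rw [hk, htime, mul_comm]
  exact H.gwNorm_eulerScheme_sub_le μ₀ hk1

lemma exists_gwNorm_eulerCurve_succ_sub_le (H : LipschitzCoefficients a b v h K L M Q P) :
    ∃ C, 0 ≤ C ∧ ∀ t ∈ Icc (0 : ℝ) 1, ∀ n,
      gwNorm a b (eulerCurve v h μ₀ n t - eulerCurve v h μ₀ (n + 1) t) ≤ C * (1 / 2 : ℝ) ^ n := by
  have ha := H.a_pos
  have hb := H.b_pos
  have hM := H.M_nonneg
  have hP := H.P_nonneg
  have hm := mass_nonneg μ₀
  obtain ⟨A, hA, hrefine⟩ := H.exists_gwNorm_eulerScheme_refine_le μ₀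
  set G := b * M * (mass μ₀ + P) + a * P
  have : 0 ≤ G := by positivity
  refine ⟨A + G, by positivity, fun t ht n => ?_⟩
  obtain ⟨r, hr, hsucc⟩ := dyadicIndex_succ n t
  have hk : ((2 * dyadicIndex n t + r : ℕ) : ℝ) * (1 / 2 : ℝ) ^ (n + 1) ≤ 1 :=
    hsucc ▸ (dyadicTime_le (n + 1) ht.1).trans ht.2
  have hlast : r * (1 / 2 : ℝ) ^ (n + 1) * G ≤ 1 * (1 / 2 : ℝ) ^ n * G := by
    gcongr ?_ * ?_ * G
    · exact_mod_cast hr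
    · exact pow_le_pow_of_le_one (by norm_num) (by norm_num) n.le_succ
  have htri := gwNorm_sub_le ha hb (eulerScheme v h μ₀ (n + 1) (2 * dyadicIndex n t + r))
    (eulerScheme v h μ₀ (n + 1) (2 * dyadicIndex n t)) (eulerScheme v h μ₀ n (dyadicIndex n t))
  rw [gwNorm_sub_comm ha hb, eulerCurve, eulerCurve, hsucc]
  linarith [H.gwNorm_eulerScheme_sub_le μ₀ hk,
    hrefine n (dyadicIndex n t) ((dyadicTime_le n ht.1).trans ht.2)]

lemma exists_isEulerLimit (H : LipschitzCoefficients a b v h K L M Q P) :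
    ∃ C σ, IsEulerLimit a b v h μ₀ C σ := by
  obtain ⟨C, hC, hsucc⟩ := H.exists_gwNorm_eulerCurve_succ_sub_le μ₀
  have hcauchy : ∀ t ∈ Icc (0 : ℝ) 1, ∀ n j,
      gwNorm a b (eulerCurve v h μ₀ n t - eulerCurve v h μ₀ (n + j) t) ≤
        2 * C * ((1 / 2 : ℝ) ^ n - (1 / 2 : ℝ) ^ (n + j)) := by
    intro t ht n j
    induction j with
    | zero => simp [gwNorm_zero H.a_pos H.b_pos]
    | succ j ih =>
      have htri := gwNorm_sub_le H.a_pos H.b_pos (eulerCurve v h μ₀ n t)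
        (eulerCurve v h μ₀ (n + j) t) (eulerCurve v h μ₀ (n + j + 1) t)
      rw [← add_assoc, pow_succ _ (n + j)]
      linarith [hsucc t ht (n + j)]
  have hlim : ∀ t : ℝ, ∃ ν : SignedMeasure E, t ∈ Icc (0 : ℝ) 1 → ∀ n,
      gwNorm a b (eulerCurve v h μ₀ n t - ν) ≤ 2 * C * (1 / 2 : ℝ) ^ n := by
    intro t
    by_cases ht : t ∈ Icc (0 : ℝ) 1
    · obtain ⟨ν, hν⟩ := exists_gwNorm_limit H.a_pos H.b_pos (fun n => H.mass_eulerCurve_le μ₀ n ht)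
        (δ := fun n => 2 * C * (1 / 2 : ℝ) ^ n) fun n k hnk => by
          obtain ⟨j, rfl⟩ := Nat.exists_eq_add_of_le hnk
          refine (hcauchy t ht n j).trans ?_
          gcongr
          exact sub_le_self _ (by positivity)
      exact ⟨ν, fun _ => hν⟩
    · exact ⟨0, fun h => absurd h ht⟩
  choose σ hσ using hlim
  exact ⟨2 * C, σ, hσ⟩

end LipschitzCoefficients

namespace IsEulerLimit

variable {μ₀} {C : ℝ} {σ : ℝ → SignedMeasure E} {φ : E → ℝ} {s t : ℝ}

lemma apply_zero (hσ : IsEulerLimit a b v h μ₀ C σ) (ha : 0 < a) (hb : 0 < b) : σ 0 = μ₀ := by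
  have hzero : gwNorm a b (μ₀ - σ 0) ≤ 0 := by
    refine ge_of_tendsto' (tendsto_const_mul_half_pow C) fun n => ?_
    simpa [eulerCurve, eulerScheme, dyadicIndex] using hσ 0 ⟨le_rfl, zero_le_one⟩ n
  exact (sub_eq_zero.1 (eq_zero_of_gwNorm_le_zero ha hb hzero)).symm

lemma gwNorm_sub_le (hσ : IsEulerLimit a b v h μ₀ C σ)
    (H : LipschitzCoefficients a b v h K L M Q P) (hs : 0 ≤ s) (hst : s ≤ t) (ht : t ≤ 1) :
    gwNorm a b (σ t - σ s) ≤ (b * M * (mass μ₀ + P) + a * P) * (t - s) := by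
  set G := b * M * (mass μ₀ + P) + a * P
  have hlim : Tendsto (fun n => C * (1 / 2 : ℝ) ^ n + G * (dyadicTime n t - dyadicTime n s) +
      C * (1 / 2 : ℝ) ^ n) atTop (𝓝 (G * (t - s))) := by
    simpa using ((tendsto_const_mul_half_pow C).add (((tendsto_dyadicTime (hs.trans hst)).sub
      (tendsto_dyadicTime hs)).const_mul G)).add (tendsto_const_mul_half_pow C)
  refine ge_of_tendsto' hlim fun n => ?_
  have hfirst := hσ t ⟨hs.trans hst, ht⟩ n
  rw [gwNorm_sub_comm H.a_pos H.b_pos] at hfirst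
  linarith [hσ s ⟨hs, hst.trans ht⟩ n, H.gwNorm_eulerCurve_sub_le μ₀ n hs hst ht,
    SignedTransport.gwNorm_sub_le H.a_pos H.b_pos (σ t) (eulerCurve v h μ₀ n t) (σ s),
    SignedTransport.gwNorm_sub_le H.a_pos H.b_pos (eulerCurve v h μ₀ n t)
      (eulerCurve v h μ₀ n s) (σ s)]

lemma tendsto_pairing (hσ : IsEulerLimit a b v h μ₀ C σ) (ha : 0 < a) (hb : 0 < b)
    (hφ : IsTestFunction φ) (ht : t ∈ Icc (0 : ℝ) 1) :
    Tendsto (fun n => pairing (eulerCurve v h μ₀ n t) φ) atTop (𝓝 (pairing (σ t) φ)) := by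
  obtain ⟨B, Λ, hΛ, hφb⟩ := hφ.exists_isBoundedLipschitz
  have hB := hφb.bound_nonneg
  refine tendsto_of_abs_sub_le (C := (B / a + Λ / b) * C) fun n => ?_
  rw [← pairing_sub_measure _ _ hφ.isBoundedContinuous, mul_assoc]
  exact (abs_pairing_le_div_add_div_mul_gwNorm ha hb _ hΛ hφb).trans
    (mul_le_mul_of_nonneg_left (hσ t ht n) (by positivity))

lemma tendsto_weakRhs (hσ : IsEulerLimit a b v h μ₀ C σ)
    (H : LipschitzCoefficients a b v h K L M Q P) (hφ : IsTestFunction φ)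
    (ht : t ∈ Icc (0 : ℝ) 1) :
    Tendsto (fun n => weakRhs v h φ (eulerCurve v h μ₀ n t)) atTop
      (𝓝 (weakRhs v h φ (σ t))) := by
  obtain ⟨C', hC', hrhs⟩ :=
    H.exists_abs_weakRhs_sub_le hφ (add_nonneg (mass_nonneg μ₀) H.P_nonneg)
  refine tendsto_of_abs_sub_le (C := C' * C) fun n => ?_
  rw [abs_sub_comm, mul_assoc]
  refine (hrhs _ _ (H.mass_eulerCurve_le μ₀ n ht)).trans (mul_le_mul_of_nonneg_left ?_ hC')
  rw [gwNorm_sub_comm H.a_pos H.b_pos]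
  exact hσ t ht n

lemma exists_abs_weakRhs_sub_le (hσ : IsEulerLimit a b v h μ₀ C σ)
    (H : LipschitzCoefficients a b v h K L M Q P) (hφ : IsTestFunction φ) :
    ∃ D, 0 ≤ D ∧ ∀ s t, 0 ≤ s → s ≤ t → t ≤ 1 →
      |weakRhs v h φ (σ t) - weakRhs v h φ (σ s)| ≤ D * (t - s) := by
  have ha := H.a_pos
  have hb := H.b_pos
  have hM := H.M_nonneg
  have hP := H.P_nonneg
  have hm := mass_nonneg μ₀
  obtain ⟨C', hC', hrhs⟩ := H.exists_abs_weakRhs_sub_le hφ (add_nonneg hm hP)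
  refine ⟨C' * (b * M * (mass μ₀ + P) + a * P), by positivity, fun s t hs hst ht => ?_⟩
  refine le_of_tendsto_of_tendsto' ((hσ.tendsto_weakRhs H hφ ⟨hs.trans hst, ht⟩).sub
    (hσ.tendsto_weakRhs H hφ ⟨hs, hst.trans ht⟩)).abs
    (((tendsto_dyadicTime (hs.trans hst)).sub (tendsto_dyadicTime hs)).const_mul _) fun n => ?_
  rw [mul_assoc]
  exact (hrhs _ _ (H.mass_eulerCurve_le μ₀ n ⟨hs, hst.trans ht⟩)).trans
    (mul_le_mul_of_nonneg_left (H.gwNorm_eulerCurve_sub_le μ₀ n hs hst ht) hC')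

lemma exists_abs_pairing_sub_sub_le (hσ : IsEulerLimit a b v h μ₀ C σ)
    (H : LipschitzCoefficients a b v h K L M Q P) (hφ : IsTestFunction φ) :
    ∃ D, ∀ s t, 0 ≤ s → s ≤ t → t ≤ 1 →
      |pairing (σ t) φ - pairing (σ s) φ - (t - s) * weakRhs v h φ (σ s)| ≤ D * (t - s) ^ 2 := by
  obtain ⟨D, hscheme⟩ := H.exists_abs_pairing_eulerScheme_sub_le μ₀ hφ
  refine ⟨D, fun s t hs hst ht => ?_⟩
  have hs' : s ∈ Icc (0 : ℝ) 1 := ⟨hs, hst.trans ht⟩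
  have htime := (tendsto_dyadicTime (hs.trans hst)).sub (tendsto_dyadicTime hs)
  have hpairing := fun r hr => hσ.tendsto_pairing (t := r) H.a_pos H.b_pos hφ hr
  refine le_of_tendsto_of_tendsto' (((hpairing t ⟨hs.trans hst, ht⟩).sub (hpairing s hs')).sub
    (htime.mul (hσ.tendsto_weakRhs H hφ hs'))).abs ((htime.pow 2).const_mul D) fun n => ?_
  obtain ⟨k, hk, hk1, hkt⟩ := exists_eulerCurve_eq (v := v) (h := h) μ₀ n hs hst ht
  rw [hk, hkt]
  exact hscheme n (dyadicIndex n s) k hk1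

lemma hasDerivWithinAt_pairing (hσ : IsEulerLimit a b v h μ₀ C σ)
    (H : LipschitzCoefficients a b v h K L M Q P) (hφ : IsTestFunction φ)
    (ht : t ∈ Icc (0 : ℝ) 1) :
    HasDerivWithinAt (fun s => pairing (σ s) φ) (weakRhs v h φ (σ t)) (Icc 0 1) t := by
  obtain ⟨D₁, hD₁, hrhs⟩ := hσ.exists_abs_weakRhs_sub_le H hφ
  obtain ⟨D₂, htaylor⟩ := hσ.exists_abs_pairing_sub_sub_le H hφ
  refine hasDerivWithinAt_of_abs_sub_sub_le_sq (C := D₂ + D₁) fun s hs => ?_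
  rcases le_total t s with hst | hst
  · have : 0 ≤ D₁ * (s - t) ^ 2 := by positivity
    linarith [htaylor t s ht.1 hst hs.2]
  · have hchange : |(t - s) * (weakRhs v h φ (σ t) - weakRhs v h φ (σ s))| ≤
        (t - s) * (D₁ * (t - s)) := by
      rw [abs_mul, abs_of_nonneg (sub_nonneg.2 hst)]
      exact mul_le_mul_of_nonneg_left (hrhs s t hs.1 hst ht.2) (sub_nonneg.2 hst)
    calc |pairing (σ s) φ - pairing (σ t) φ - (s - t) * weakRhs v h φ (σ t)|
        = |(t - s) * (weakRhs v h φ (σ t) - weakRhs v h φ (σ s)) -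
            (pairing (σ t) φ - pairing (σ s) φ - (t - s) * weakRhs v h φ (σ s))| := by
          congr 1
          ring
      _ ≤ (t - s) * (D₁ * (t - s)) + D₂ * (t - s) ^ 2 :=
          (abs_sub _ _).trans (add_le_add hchange (htaylor s t hs.1 hst ht.2))
      _ = (D₂ + D₁) * (s - t) ^ 2 := by ring

end IsEulerLimit

end Existence

section Flow

variable {E : Type*} [NormedAddCommGroup E] [NormedSpace ℝ E] {B Λ A L M c ε τ : ℝ} {ψ : E → ℝ}
  {w W : E → E}

lemma IsSmoothApprox.norm_sub_le (h : IsSmoothApprox c L M ε w W) (x y : E) :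
    ‖W x - W y‖ ≤ L * ‖x - y‖ :=
  norm_sub_le_of_norm_fderiv_le (h.contDiff.differentiable (by simp)) h.fderiv_bound x y

lemma IsSmoothApprox.norm_smul_le (h : IsSmoothApprox c L M ε w W) (hτ : 0 ≤ τ) (x : E) :
    ‖τ • W x‖ ≤ τ * M := by
  rw [norm_smul, Real.norm_of_nonneg hτ]
  exact mul_le_mul_of_nonneg_left (h.bound x) hτ

lemma IsSmoothApprox.norm_id_add_smul_fderiv_le (h : IsSmoothApprox c L M ε w W) (hτ : 0 ≤ τ)
    (x : E) : ‖ContinuousLinearMap.id ℝ E + τ • fderiv ℝ W x‖ ≤ 1 + τ * L := by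
  refine (norm_add_le _ _).trans (add_le_add ContinuousLinearMap.norm_id_le ?_)
  rw [norm_smul, Real.norm_of_nonneg hτ]
  exact mul_le_mul_of_nonneg_left (h.fderiv_bound x) hτ

lemma IsSmoothApprox.hasFDerivAt_comp (h : IsSmoothApprox c L M ε w W) (hψ : Differentiable ℝ ψ)
    (τ : ℝ) (x : E) : HasFDerivAt (fun x => ψ (x + τ • W x))
      ((fderiv ℝ ψ (x + τ • W x)).comp (ContinuousLinearMap.id ℝ E + τ • fderiv ℝ W x)) x := by
  have hW : DifferentiableAt ℝ W x := h.contDiff.differentiable (by simp) x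
  have hflow : HasFDerivAt (fun x => x + τ • W x)
      (ContinuousLinearMap.id ℝ E + τ • fderiv ℝ W x) x :=
    (hasFDerivAt_id x).add (hW.hasFDerivAt.const_smul τ)
  exact (hψ _).hasFDerivAt.comp x hflow

lemma IsTestFunction.comp_flow [ProperSpace E] (hψ : IsTestFunction ψ)
    (h : IsSmoothApprox c L M ε w W) (hτ : 0 ≤ τ) :
    IsTestFunction (fun x => ψ (x + τ • W x)) := by
  refine ⟨hψ.1.comp (contDiff_id.add (contDiff_const.smul h.contDiff)), ?_⟩
  obtain ⟨r, hr⟩ := hψ.2.isCompact.isBounded.subset_ball 0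
  refine hasCompactSupport_of_forall_norm (r := r + τ * M) fun x hx => ?_
  by_contra hne
  have hball : ‖x + τ • W x‖ < r := mem_ball_zero_iff.1 (hr (subset_tsupport _ hne))
  have htri : ‖x‖ ≤ ‖x + τ • W x‖ + ‖τ • W x‖ := by
    simpa using norm_sub_le (x + τ • W x) (τ • W x)
  linarith [h.norm_smul_le hτ x]

lemma IsC11Bounded.comp_flow (hb : IsC11Bounded B Λ A ψ) (hψ : Differentiable ℝ ψ) (hA : 0 ≤ A)
    (hΛ : 0 ≤ Λ) (h : IsSmoothApprox c L M ε w W) (hτ : 0 ≤ τ) :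
    IsC11Bounded B ((1 + τ * L) * Λ) ((1 + τ * L) ^ 2 * A + τ * (c * L / ε) * Λ)
      (fun x => ψ (x + τ • W x)) := by
  have hL : 0 ≤ L := (norm_nonneg _).trans (h.fderiv_bound 0)
  set T : E → E := fun x => x + τ • W x
  set T' : E → E →L[ℝ] E := fun x => ContinuousLinearMap.id ℝ E + τ • fderiv ℝ W x
  have hfderiv (x : E) : fderiv ℝ (fun x => ψ (x + τ • W x)) x = (fderiv ℝ ψ (T x)).comp (T' x) :=
    (h.hasFDerivAt_comp hψ τ x).fderiv
  refine ⟨fun x => hb.bound _, fun x => ?_, fun x y => ?_⟩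
  · rw [hfderiv, mul_comm]
    exact (ContinuousLinearMap.opNorm_comp_le _ _).trans (mul_le_mul (hb.fderiv_bound _)
      (h.norm_id_add_smul_fderiv_le hτ x) (norm_nonneg _) hΛ)
  · have houter : ‖(fderiv ℝ ψ (T x) - fderiv ℝ ψ (T y)).comp (T' x)‖ ≤
        A * ((1 + τ * L) * ‖x - y‖) * (1 + τ * L) :=
      (ContinuousLinearMap.opNorm_comp_le _ _).trans (mul_le_mul
        ((hb.fderiv_lip _ _).trans
          (mul_le_mul_of_nonneg_left (norm_add_smul_sub_le hτ h.norm_sub_le x y) hA))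
        (h.norm_id_add_smul_fderiv_le hτ x) (norm_nonneg _) (by positivity))
    have hT' : ‖T' x - T' y‖ ≤ τ * (c * L / ε * ‖x - y‖) := by
      rw [add_sub_add_left_eq_sub, ← smul_sub, norm_smul, Real.norm_of_nonneg hτ]
      exact mul_le_mul_of_nonneg_left (h.fderiv_lip x y) hτ
    have hinner : ‖(fderiv ℝ ψ (T y)).comp (T' x - T' y)‖ ≤ Λ * (τ * (c * L / ε * ‖x - y‖)) :=
      (ContinuousLinearMap.opNorm_comp_le _ _).trans
        (mul_le_mul (hb.fderiv_bound _) hT' (norm_nonneg _) hΛ)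
    calc ‖fderiv ℝ (fun x => ψ (x + τ • W x)) x - fderiv ℝ (fun x => ψ (x + τ • W x)) y‖
        = ‖(fderiv ℝ ψ (T x) - fderiv ℝ ψ (T y)).comp (T' x) +
            (fderiv ℝ ψ (T y)).comp (T' x - T' y)‖ := by
          rw [hfderiv, hfderiv, ContinuousLinearMap.sub_comp, ContinuousLinearMap.comp_sub,
            sub_add_sub_cancel]
      _ ≤ _ := (norm_add_le _ _).trans (add_le_add houter hinner)
      _ = _ := by ring

lemma IsC11Bounded.norm_fderiv_comp_flow_sub_le (hb : IsC11Bounded B Λ A ψ)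
    (hψ : Differentiable ℝ ψ) (hA : 0 ≤ A) (hΛ : 0 ≤ Λ) (h : IsSmoothApprox c L M ε w W)
    (hτ : 0 ≤ τ) (x : E) :
    ‖fderiv ℝ (fun x => ψ (x + τ • W x) - ψ x) x‖ ≤ τ * (Λ * L + A * M) := by
  have hshift : ‖fderiv ℝ ψ (x + τ • W x) - fderiv ℝ ψ x‖ ≤ A * (τ * M) := by
    refine (hb.fderiv_lip _ _).trans (mul_le_mul_of_nonneg_left ?_ hA)
    rw [add_sub_cancel_left]
    exact h.norm_smul_le hτ x
  have hchain : ‖τ • (fderiv ℝ ψ (x + τ • W x)).comp (fderiv ℝ W x)‖ ≤ τ * (Λ * L) := by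
    rw [norm_smul, Real.norm_of_nonneg hτ]
    exact mul_le_mul_of_nonneg_left ((ContinuousLinearMap.opNorm_comp_le _ _).trans
      (mul_le_mul (hb.fderiv_bound _) (h.fderiv_bound x) (norm_nonneg _) hΛ)) hτ
  rw [((h.hasFDerivAt_comp hψ τ x).fun_sub (hψ x).hasFDerivAt).fderiv,
    ContinuousLinearMap.comp_add, ContinuousLinearMap.comp_id, ContinuousLinearMap.comp_smul,
    add_sub_right_comm]
  linarith [norm_add_le (fderiv ℝ ψ (x + τ • W x) - fderiv ℝ ψ x)
    (τ • (fderiv ℝ ψ (x + τ • W x)).comp (fderiv ℝ W x))]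

lemma IsC11Bounded.isBoundedLipschitz_flow_remainder (hb : IsC11Bounded B Λ A ψ)
    (hψ : Differentiable ℝ ψ) (hA : 0 ≤ A) (hΛ : 0 ≤ Λ) (h : IsSmoothApprox c L M ε w W)
    (hτ : 0 ≤ τ) :
    IsBoundedLipschitz (A * (τ * M) ^ 2) (τ * (2 * (Λ * L + A * M)))
      (fun x => ψ (x + τ • W x) - ψ x - τ * fderiv ℝ ψ x (W x)) where
  bound x := by
    have htaylor := hb.abs_add_sub_sub_fderiv_le hψ hA x (τ • W x)
    rw [map_smul, smul_eq_mul] at htaylor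
    exact htaylor.trans (mul_le_mul_of_nonneg_left
      (pow_le_pow_left₀ (norm_nonneg _) (h.norm_smul_le hτ x) 2) hA)
  lip x y := by
    have hincrement : |(ψ (x + τ • W x) - ψ x) - (ψ (y + τ • W y) - ψ y)| ≤
        τ * (Λ * L + A * M) * ‖x - y‖ :=
      norm_sub_le_of_norm_fderiv_le
        (fun z => ((h.hasFDerivAt_comp hψ τ z).sub (hψ z).hasFDerivAt).differentiableAt)
        (hb.norm_fderiv_comp_flow_sub_le hψ hA hΛ h hτ) x y
    have hlinear : |τ * fderiv ℝ ψ x (W x) - τ * fderiv ℝ ψ y (W y)| ≤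
        τ * ((Λ * L + A * M) * ‖x - y‖) := by
      rw [← mul_sub, abs_mul, abs_of_nonneg hτ]
      exact mul_le_mul_of_nonneg_left
        ((hb.fderiv_apply hΛ hA h.bound h.norm_sub_le).lip x y) hτ
    rw [sub_sub_sub_comm]
    linarith [abs_sub ((ψ (x + τ • W x) - ψ x) - (ψ (y + τ • W y) - ψ y))
      (τ * fderiv ℝ ψ x (W x) - τ * fderiv ℝ ψ y (W y))]

end Flow

section SolutionCurves

variable {E : Type*} [NormedAddCommGroup E] [NormedSpace ℝ E] [FiniteDimensional ℝ E]
  [MeasurableSpace E] [BorelSpace E]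
  {a b K L M Q P : ℝ} {v : SignedMeasure E → E → E} {h : SignedMeasure E → SignedMeasure E}
  {σ μ ν : ℝ → SignedMeasure E}

/-- Weak solutions on `[0,1]` of `∂ₜσ + div(v[σ] σ) = h[σ]`, without initial condition. -/
structure IsSolutionCurve (a b : ℝ) (v : SignedMeasure E → E → E)
    (h : SignedMeasure E → SignedMeasure E) (σ : ℝ → SignedMeasure E) : Prop where
  continuous : ∀ s ∈ Icc (0 : ℝ) 1,
    Tendsto (fun t => gwNorm a b (σ t - σ s)) (𝓝[Icc 0 1] s) (𝓝 0)
  weak : ∀ φ, IsTestFunction φ → ∀ t ∈ Icc (0 : ℝ) 1,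
    HasDerivWithinAt (fun s => pairing (σ s) φ) (weakRhs v h φ (σ t)) (Icc 0 1) t

lemma eventually_const_mul_le (C : ℝ) {δ : ℝ} (hδ : 0 < δ) : ∀ᶠ x in 𝓝[>] (0 : ℝ), C * x ≤ δ := by
  have hlim : Tendsto (fun x => C * x) (𝓝[>] 0) (𝓝 0) := by
    simpa using ((continuous_const_mul C).tendsto 0).mono_left nhdsWithin_le_nhds
  exact hlim.eventually (ge_mem_nhds hδ)

namespace IsSolutionCurve

lemma continuousOn_gwPseudoMetric (S : IsSolutionCurve a b v h σ) (ha : 0 < a) (hb : 0 < b) :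
    letI := gwPseudoMetric (E := E) ha hb
    ContinuousOn σ (Icc 0 1) := by
  let _ := gwPseudoMetric (E := E) ha hb
  intro s hs
  rw [ContinuousWithinAt, tendsto_iff_dist_tendsto_zero]
  exact S.continuous s hs

lemma continuousOn_gwNorm_sub (Sμ : IsSolutionCurve a b v h μ) (Sν : IsSolutionCurve a b v h ν)
    (ha : 0 < a) (hb : 0 < b) : ContinuousOn (fun t => gwNorm a b (μ t - ν t)) (Icc 0 1) := by
  let _ := gwPseudoMetric (E := E) ha hb
  exact fun s hs => (Sμ.continuousOn_gwPseudoMetric ha hb s hs).dist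
    (Sν.continuousOn_gwPseudoMetric ha hb s hs)

lemma eventually_gwNorm_sub_le (S : IsSolutionCurve a b v h σ) (ha : 0 < a) (hb : 0 < b) {θ : ℝ}
    (hθ : 0 < θ) : ∀ᶠ τ in 𝓝[>] (0 : ℝ), ∀ s ∈ Icc (0 : ℝ) 1, ∀ r ∈ Icc (0 : ℝ) 1, |r - s| ≤ τ →
      gwNorm a b (σ r - σ s) ≤ θ := by
  let _ := gwPseudoMetric (E := E) ha hb
  have huniform := isCompact_Icc.uniformContinuousOn_of_continuous
    (S.continuousOn_gwPseudoMetric ha hb)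
  obtain ⟨τ₀, hτ₀, hmodulus⟩ := Metric.uniformContinuousOn_iff.1 huniform θ hθ
  filter_upwards [Ioo_mem_nhdsGT hτ₀] with τ hτ s hs r hr hrs
  exact (hmodulus r hr s hs (hrs.trans_lt hτ.2)).le

/-- A solution is not known a priori to have bounded mass. Its continuity nevertheless makes the
pairings with small functions of bounded slope small, uniformly in time. -/
lemma eventually_abs_pairing_le (S : IsSolutionCurve a b v h σ) (ha : 0 < a) (hb : 0 < b)
    {Λ δ : ℝ} (hΛ : 0 ≤ Λ) (hδ : 0 < δ) : ∀ᶠ B in 𝓝[>] (0 : ℝ), ∀ s ∈ Icc (0 : ℝ) 1, ∀ f,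
      IsBoundedLipschitz B Λ f → |pairing (σ s) f| ≤ δ := by
  refine isCompact_Icc.induction_on
    (p := fun T => ∀ᶠ B in 𝓝[>] (0 : ℝ), ∀ s ∈ T, ∀ f, IsBoundedLipschitz B Λ f →
      |pairing (σ s) f| ≤ δ) (by simp)
    (fun _ _ hst ht => ht.mono fun _ hB s hs => hB s (hst hs))
    (fun _ _ hs ht => (hs.and ht).mono fun _ hB s hsT => hsT.elim (hB.1 s) (hB.2 s))
    fun x hx => ?_
  obtain ⟨θ, hθle, hθ⟩ := ((eventually_const_mul_le (1 / a + Λ / b) (half_pos hδ)).and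
    self_mem_nhdsWithin).exists
  refine ⟨_, (S.continuous x hx).eventually (gt_mem_nhds hθ), ?_⟩
  filter_upwards [eventually_const_mul_le (mass (σ x)) (half_pos hδ), Ioo_mem_nhdsGT one_pos]
    with B hBmass hB s hs f hf
  have hnear : |pairing (σ s - σ x) f| ≤ (1 / a + Λ / b) * θ :=
    (abs_pairing_le_div_add_div_mul_gwNorm ha hb _ hΛ (hf.mono hB.2.le le_rfl)).trans
      (mul_le_mul_of_nonneg_left (le_of_lt hs) (by positivity))
  have hcenter : |pairing (σ x) f| ≤ B * mass (σ x) := abs_pairing_le _ hf.bound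
  rw [pairing_sub_measure _ _ hf.isBoundedContinuous] at hnear
  linarith [abs_sub_abs_le_abs_sub (pairing (σ s) f) (pairing (σ x) f)]

end IsSolutionCurve

end SolutionCurves

section Consistency

variable {E : Type*} [NormedAddCommGroup E] [NormedSpace ℝ E] [FiniteDimensional ℝ E]
  [MeasurableSpace E] [BorelSpace E]
  {a b K L M Q P B Λ A κ δ : ℝ} {v : SignedMeasure E → E → E}
  {h : SignedMeasure E → SignedMeasure E} {σ : ℝ → SignedMeasure E}

namespace IsSolutionCurve

lemma eventually_abs_weakRhs_sub_le (S : IsSolutionCurve a b v h σ)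
    (H : LipschitzCoefficients a b v h K L M Q P) (hΛ : 0 ≤ Λ) (hA : 0 ≤ A) (hδ : 0 < δ) :
    ∀ᶠ θ in 𝓝[>] (0 : ℝ), ∀ s ∈ Icc (0 : ℝ) 1, ∀ μ, gwNorm a b (μ - σ s) ≤ θ → ∀ ψ,
      Differentiable ℝ ψ → IsC11Bounded B Λ A ψ →
      |weakRhs v h ψ μ - weakRhs v h ψ (σ s)| ≤ δ := by
  have ha := H.a_pos
  have hb := H.b_pos
  have hK := H.K_nonneg
  have hL := H.L_nonneg
  have hM := H.M_nonneg
  have hQ := H.Q_nonneg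
  obtain ⟨B₀, hsmall, hB₀⟩ := ((S.eventually_abs_pairing_le ha hb (Λ := Λ * (2 * L) + A)
    (by positivity) (half_pos hδ)).and self_mem_nhdsWithin).exists
  filter_upwards [eventually_const_mul_le K one_pos, eventually_const_mul_le (Λ * K) hB₀,
    eventually_const_mul_le (Λ * M / a + (Λ * L + A * M) / b + (B / a + Λ / b) * Q)
      (half_pos hδ)] with θ hθ₁ hθ₂ hθ₃ s hs μ hμ ψ hψ hbψ
  have hB : 0 ≤ B := (abs_nonneg _).trans (hbψ.bound 0)
  have htransport : |pairing (μ - σ s) (fun x => fderiv ℝ ψ x (v μ x))| ≤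
      (Λ * M / a + (Λ * L + A * M) / b) * θ :=
    (abs_pairing_le_div_add_div_mul_gwNorm ha hb _ (by positivity)
      (hbψ.fderiv_apply hΛ hA (H.v_bound μ) (H.v_lip μ))).trans
      (mul_le_mul_of_nonneg_left hμ (by positivity))
  have hvelocity : |pairing (σ s) (fun x => fderiv ℝ ψ x (v μ x - v (σ s) x))| ≤ δ / 2 := by
    have hlip (x y : E) : ‖v μ x - v (σ s) x - (v μ y - v (σ s) y)‖ ≤ 2 * L * ‖x - y‖ := by
      rw [sub_sub_sub_comm]
      linarith [norm_sub_le (v μ x - v μ y) (v (σ s) x - v (σ s) y), H.v_lip μ x y,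
        H.v_lip (σ s) x y]
    have hle (x : E) : ‖v μ x - v (σ s) x‖ ≤ K * θ := (H.v_sub μ (σ s) x).trans (by gcongr)
    exact hsmall s hs _ ((hbψ.fderiv_apply hΛ hA hle hlip).mono (by linarith)
      (by linarith [mul_le_mul_of_nonneg_left hθ₁ hA]))
  have hsource : |pairing (h μ - h (σ s)) ψ| ≤ (B / a + Λ / b) * (Q * θ) :=
    (abs_pairing_le_div_add_div_mul_gwNorm ha hb _ hΛ (hbψ.isBoundedLipschitz hψ)).trans
      (mul_le_mul_of_nonneg_left ((H.h_sub _ _).trans (by gcongr)) (by positivity))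
  rw [H.weakRhs_sub hψ hbψ hΛ hA]
  exact (abs_add_three _ _ _).trans (by linarith)

lemma eventually_abs_pairing_sub_sub_weakRhs_le (S : IsSolutionCurve a b v h σ)
    (H : LipschitzCoefficients a b v h K L M Q P) (hΛ : 0 ≤ Λ) (hA : 0 ≤ A) (hδ : 0 < δ) :
    ∀ᶠ τ in 𝓝[>] (0 : ℝ), ∀ s, 0 ≤ s → s + τ ≤ 1 → ∀ ψ, IsTestFunction ψ →
      IsC11Bounded B Λ A ψ →
      |pairing (σ (s + τ)) ψ - pairing (σ s) ψ - τ * weakRhs v h ψ (σ s)| ≤ τ * δ := by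
  obtain ⟨θ, hrhs, hθ⟩ := ((S.eventually_abs_weakRhs_sub_le H (B := B) hΛ hA hδ).and
    self_mem_nhdsWithin).exists
  filter_upwards [S.eventually_gwNorm_sub_le H.a_pos H.b_pos hθ, self_mem_nhdsWithin]
    with τ hmodulus hτ s hs hsτ ψ hψ hbψ
  have hτ : 0 < τ := hτ
  have hsub : Icc s (s + τ) ⊆ Icc 0 1 := Icc_subset_Icc hs hsτ
  have hs' : s ∈ Icc s (s + τ) := left_mem_Icc.2 (by linarith)
  have hderiv (r : ℝ) (hr : r ∈ Icc s (s + τ)) : HasDerivWithinAt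
      (fun r => pairing (σ r) ψ - r * weakRhs v h ψ (σ s))
      (weakRhs v h ψ (σ r) - weakRhs v h ψ (σ s)) (Icc s (s + τ)) r := by
    simpa using ((S.weak ψ hψ r (hsub hr)).mono hsub).fun_sub
      ((hasDerivWithinAt_id r (Icc s (s + τ))).mul_const (weakRhs v h ψ (σ s)))
  have hclose (r : ℝ) (hr : r ∈ Icc s (s + τ)) : gwNorm a b (σ r - σ s) ≤ θ :=
    hmodulus s (hsub hs') r (hsub hr) (abs_le.2 ⟨by linarith [hr.1], by linarith [hr.2]⟩)
  have hmean := (convex_Icc s (s + τ)).norm_image_sub_le_of_norm_hasDerivWithin_le hderiv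
    (fun r hr => hrhs s (hsub hs') (σ r) (hclose r hr) ψ hψ.differentiable hbψ) hs'
    (right_mem_Icc.2 (by linarith))
  rw [Real.norm_eq_abs, Real.norm_eq_abs, add_sub_cancel_left, abs_of_pos hτ] at hmean
  convert hmean using 1
  · congr 1
    ring
  · ring

lemma eventually_abs_pairing_comp_flow_sub_le (S : IsSolutionCurve a b v h σ) (ha : 0 < a)
    (hb : 0 < b) (hL : 0 ≤ L) (hM : 0 ≤ M) (hΛ : 0 ≤ Λ) (hA : 0 ≤ A) (hδ : 0 < δ) :
    ∀ᶠ τ in 𝓝[>] (0 : ℝ), ∀ s ∈ Icc (0 : ℝ) 1, ∀ c ε w W, IsSmoothApprox c L M ε w W →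
      ∀ ψ, IsTestFunction ψ → IsC11Bounded B Λ A ψ →
      |pairing (σ s) (fun x => ψ (x + τ • W x)) - pairing (σ s) ψ -
        τ * pairing (σ s) (fun x => fderiv ℝ ψ x (W x))| ≤ τ * δ := by
  have : ProperSpace E := FiniteDimensional.proper ℝ E
  obtain ⟨B₀, hsmall, hB₀⟩ := ((S.eventually_abs_pairing_le ha hb
    (Λ := 2 * (Λ * L + A * M)) (by positivity) hδ).and self_mem_nhdsWithin).exists
  filter_upwards [eventually_const_mul_le (A * M ^ 2) hB₀, self_mem_nhdsWithin]
    with τ hτB hτ s hs c ε w W hW ψ hψ hbψ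
  have hτ : 0 < τ := hτ
  set g : E → ℝ := fun x => ψ (x + τ • W x) - ψ x - τ * fderiv ℝ ψ x (W x) with hg
  have hremainder : IsBoundedLipschitz (A * (τ * M) ^ 2) (τ * (2 * (Λ * L + A * M))) g :=
    hbψ.isBoundedLipschitz_flow_remainder hψ.differentiable hA hΛ hW hτ.le
  have hscaled : IsBoundedLipschitz B₀ (2 * (Λ * L + A * M)) (fun x => τ⁻¹ * g x) := by
    refine (hremainder.const_mul τ⁻¹).mono ?_ ?_ <;> rw [abs_of_pos (inv_pos.2 hτ)]
    · field_simp
      linarith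
    · rw [inv_mul_cancel_left₀ hτ.ne']
  have hflow := (hψ.comp_flow hW hτ.le).isBoundedContinuous
  have hlinear := (hbψ.fderiv_apply hΛ hA hW.bound hW.norm_sub_le).isBoundedContinuous
  have hsplit : pairing (σ s) g = pairing (σ s) (fun x => ψ (x + τ • W x)) - pairing (σ s) ψ -
      τ * pairing (σ s) (fun x => fderiv ℝ ψ x (W x)) := by
    rw [hg, pairing_sub _ (hflow.sub hψ.isBoundedContinuous) (hlinear.const_mul τ),
      pairing_sub _ hflow hψ.isBoundedContinuous, pairing_const_mul]
  have hle := hsmall s hs _ hscaled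
  rw [pairing_const_mul, abs_mul, abs_of_pos (inv_pos.2 hτ), inv_mul_le_iff₀ hτ] at hle
  rwa [← hsplit]

lemma eventually_abs_pairing_fderiv_sub_le (S : IsSolutionCurve a b v h σ) (ha : 0 < a)
    (hb : 0 < b) (hL : 0 ≤ L) (hΛ : 0 ≤ Λ) (hA : 0 ≤ A) (hκ : 0 ≤ κ) (hδ : 0 < δ) :
    ∀ᶠ ε in 𝓝[>] (0 : ℝ), ∀ s ∈ Icc (0 : ℝ) 1, ∀ c M w W,
      (∀ x y, ‖w x - w y‖ ≤ L * ‖x - y‖) → IsSmoothApprox c L M ε w W →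
      ∀ ψ, IsC11Bounded B Λ (A + κ / ε) ψ →
      |pairing (σ s) (fun x => fderiv ℝ ψ x (W x - w x))| ≤ δ := by
  obtain ⟨B₀, hsmall, hB₀⟩ := ((S.eventually_abs_pairing_le ha hb
    (Λ := Λ * (2 * L) + L * (A + κ)) (by positivity) hδ).and self_mem_nhdsWithin).exists
  filter_upwards [eventually_const_mul_le (Λ * L) hB₀, Ioo_mem_nhdsGT one_pos]
    with ε hεB hε s hs c M w W hw hW ψ hbψ
  have hlip (x y : E) : ‖W x - w x - (W y - w y)‖ ≤ 2 * L * ‖x - y‖ := by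
    rw [sub_sub_sub_comm]
    linarith [norm_sub_le (W x - W y) (w x - w y), hW.norm_sub_le x y, hw x y]
  have hcurvature : (A + κ / ε) * (L * ε) ≤ L * (A + κ) := by
    have hcancel : κ / ε * ε = κ := div_mul_cancel₀ _ hε.1.ne'
    calc (A + κ / ε) * (L * ε) = L * (A * ε + κ) := by linear_combination L * hcancel
      _ ≤ L * (A + κ) := by gcongr; exact mul_le_of_le_one_right hA hε.2.le
  have hκε : 0 ≤ κ / ε := div_nonneg hκ hε.1.le
  exact hsmall s hs _ ((hbψ.fderiv_apply hΛ (by positivity) hW.close hlip).mono (by linarith)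
    (by linarith))

/-- Consistency of transporting test functions by one explicit step of a mollified velocity `W`.
The second derivative of the test function may blow up like the inverse of the mollification
radius `ε`, which is what the backward iteration of such steps produces. -/
lemma eventually_abs_pairing_sub_comp_flow_le (S : IsSolutionCurve a b v h σ)
    (H : LipschitzCoefficients a b v h K L M Q P) (hΛ : 0 ≤ Λ) (hA : 0 ≤ A) (hκ : 0 ≤ κ)
    (hδ : 0 < δ) :
    ∀ᶠ ε in 𝓝[>] (0 : ℝ), ∀ᶠ τ in 𝓝[>] (0 : ℝ), ∀ s, 0 ≤ s → s + τ ≤ 1 → ∀ c w W,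
      (∀ x y, ‖w x - w y‖ ≤ L * ‖x - y‖) → (∀ x, ‖w x‖ ≤ M) → IsSmoothApprox c L M ε w W →
      ∀ ψ, IsTestFunction ψ → IsC11Bounded B Λ (A + κ / ε) ψ →
      |pairing (σ (s + τ)) ψ - pairing (σ s) (fun x => ψ (x + τ • W x)) -
        τ * (pairing (σ s) (fun x => fderiv ℝ ψ x (v (σ s) x - w x)) + pairing (h (σ s)) ψ)| ≤
      τ * δ := by
  have hδ' : 0 < δ / 3 := by positivity
  filter_upwards [S.eventually_abs_pairing_fderiv_sub_le H.a_pos H.b_pos H.L_nonneg hΛ hA hκ hδ',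
    self_mem_nhdsWithin] with ε hmollify hε
  have hAε : 0 ≤ A + κ / ε := add_nonneg hA (div_nonneg hκ (le_of_lt hε))
  filter_upwards [S.eventually_abs_pairing_sub_sub_weakRhs_le H hΛ hAε hδ',
    S.eventually_abs_pairing_comp_flow_sub_le H.a_pos H.b_pos H.L_nonneg H.M_nonneg hΛ hAε hδ',
    self_mem_nhdsWithin] with τ hevolve hflow hτ s hs hsτ c w W hw hwM hW ψ hψ hbψ
  have hτ : 0 < τ := hτ
  have hsI : s ∈ Icc (0 : ℝ) 1 := ⟨hs, by linarith⟩
  have hbc {u : E → E} {C : ℝ} (hu : ∀ x, ‖u x‖ ≤ C) (hlip : ∀ x y, ‖u x - u y‖ ≤ L * ‖x - y‖) :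
      IsBoundedContinuous fun x => fderiv ℝ ψ x (u x) :=
    (hbψ.fderiv_apply hΛ hAε hu hlip).isBoundedContinuous
  have hv := hbc (H.v_bound (σ s)) (H.v_lip (σ s))
  have hsplit : weakRhs v h ψ (σ s) = pairing (σ s) (fun x => fderiv ℝ ψ x (W x)) -
      pairing (σ s) (fun x => fderiv ℝ ψ x (W x - w x)) +
      (pairing (σ s) (fun x => fderiv ℝ ψ x (v (σ s) x - w x)) + pairing (h (σ s)) ψ) := by
    simp only [map_sub]
    rw [pairing_sub _ (hbc hW.bound hW.norm_sub_le) (hbc hwM hw), pairing_sub _ hv (hbc hwM hw),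
      weakRhs]
    ring
  have hevolve' := hevolve s hs hsτ ψ hψ hbψ
  have hflow' := hflow s hsI c ε w W hW ψ hψ hbψ
  have hmollify' : |τ * pairing (σ s) (fun x => fderiv ℝ ψ x (W x - w x))| ≤ τ * (δ / 3) := by
    rw [abs_mul, abs_of_pos hτ]
    exact mul_le_mul_of_nonneg_left (hmollify s hsI c M w W hw hW ψ hbψ) hτ.le
  rw [hsplit] at hevolve'
  rw [abs_le] at hevolve' hflow' hmollify' ⊢
  constructor <;> linarith

end IsSolutionCurve

end Consistency

section Backward

variable {E : Type*} [NormedAddCommGroup E] [NormedSpace ℝ E]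
  {c L M ε B Λ A s τ : ℝ} {ψ : E → ℝ}

/-- The `C^{1,1}` bounds at time `s` which are preserved by composing test functions, backwards in
time from `1`, with explicit steps of `L`-Lipschitz velocities mollified at radius `ε`. -/
def IsBackwardBounded (c L ε B Λ A s : ℝ) (ψ : E → ℝ) : Prop :=
  IsC11Bounded B (Λ * Real.exp (L * (1 - s)))
    ((A + c * L * Λ / ε * (1 - s)) * Real.exp (L * (1 - s)) ^ 2) ψ

lemma one_add_mul_mul_exp_le (L s t τ : ℝ) :
    (1 + τ * L) * Real.exp (L * (t - (s + τ))) ≤ Real.exp (L * (t - s)) := by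
  calc (1 + τ * L) * Real.exp (L * (t - (s + τ)))
      ≤ Real.exp (τ * L) * Real.exp (L * (t - (s + τ))) := by
        gcongr
        linarith [Real.add_one_le_exp (τ * L)]
    _ = Real.exp (L * (t - s)) := by rw [← Real.exp_add]; ring_nf

lemma IsC11Bounded.isBackwardBounded (hψ : IsC11Bounded B Λ A ψ) (hc : 0 ≤ c) (hL : 0 ≤ L)
    (hε : 0 ≤ ε) (hΛ : 0 ≤ Λ) (hA : 0 ≤ A) (hs : s ≤ 1) : IsBackwardBounded c L ε B Λ A s ψ := by
  have : 0 ≤ 1 - s := by linarith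
  have hexp : 1 ≤ Real.exp (L * (1 - s)) := Real.one_le_exp (by positivity)
  refine hψ.mono (le_mul_of_one_le_right hΛ hexp) ?_
  calc A ≤ A + c * L * Λ / ε * (1 - s) := le_add_of_nonneg_right (by positivity)
    _ ≤ _ := le_mul_of_one_le_right (by positivity) (one_le_pow₀ hexp)

namespace IsBackwardBounded

lemma isC11Bounded (hψ : IsBackwardBounded c L ε B Λ A s ψ) (hc : 0 ≤ c) (hL : 0 ≤ L)
    (hε : 0 ≤ ε) (hΛ : 0 ≤ Λ) (hA : 0 ≤ A) (hs : s ∈ Icc (0 : ℝ) 1) :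
    IsC11Bounded B (Λ * Real.exp L)
      (A * Real.exp L ^ 2 + c * L * Λ * Real.exp L ^ 2 / ε) ψ := by
  have hexp : Real.exp (L * (1 - s)) ≤ Real.exp L :=
    Real.exp_le_exp.2 (mul_le_of_le_one_right hL (by linarith [hs.1]))
  refine hψ.mono (by gcongr) ?_
  calc (A + c * L * Λ / ε * (1 - s)) * Real.exp (L * (1 - s)) ^ 2
      ≤ (A + c * L * Λ / ε * 1) * Real.exp L ^ 2 := by gcongr; linarith [hs.1]
    _ = A * Real.exp L ^ 2 + c * L * Λ * Real.exp L ^ 2 / ε := by ring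

lemma comp_flow {w W : E → E}
    (hψ : IsBackwardBounded c L ε B Λ A (s + τ) ψ) (hψdiff : Differentiable ℝ ψ) (hc : 0 ≤ c)
    (hL : 0 ≤ L) (hε : 0 ≤ ε) (hΛ : 0 ≤ Λ) (hA : 0 ≤ A) (hτ : 0 ≤ τ) (hsτ : s + τ ≤ 1)
    (hW : IsSmoothApprox c L M ε w W) :
    IsBackwardBounded c L ε B Λ A s (fun x => ψ (x + τ • W x)) := by
  have hexp := one_add_mul_mul_exp_le L s 1 τ
  set e := Real.exp (L * (1 - s))
  set e' := Real.exp (L * (1 - (s + τ)))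
  have : 0 ≤ 1 - (s + τ) := by linarith
  have hs : 0 ≤ 1 - s := by linarith
  have hone : 1 ≤ e := Real.one_le_exp (by positivity)
  have hle : e' ≤ e ^ 2 := by
    have h₁ : e' ≤ e := Real.exp_le_exp.2 (by gcongr; linarith)
    exact h₁.trans (le_self_pow₀ hone two_ne_zero)
  have hsq : ((1 + τ * L) * e') ^ 2 ≤ e ^ 2 := by gcongr
  refine (IsC11Bounded.comp_flow hψ hψdiff (by positivity) (by positivity) hW hτ).mono ?_ ?_
  · calc (1 + τ * L) * (Λ * e') = Λ * ((1 + τ * L) * e') := by ring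
      _ ≤ Λ * e := by gcongr
  · calc (1 + τ * L) ^ 2 * ((A + c * L * Λ / ε * (1 - (s + τ))) * e' ^ 2) +
          τ * (c * L / ε) * (Λ * e')
        = (A + c * L * Λ / ε * (1 - (s + τ))) * ((1 + τ * L) * e') ^ 2 +
          c * L * Λ / ε * τ * e' := by ring
      _ ≤ (A + c * L * Λ / ε * (1 - (s + τ))) * e ^ 2 + c * L * Λ / ε * τ * e ^ 2 := by gcongr
      _ = (A + c * L * Λ / ε * (1 - s)) * e ^ 2 := by ring

end IsBackwardBounded

lemma le_add_nat_mul_of_forall_step {α : Type*} {I : ℝ → α → ℝ} {G : ℝ → α → Prop}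
    {s₀ τ r c₀ : ℝ} {n : ℕ} (hτ : 0 ≤ τ)
    (hstep : ∀ s y, s₀ ≤ s → s + τ ≤ s₀ + n * τ → G (s + τ) y →
      ∃ x, G s x ∧ I (s + τ) y ≤ I s x + τ * r)
    (hinit : ∀ x, G s₀ x → I s₀ x ≤ c₀) (k : ℕ) (hk : k ≤ n) (y : α) (hy : G (s₀ + k * τ) y) :
    I (s₀ + k * τ) y ≤ c₀ + k * τ * r := by
  induction k generalizing y with
  | zero =>
    simp only [Nat.cast_zero, zero_mul, add_zero] at hy ⊢
    exact hinit y hy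
  | succ k ih =>
    have htime : s₀ + (k + 1 : ℕ) * τ = s₀ + k * τ + τ := by push_cast; ring
    have hkn : s₀ + (k + 1 : ℕ) * τ ≤ s₀ + n * τ := by gcongr
    rw [htime] at hy hkn ⊢
    obtain ⟨x, hx, hle⟩ := hstep _ y (le_add_of_nonneg_right (by positivity)) hkn hy
    have hprev := ih (by omega) x hx
    push_cast
    linarith

/-- The test function is transported backwards along `n` explicit steps, with `n → ∞` for a fixed
mollification radius `ε`. Its `C^{1,1}` bounds are uniform in `n`, so that it suffices to control a
single step up to an arbitrarily small relative error. -/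
lemma le_of_backward_steps [FiniteDimensional ℝ E] {I : ℝ → (E → ℝ) → ℝ}
    {G : ℝ → (E → ℝ) → Prop} {w : ℝ → E → E} {s₀ t r c₀ : ℝ} (hL : 0 ≤ L) (hs₀ : 0 ≤ s₀)
    (hst : s₀ ≤ t) (ht : t ≤ 1) (hw : ∀ s x y, ‖w s x - w s y‖ ≤ L * ‖x - y‖)
    (hwM : ∀ s x, ‖w s x‖ ≤ M)
    (hG : ∀ s τ ψ (W : E → E), s₀ ≤ s → 0 ≤ τ → s + τ ≤ t → G (s + τ) ψ →
      (∀ x y, ‖W x - W y‖ ≤ L * ‖x - y‖) → (∀ x, ‖W x‖ ≤ M) → G s (fun x => ψ (x + τ • W x)))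
    (hstep : ∀ B Λ A κ δ, 0 ≤ Λ → 0 ≤ A → 0 ≤ κ → 0 < δ →
      ∀ᶠ ε in 𝓝[>] (0 : ℝ), ∀ᶠ τ in 𝓝[>] (0 : ℝ), ∀ s, s₀ ≤ s → s + τ ≤ t → ∀ c W,
        IsSmoothApprox c L M ε (w s) W → ∀ ψ, IsTestFunction ψ →
        IsC11Bounded B Λ (A + κ / ε) ψ → G (s + τ) ψ →
        I (s + τ) ψ ≤ I s (fun x => ψ (x + τ • W x)) + τ * (r + δ))
    (hinit : ∀ ψ, IsTestFunction ψ → G s₀ ψ → I s₀ ψ ≤ c₀) {φ : E → ℝ} (hφ : IsTestFunction φ)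
    (hGφ : G t φ) : I t φ ≤ c₀ + (t - s₀) * r := by
  have : ProperSpace E := FiniteDimensional.proper ℝ E
  obtain rfl | hlt := hst.eq_or_lt
  · simpa using hinit φ hφ hGφ
  refine le_of_forall_pos_le_add fun δ hδ => ?_
  obtain ⟨c, hc, hmollify⟩ := exists_isSmoothApprox E E
  obtain ⟨B, Λ, A, -, hΛ, hA, hbφ⟩ := hφ.exists_isC11Bounded
  obtain ⟨ε, hε, hεpos⟩ := ((hstep B (Λ * Real.exp L) (A * Real.exp L ^ 2)
    (c * L * Λ * Real.exp L ^ 2) δ (by positivity) (by positivity) (by positivity) hδ).and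
    self_mem_nhdsWithin).exists
  have hε₀ : 0 ≤ ε := le_of_lt hεpos
  have hlim : Tendsto (fun n : ℕ => (t - s₀) / n) atTop (𝓝[>] 0) :=
    tendsto_nhdsWithin_iff.2 ⟨tendsto_const_div_atTop_nhds_zero_nat _,
      (eventually_gt_atTop 0).mono fun n hn => div_pos (sub_pos.2 hlt) (Nat.cast_pos.2 hn)⟩
  obtain ⟨n, hτstep, hn⟩ := ((hlim.eventually hε).and (eventually_gt_atTop 0)).exists
  set τ := (t - s₀) / n
  have hτ : 0 ≤ τ := div_nonneg (sub_nonneg.2 hst) n.cast_nonneg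
  have hnτ : n * τ = t - s₀ := mul_div_cancel₀ _ (Nat.cast_ne_zero.2 hn.ne')
  have hend : s₀ + n * τ = t := by linarith
  have hiterate := le_add_nat_mul_of_forall_step (I := I) (s₀ := s₀) (c₀ := c₀) (r := r + δ)
    (G := fun s ψ => IsTestFunction ψ ∧ IsBackwardBounded c L ε B Λ A s ψ ∧ G s ψ) (n := n) hτ
    (fun s ψ hs hsn ⟨hψ, hbψ, hGψ⟩ => by
      rw [hend] at hsn
      obtain ⟨W, hW⟩ := hmollify (w s) L M ε hεpos hL (hwM s) (hw s)
      exact ⟨_, ⟨hψ.comp_flow hW hτ, hbψ.comp_flow hψ.differentiable hc hL hε₀ hΛ hA hτ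
        (hsn.trans ht) hW, hG s τ ψ W hs hτ hsn hGψ hW.norm_sub_le hW.bound⟩,
        hτstep s hs hsn c W hW ψ hψ
          (hbψ.isC11Bounded hc hL hε₀ hΛ hA ⟨by linarith, by linarith⟩) hGψ⟩)
    (fun ψ hψ => hinit ψ hψ.1 hψ.2.2) n le_rfl φ
    (by rw [hend]; exact ⟨hφ, hbφ.isBackwardBounded hc hL hε₀ hΛ hA ht, hGφ⟩)
  rw [hend, hnτ] at hiterate
  have herror : (t - s₀) * δ ≤ δ := mul_le_of_le_one_left hδ.le (by linarith)
  linarith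

end Backward

section MassAndSupport

variable {E : Type*} [NormedAddCommGroup E] [NormedSpace ℝ E] [FiniteDimensional ℝ E]
  [MeasurableSpace E] [BorelSpace E]
  {a b K L M Q P B Λ A κ δ t : ℝ} {v : SignedMeasure E → E → E}
  {h : SignedMeasure E → SignedMeasure E} {σ : ℝ → SignedMeasure E}

omit [FiniteDimensional ℝ E] [MeasurableSpace E] [BorelSpace E] in
lemma IsBoundedLipschitz.abs_fderiv_apply_le {f : E → ℝ} {u : E} {C : ℝ}
    (hf : IsBoundedLipschitz B Λ f) (hΛ : 0 ≤ Λ) (hu : ‖u‖ ≤ C) (x : E) :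
    |fderiv ℝ f x u| ≤ Λ * C :=
  ((fderiv ℝ f x).le_opNorm u).trans (mul_le_mul
    (norm_fderiv_le_of_lip' ℝ hΛ (Eventually.of_forall fun y => hf.lip y x)) hu
    (norm_nonneg _) hΛ)

namespace IsSolutionCurve

lemma eventually_abs_pairing_sub_comp_flow_self_le (S : IsSolutionCurve a b v h σ)
    (H : LipschitzCoefficients a b v h K L M Q P) (hΛ : 0 ≤ Λ) (hA : 0 ≤ A) (hκ : 0 ≤ κ)
    (hδ : 0 < δ) :
    ∀ᶠ ε in 𝓝[>] (0 : ℝ), ∀ᶠ τ in 𝓝[>] (0 : ℝ), ∀ s, 0 ≤ s → s + τ ≤ 1 → ∀ c W,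
      IsSmoothApprox c L M ε (v (σ s)) W →
      ∀ ψ, IsTestFunction ψ → IsC11Bounded B Λ (A + κ / ε) ψ →
      |pairing (σ (s + τ)) ψ - pairing (σ s) (fun x => ψ (x + τ • W x)) -
        τ * pairing (h (σ s)) ψ| ≤ τ * δ := by
  filter_upwards [S.eventually_abs_pairing_sub_comp_flow_le H hΛ hA hκ hδ] with ε hε
  filter_upwards [hε] with τ hτ s hs hsτ c W hW ψ hψ hbψ
  have hzero : pairing (σ s) (fun x => fderiv ℝ ψ x (v (σ s) x - v (σ s) x)) = 0 :=
    pairing_eq_zero_of_forall_mem_supp _ fun x _ => by rw [sub_self, map_zero]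
  have hle := hτ s hs hsτ c _ W (H.v_lip _) (H.v_bound _) hW ψ hψ hbψ
  rwa [hzero, zero_add] at hle

theorem mass_le (S : IsSolutionCurve a b v h σ) (H : LipschitzCoefficients a b v h K L M Q P)
    (ht : t ∈ Icc (0 : ℝ) 1) : mass (σ t) ≤ mass (σ 0) + P * t := by
  have : ProperSpace E := FiniteDimensional.proper ℝ E
  refine mass_le_of_forall_isTestFunction _ fun φ hφ hφ1 => ?_
  have hle : pairing (σ t) φ ≤ mass (σ 0) + (t - 0) * P :=
    le_of_backward_steps (I := fun s ψ => pairing (σ s) ψ) (G := fun _ ψ => ∀ x, |ψ x| ≤ 1)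
      (w := fun s => v (σ s)) H.L_nonneg le_rfl ht.1 ht.2 (fun s => H.v_lip _)
      (fun s => H.v_bound _) (fun s τ ψ W _ _ _ hψ _ _ x => hψ _)
      (fun B Λ A κ δ hΛ hA hκ hδ => by
        filter_upwards [S.eventually_abs_pairing_sub_comp_flow_self_le H (B := B) hΛ hA hκ hδ]
          with ε hε
        filter_upwards [hε, self_mem_nhdsWithin] with τ hconsistent hτ s hs hst c W hW ψ hψ hbψ hψ1
        have hsource : pairing (h (σ s)) ψ ≤ 1 * P :=
          (le_abs_self _).trans (abs_pairing_le_mul_of_mass_le (H.h_mass _) hψ1)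
        linarith [(abs_le.1 (hconsistent s hs (hst.trans ht.2) c W hW ψ hψ hbψ)).2,
          mul_le_mul_of_nonneg_left hsource (le_of_lt hτ)])
      (fun ψ _ hψ1 => (le_abs_self _).trans ((abs_pairing_le (σ 0) hψ1).trans_eq (one_mul _)))
      hφ hφ1
  linarith

theorem supp_subset (S : IsSolutionCurve a b v h σ)
    (H : LipschitzCoefficients a b v h K L M Q P) {R' : ℝ}
    (hinit : supp (σ 0) ⊆ Metric.closedBall 0 R')
    (hsource : ∀ μ, supp (h μ) ⊆ Metric.closedBall 0 R') (ht : t ∈ Icc (0 : ℝ) 1) :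
    supp (σ t) ⊆ Metric.closedBall 0 (R' + t * M) := by
  have : ProperSpace E := FiniteDimensional.proper ℝ E
  have hM := H.M_nonneg
  refine supp_subset_of_forall_isTestFunction _ Metric.isClosed_closedBall fun φ hφ hφ0 => ?_
  have hle : |pairing (σ t) φ| ≤ 0 + (t - 0) * 0 :=
    le_of_backward_steps (I := fun s ψ => |pairing (σ s) ψ|)
      (G := fun s ψ => ∀ x ∈ Metric.closedBall (0 : E) (R' + s * M), ψ x = 0)
      (w := fun s => v (σ s)) H.L_nonneg le_rfl ht.1 ht.2 (fun s => H.v_lip _)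
      (fun s => H.v_bound _)
      (fun s τ ψ W _ hτ _ hψ _ hWM x hx => hψ _ (by
        rw [mem_closedBall_zero_iff] at hx ⊢
        have hmove : ‖τ • W x‖ ≤ τ * M := by
          rw [norm_smul, Real.norm_of_nonneg hτ]
          exact mul_le_mul_of_nonneg_left (hWM x) hτ
        linarith [norm_add_le x (τ • W x)]))
      (fun B Λ A κ δ hΛ hA hκ hδ => by
        filter_upwards [S.eventually_abs_pairing_sub_comp_flow_self_le H (B := B) hΛ hA hκ hδ]
          with ε hε
        filter_upwards [hε, self_mem_nhdsWithin] with τ hconsistent hτ s hs hst c W hW ψ hψ hbψ hψ0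
        have hradius : 0 ≤ (s + τ) * M := mul_nonneg (add_nonneg hs (le_of_lt hτ)) hM
        have hzero : pairing (h (σ s)) ψ = 0 := pairing_eq_zero_of_forall_mem_supp _ fun x hx =>
          hψ0 x (Metric.closedBall_subset_closedBall (by linarith) (hsource _ hx))
        have hstep := hconsistent s hs (hst.trans ht.2) c W hW ψ hψ hbψ
        rw [hzero, mul_zero, sub_zero] at hstep
        linarith [abs_sub_abs_le_abs_sub (pairing (σ (s + τ)) ψ)
          (pairing (σ s) (fun x => ψ (x + τ • W x)))])
      (fun ψ _ hψ0 => by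
        rw [pairing_eq_zero_of_forall_mem_supp _ fun x hx => hψ0 x (by simpa using hinit hx),
          abs_zero])
      hφ hφ0
  exact abs_nonpos_iff.1 (by simpa using hle)

theorem gwNorm_sub_le_mul (S : IsSolutionCurve a b v h σ)
    (H : LipschitzCoefficients a b v h K L M Q P) {τ : ℝ} (ht : 0 ≤ t) (hτ : 0 ≤ τ)
    (htτ : t + τ ≤ 1) :
    gwNorm a b (σ (t + τ) - σ t) ≤ (a * P + b * M * (P * (t + τ) + mass (σ 0))) * τ := by
  have : ProperSpace E := FiniteDimensional.proper ℝ E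
  have hb := H.b_pos
  have hsub : Icc t (t + τ) ⊆ Icc 0 1 := Icc_subset_Icc ht htτ
  refine gwNorm_le_of_forall_isTestFunction H.a_pos hb _ fun φ hφ hφBL => ?_
  have hspeed (r : ℝ) (hr : r ∈ Icc t (t + τ)) :
      ‖weakRhs v h φ (σ r)‖ ≤ a * P + b * M * (P * (t + τ) + mass (σ 0)) := by
    have hmass : mass (σ r) ≤ P * (t + τ) + mass (σ 0) := by
      linarith [S.mass_le H (hsub hr), mul_le_mul_of_nonneg_left hr.2 H.P_nonneg]
    have htransport : |pairing (σ r) (fun x => fderiv ℝ φ x (v (σ r) x))| ≤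
        b * M * (P * (t + τ) + mass (σ 0)) :=
      abs_pairing_le_mul_of_mass_le hmass fun x =>
        hφBL.abs_fderiv_apply_le hb.le (H.v_bound _ x) x
    have hsource : |pairing (h (σ r)) φ| ≤ a * P :=
      abs_pairing_le_mul_of_mass_le (H.h_mass _) hφBL.bound
    rw [weakRhs, Real.norm_eq_abs]
    linarith [abs_add_le (pairing (σ r) fun x => fderiv ℝ φ x (v (σ r) x))
      (pairing (h (σ r)) φ)]
  have hmean := (convex_Icc t (t + τ)).norm_image_sub_le_of_norm_hasDerivWithin_le
    (fun r hr => (S.weak φ hφ r (hsub hr)).mono hsub) hspeed (left_mem_Icc.2 (by linarith))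
    (right_mem_Icc.2 (by linarith))
  rw [Real.norm_eq_abs, Real.norm_eq_abs, add_sub_cancel_left, abs_of_nonneg hτ] at hmean
  rw [pairing_sub_measure _ _ hφBL.isBoundedContinuous]
  exact (le_abs_self _).trans hmean

end IsSolutionCurve

end MassAndSupport

section Stability

variable {E : Type*} [NormedAddCommGroup E] [NormedSpace ℝ E] [FiniteDimensional ℝ E]
  [MeasurableSpace E] [BorelSpace E]
  {a b K L M Q P B Λ A κ δ t : ℝ} {v : SignedMeasure E → E → E}
  {h : SignedMeasure E → SignedMeasure E} {μ ν : ℝ → SignedMeasure E}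

lemma LipschitzCoefficients.pairing_sub_sub_pairing_fderiv_sub_le
    (H : LipschitzCoefficients a b v h K L M Q P) {ρ σ : SignedMeasure E} {q m D : ℝ}
    {ψ : E → ℝ} (hq : 1 ≤ q) (hψ : IsBoundedLipschitz a (b * q) ψ) (hm : mass σ ≤ m)
    (hD : gwNorm a b (ρ - σ) ≤ D) :
    pairing (h ρ) ψ - pairing (h σ) ψ -
      pairing σ (fun x => fderiv ℝ ψ x (v σ x - v ρ x)) ≤ q * (Q + b * K * m) * D := by
  have hb := H.b_pos
  have hq₀ : 0 ≤ q := zero_le_one.trans hq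
  have hsource : pairing (h ρ - h σ) ψ ≤ q * (Q * D) :=
    (le_abs_self _).trans ((abs_pairing_le_mul_gwNorm H.a_pos hb _ hq₀
      (hψ.mono (le_mul_of_one_le_left H.a_pos.le hq) (mul_comm b q).le)).trans
      (mul_le_mul_of_nonneg_left
        ((H.h_sub _ _).trans (mul_le_mul_of_nonneg_left hD H.Q_nonneg)) hq₀))
  have hvelocity : |pairing σ (fun x => fderiv ℝ ψ x (v σ x - v ρ x))| ≤ b * q * (K * D) * m :=
    abs_pairing_le_mul_of_mass_le hm fun x => hψ.abs_fderiv_apply_le (by positivity)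
      ((H.v_sub _ _ x).trans (mul_le_mul_of_nonneg_left
        ((gwNorm_sub_comm H.a_pos hb _ _).trans_le hD) H.K_nonneg)) x
  rw [pairing_sub_measure _ _ hψ.isBoundedContinuous] at hsource
  linarith [(abs_le.1 hvelocity).1]

namespace IsSolutionCurve

/-- Both solutions are tested along the flow of the velocity of the first one. -/
lemma eventually_abs_pairing_sub_sub_comp_flow_le (Sμ : IsSolutionCurve a b v h μ)
    (Sν : IsSolutionCurve a b v h ν) (H : LipschitzCoefficients a b v h K L M Q P) (hΛ : 0 ≤ Λ)
    (hA : 0 ≤ A) (hκ : 0 ≤ κ) (hδ : 0 < δ) :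
    ∀ᶠ ε in 𝓝[>] (0 : ℝ), ∀ᶠ τ in 𝓝[>] (0 : ℝ), ∀ s, 0 ≤ s → s + τ ≤ 1 → ∀ c W,
      IsSmoothApprox c L M ε (v (μ s)) W →
      ∀ ψ, IsTestFunction ψ → IsC11Bounded B Λ (A + κ / ε) ψ →
      |pairing (μ (s + τ) - ν (s + τ)) ψ - pairing (μ s - ν s) (fun x => ψ (x + τ • W x)) -
        τ * (pairing (h (μ s)) ψ - pairing (h (ν s)) ψ -
          pairing (ν s) (fun x => fderiv ℝ ψ x (v (ν s) x - v (μ s) x)))| ≤ τ * δ := by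
  have : ProperSpace E := FiniteDimensional.proper ℝ E
  filter_upwards [Sμ.eventually_abs_pairing_sub_comp_flow_self_le H (B := B) hΛ hA hκ (half_pos hδ),
    Sν.eventually_abs_pairing_sub_comp_flow_le H (B := B) hΛ hA hκ (half_pos hδ)] with ε hμε hνε
  filter_upwards [hμε, hνε, self_mem_nhdsWithin] with τ hμτ hντ hτ s hs hsτ c W hW ψ hψ hbψ
  have hμ := hμτ s hs hsτ c W hW ψ hψ hbψ
  have hν := hντ s hs hsτ c _ W (H.v_lip _) (H.v_bound _) hW ψ hψ hbψ
  rw [pairing_sub_measure _ _ hψ.isBoundedContinuous,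
    pairing_sub_measure _ _ (hψ.comp_flow hW (le_of_lt hτ)).isBoundedContinuous]
  rw [abs_le] at hμ hν ⊢
  constructor <;> linarith

lemma gwNorm_sub_le_of_forall_le (Sμ : IsSolutionCurve a b v h μ)
    (Sν : IsSolutionCurve a b v h ν) (H : LipschitzCoefficients a b v h K L M Q P) {s₀ D : ℝ}
    (hs₀ : 0 ≤ s₀) (hst : s₀ ≤ t) (ht : t ≤ 1)
    (hD : ∀ s ∈ Icc s₀ t, gwNorm a b (μ s - ν s) ≤ D) :
    gwNorm a b (μ t - ν t) ≤ Real.exp (L * (t - s₀)) * gwNorm a b (μ s₀ - ν s₀) +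
      (t - s₀) * (Real.exp (L * (t - s₀)) * (Q + b * K * (P + mass (ν 0))) * D) := by
  have : ProperSpace E := FiniteDimensional.proper ℝ E
  have hb := H.b_pos
  have hL := H.L_nonneg
  have hone : 1 ≤ Real.exp (L * (t - s₀)) :=
    Real.one_le_exp (mul_nonneg hL (sub_nonneg.2 hst))
  refine gwNorm_le_of_forall_isTestFunction H.a_pos hb _ fun φ hφ hφBL => ?_
  refine le_of_backward_steps (I := fun s ψ => pairing (μ s - ν s) ψ)
    (G := fun s ψ => IsBoundedLipschitz a (b * Real.exp (L * (t - s))) ψ) (w := fun s => v (μ s))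
    hL hs₀ hst ht (fun s => H.v_lip _) (fun s => H.v_bound _) ?_ ?_ ?_ hφ (by simpa using hφBL)
  · intro s τ ψ W _ hτ _ hψ hW _
    refine (hψ.comp (by positivity) (norm_add_smul_sub_le hτ hW)).mono le_rfl ?_
    rw [mul_assoc, mul_comm (Real.exp _)]
    exact mul_le_mul_of_nonneg_left (one_add_mul_mul_exp_le L s t τ) hb.le
  · intro B Λ A κ δ hΛ hA hκ hδ
    filter_upwards [Sμ.eventually_abs_pairing_sub_sub_comp_flow_le Sν H (B := B) hΛ hA hκ hδ]
      with ε hε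
    filter_upwards [hε, self_mem_nhdsWithin] with τ hconsistent hτ s hs hsτ c W hW ψ hψ hbψ hψBL
    have hτ : 0 < τ := hτ
    have hs' : 0 ≤ s := hs₀.trans hs
    have hmass : mass (ν s) ≤ P + mass (ν 0) := by
      have := mul_le_of_le_one_right H.P_nonneg (by linarith : s ≤ 1)
      linarith [Sν.mass_le H (t := s) ⟨hs', by linarith⟩]
    have hexp : Real.exp (L * (t - (s + τ))) ≤ Real.exp (L * (t - s₀)) := by gcongr; linarith
    have hrate := H.pairing_sub_sub_pairing_fderiv_sub_le hone
      (hψBL.mono le_rfl (mul_le_mul_of_nonneg_left hexp hb.le)) hmass (hD s ⟨hs, by linarith⟩)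
    linarith [(abs_le.1 (hconsistent s hs' (hsτ.trans ht) c W hW ψ hψ hbψ)).2,
      mul_le_mul_of_nonneg_left hrate hτ.le]
  · intro ψ _ hψ
    exact (le_abs_self _).trans (abs_pairing_le_mul_gwNorm H.a_pos hb _ (Real.exp_pos _).le
      (hψ.mono (le_mul_of_one_le_left H.a_pos.le hone) (mul_comm _ _).le))

end IsSolutionCurve

end Stability

section ExponentialStability

lemma hasDerivAt_exp_mul_add (L p q x : ℝ) :
    HasDerivAt (fun z => Real.exp (L * (z - x)) * p + (z - x) * (Real.exp (L * (z - x)) * q))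
      (L * p + q) x := by
  have hsub : HasDerivAt (fun z => z - x) 1 x := (hasDerivAt_id x).sub_const x
  have hexp : HasDerivAt (fun z => Real.exp (L * (z - x))) L x := by
    simpa using (hsub.const_mul L).exp
  simpa using (hexp.mul_const p).fun_add (hsub.fun_mul (hexp.mul_const q))

lemma eventually_forall_Icc_lt {f : ℝ → ℝ} {x c C : ℝ} (hf : ContinuousOn f (Icc x c))
    (hxc : x < c) (hC : f x < C) : ∀ᶠ z in 𝓝[>] x, ∀ s ∈ Icc x z, f s < C := by
  have hnear : ∀ᶠ s in 𝓝[≥] x, f s < C := by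
    rw [← nhdsWithin_Icc_eq_nhdsGE hxc]
    exact (hf x (left_mem_Icc.2 hxc.le)).eventually (gt_mem_nhds hC)
  obtain ⟨u, hxu, hu⟩ := mem_nhdsGE_iff_exists_Ico_subset.1 hnear
  filter_upwards [Ioo_mem_nhdsGT hxu] with z hz s hs
  exact hu ⟨hs.1, hs.2.trans_lt hz.2⟩

section Gronwall

variable {f : ℝ → ℝ} {L Γ c x : ℝ} (hf : ContinuousOn f (Icc 0 c))
  (hstep : ∀ s t C, 0 ≤ s → s ≤ t → t ≤ c → (∀ r ∈ Icc s t, f r ≤ C) →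
    f t ≤ Real.exp (L * (t - s)) * f s + (t - s) * (Real.exp (L * (t - s)) * (Γ * C)))

include hf hstep

lemma eventually_slope_lt_of_exp_step (hx : x ∈ Ico 0 c) {r : ℝ} (hr : (L + Γ) * f x < r) :
    ∀ᶠ z in 𝓝[>] x, (z - x)⁻¹ * (f z - f x) < r := by
  obtain ⟨C, hCr, hC⟩ : ∃ C, L * f x + Γ * C < r ∧ f x < C := by
    have hlim : Tendsto (fun C => L * f x + Γ * C) (𝓝[>] f x) (𝓝 (L * f x + Γ * f x)) :=
      Continuous.continuousWithinAt (by fun_prop)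
    exact ((hlim.eventually (gt_mem_nhds (by linarith))).and self_mem_nhdsWithin).exists
  have hslope := (hasDerivAt_iff_tendsto_slope.1
    (hasDerivAt_exp_mul_add L (f x) (Γ * C) x)).mono_left (nhdsGT_le_nhdsNE x)
  filter_upwards [hslope.eventually (gt_mem_nhds hCr), self_mem_nhdsWithin, Ioo_mem_nhdsGT hx.2,
    eventually_forall_Icc_lt (hf.mono (Icc_subset_Icc_left hx.1)) hx.2 hC] with z hz hxz hzc hlt
  refine lt_of_le_of_lt ?_ hz
  rw [slope_def_field, div_eq_inv_mul, sub_self, mul_zero, Real.exp_zero, one_mul, zero_mul,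
    add_zero]
  have hxz : x < z := hxz
  have := hstep x z C hx.1 hxz.le hzc.2.le fun s hs => (hlt s hs).le
  gcongr

lemma le_mul_exp_of_exp_step {t : ℝ} (ht : t ∈ Icc 0 c) : f t ≤ f 0 * Real.exp ((L + Γ) * t) := by
  have hgronwall := le_gronwallBound_of_liminf_deriv_right_le (f' := fun s => (L + Γ) * f s)
    (δ := f 0) (K := L + Γ) (ε := 0) hf
    (fun x hx r hr => (eventually_slope_lt_of_exp_step hf hstep hx hr).frequently) le_rfl
    (fun x _ => (add_zero _).ge) t ht
  rwa [gronwallBound_ε0, sub_zero] at hgronwall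

end Gronwall

variable {E : Type*} [NormedAddCommGroup E] [NormedSpace ℝ E] [FiniteDimensional ℝ E]
  [MeasurableSpace E] [BorelSpace E] {a b K L M Q P t : ℝ} {v : SignedMeasure E → E → E}
  {h : SignedMeasure E → SignedMeasure E} {μ ν : ℝ → SignedMeasure E}

namespace IsSolutionCurve

lemma gwNorm_sub_le_exp (Sμ : IsSolutionCurve a b v h μ) (Sν : IsSolutionCurve a b v h ν)
    (H : LipschitzCoefficients a b v h K L M Q P) (ht : t ∈ Icc 0 1) :
    gwNorm a b (μ t - ν t) ≤ gwNorm a b (μ 0 - ν 0) *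
      Real.exp ((L + (Q + b * K * (P + mass (ν 0)))) * t) := by
  refine le_mul_exp_of_exp_step (Sμ.continuousOn_gwNorm_sub Sν H.a_pos H.b_pos)
    (fun s r C hs hsr hr hC => ?_) ht
  rw [← mul_assoc (Real.exp _)]
  exact Sμ.gwNorm_sub_le_of_forall_le Sν H hs hsr hr hC

lemma gwNorm_sub_le_exp_min (Sμ : IsSolutionCurve a b v h μ) (Sν : IsSolutionCurve a b v h ν)
    (H : LipschitzCoefficients a b v h K L M Q P) (ht : t ∈ Icc 0 1) :
    gwNorm a b (μ t - ν t) ≤ gwNorm a b (μ 0 - ν 0) *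
      Real.exp ((2 * L + 2 * b * K * (P + min (mass (μ 0)) (mass (ν 0))) + Q) * t) := by
  have ha := H.a_pos
  have hb := H.b_pos
  have hrate (m : ℝ) (hm : 0 ≤ m) : Real.exp ((L + (Q + b * K * (P + m))) * t) ≤
      Real.exp ((2 * L + 2 * b * K * (P + m) + Q) * t) := by
    have hdouble : 0 ≤ b * K * (P + m) :=
      mul_nonneg (mul_nonneg hb.le H.K_nonneg) (add_nonneg H.P_nonneg hm)
    exact Real.exp_le_exp.2
      (mul_le_mul_of_nonneg_right (by linarith [H.L_nonneg]) ht.1)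
  rcases le_total (mass (μ 0)) (mass (ν 0)) with hle | hle
  · rw [min_eq_left hle, gwNorm_sub_comm ha hb (μ t), gwNorm_sub_comm ha hb (μ 0)]
    exact (Sν.gwNorm_sub_le_exp Sμ H ht).trans
      (mul_le_mul_of_nonneg_left (hrate _ (mass_nonneg _)) (gwNorm_nonneg _ _ _))
  · rw [min_eq_right hle]
    exact (Sμ.gwNorm_sub_le_exp Sν H ht).trans
      (mul_le_mul_of_nonneg_left (hrate _ (mass_nonneg _)) (gwNorm_nonneg _ _ _))

end IsSolutionCurve

end ExponentialStability

section WellPosedness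

variable {E : Type*} [NormedAddCommGroup E] [NormedSpace ℝ E] [FiniteDimensional ℝ E]
  [MeasurableSpace E] [BorelSpace E] {a b K L M Q P : ℝ} {v : SignedMeasure E → E → E}
  {h : SignedMeasure E → SignedMeasure E}

lemma exists_gwNorm_pos (ha : 0 < a) (hb : 0 < b) : ∃ μ : SignedMeasure E, 0 < gwNorm a b μ := by
  refine ⟨(Measure.dirac 0).toSignedMeasure, lt_of_not_ge fun hle => ?_⟩
  have hmass := congrArg (fun μ : SignedMeasure E => μ univ) (eq_zero_of_gwNorm_le_zero ha hb hle)
  simp [Measure.toSignedMeasure_apply_measurable MeasurableSet.univ] at hmass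

lemma LipschitzCoefficients.of_forall_le (ha : 0 < a) (hb : 0 < b) (hL : 0 ≤ L)
    (v_sub : ∀ μ ν x, ‖v μ x - v ν x‖ ≤ K * gwNorm a b (μ - ν))
    (v_lip : ∀ μ x y, ‖v μ x - v μ y‖ ≤ L * ‖x - y‖) (v_bound : ∀ μ x, ‖v μ x‖ ≤ M)
    (h_sub : ∀ μ ν, gwNorm a b (h μ - h ν) ≤ Q * gwNorm a b (μ - ν))
    (h_mass : ∀ μ, mass (h μ) ≤ P) : LipschitzCoefficients a b v h K L M Q P := by
  obtain ⟨μ, hμ⟩ := exists_gwNorm_pos (E := E) ha hb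
  rw [← sub_zero μ] at hμ
  have hK : 0 ≤ K := nonneg_of_mul_nonneg_left ((norm_nonneg _).trans (v_sub μ 0 0)) hμ
  have hM : 0 ≤ M := (norm_nonneg _).trans (v_bound 0 0)
  have hQ : 0 ≤ Q := nonneg_of_mul_nonneg_left ((gwNorm_nonneg a b _).trans (h_sub μ 0)) hμ
  have hP : 0 ≤ P := (mass_nonneg _).trans (h_mass 0)
  exact ⟨ha, hb, hK, hL, hM, hQ, hP, v_sub, v_lip, v_bound, h_sub, h_mass⟩

lemma tendsto_gwNorm_sub_of_le {E : Type*} [NormedAddCommGroup E] [MeasurableSpace E]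
    {σ : ℝ → SignedMeasure E} {S : Set ℝ} {C s : ℝ}
    (hσ : ∀ t ∈ S, gwNorm a b (σ t - σ s) ≤ C * |t - s|) :
    Tendsto (fun t => gwNorm a b (σ t - σ s)) (𝓝[S] s) (𝓝 0) := by
  have hlim : Tendsto (fun t => C * |t - s|) (𝓝[S] s) (𝓝 0) := by
    have hcont : Continuous fun t : ℝ => C * |t - s| := by fun_prop
    simpa using (hcont.tendsto s).mono_left nhdsWithin_le_nhds
  exact squeeze_zero' (Eventually.of_forall fun t => gwNorm_nonneg _ _ _)
    (eventually_mem_nhdsWithin.mono hσ) hlim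

lemma IsEulerLimit.isSolutionCurve {μ₀ : SignedMeasure E} {C : ℝ} {σ : ℝ → SignedMeasure E}
    (hσ : IsEulerLimit a b v h μ₀ C σ) (H : LipschitzCoefficients a b v h K L M Q P) :
    IsSolutionCurve a b v h σ := by
  refine ⟨fun s hs => tendsto_gwNorm_sub_of_le (C := b * M * (mass μ₀ + P) + a * P) fun t ht => ?_,
    fun φ hφ t ht => hσ.hasDerivWithinAt_pairing H hφ ht⟩
  rcases le_total s t with hst | hts
  · rw [abs_of_nonneg (sub_nonneg.2 hst)]
    exact hσ.gwNorm_sub_le H hs.1 hst ht.2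
  · rw [gwNorm_sub_comm H.a_pos H.b_pos, abs_sub_comm, abs_of_nonneg (sub_nonneg.2 hts)]
    exact hσ.gwNorm_sub_le H ht.1 hts hs.2

lemma LipschitzCoefficients.exists_isSolutionCurve (H : LipschitzCoefficients a b v h K L M Q P)
    (μ₀ : SignedMeasure E) : ∃ σ, IsSolutionCurve a b v h σ ∧ σ 0 = μ₀ := by
  obtain ⟨C, σ, hσ⟩ := H.exists_isEulerLimit μ₀
  exact ⟨σ, hσ.isSolutionCurve H, hσ.apply_zero H.a_pos H.b_pos⟩

lemma IsSolutionCurve.eqOn {μ ν : ℝ → SignedMeasure E} (Sμ : IsSolutionCurve a b v h μ)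
    (Sν : IsSolutionCurve a b v h ν) (H : LipschitzCoefficients a b v h K L M Q P)
    (h₀ : μ 0 = ν 0) : EqOn μ ν (Icc 0 1) := by
  intro t ht
  have hstab := Sμ.gwNorm_sub_le_exp Sν H ht
  rw [h₀, sub_self, gwNorm_zero H.a_pos H.b_pos, zero_mul] at hstab
  exact sub_eq_zero.1 (eq_zero_of_gwNorm_le_zero H.a_pos H.b_pos hstab)

lemma isWeakSolution_iff {d : ℕ} {v : Ms d → EuclideanSpace ℝ (Fin d) → EuclideanSpace ℝ (Fin d)}
    {h : Ms d → Ms d} {μ₀ : Ms d} {μ : ℝ → Ms d} :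
    IsWeakSolution a b v h μ₀ μ ↔ IsSolutionCurve a b v h μ ∧ μ 0 = μ₀ :=
  ⟨fun S => ⟨⟨S.continuous, fun φ hφ => S.weak φ hφ.1 hφ.2⟩, S.initial⟩,
    fun S => ⟨S.1.continuous, S.2, fun φ hsmooth hsupp => S.1.weak φ ⟨hsmooth, hsupp⟩⟩⟩

end WellPosedness

end SignedTransport

end

open SignedTransport in
theorem theorem1_general {E : Type*} [NormedAddCommGroup E] [NormedSpace ℝ E]
    [FiniteDimensional ℝ E] [MeasurableSpace E] [BorelSpace E] {a b K L M Q P : ℝ}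
    {v : SignedMeasure E → E → E} {h : SignedMeasure E → SignedMeasure E}
    (H : LipschitzCoefficients a b v h K L M Q P) :
    (∀ μ₀ : SignedMeasure E, ∃ μ : ℝ → SignedMeasure E,
      (IsSolutionCurve a b v h μ ∧ μ 0 = μ₀) ∧
        ∀ ν : ℝ → SignedMeasure E, IsSolutionCurve a b v h ν ∧ ν 0 = μ₀ → EqOn ν μ (Icc 0 1)) ∧
    (∀ (μ₀ ν₀ : SignedMeasure E) (μ ν : ℝ → SignedMeasure E),
      IsSolutionCurve a b v h μ ∧ μ 0 = μ₀ → IsSolutionCurve a b v h ν ∧ ν 0 = ν₀ →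
      ∀ t ∈ Icc (0 : ℝ) 1, gwNorm a b (μ t - ν t) ≤ gwNorm a b (μ₀ - ν₀) *
        Real.exp ((2 * L + 2 * b * K * (P + min (mass μ₀) (mass ν₀)) + Q) * t)) ∧
    (∀ (μ₀ : SignedMeasure E) (μ : ℝ → SignedMeasure E),
      IsSolutionCurve a b v h μ ∧ μ 0 = μ₀ →
        (∀ t ∈ Icc (0 : ℝ) 1, mass (μ t) ≤ mass μ₀ + P * t) ∧
        (∀ R' : ℝ, supp μ₀ ⊆ Metric.closedBall 0 R' →
          (∀ ρ, supp (h ρ) ⊆ Metric.closedBall 0 R') →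
          ∀ t ∈ Icc (0 : ℝ) 1, supp (μ t) ⊆ Metric.closedBall 0 (R' + t * M)) ∧
        (∀ t τ : ℝ, 0 ≤ t → 0 ≤ τ → t + τ ≤ 1 →
          gwNorm a b (μ (t + τ) - μ t) ≤
            (a * P + b * M * (P * (t + τ) + mass μ₀)) * τ)) := by
  refine ⟨fun μ₀ => ?_, ?_, ?_⟩
  · obtain ⟨μ, hμ, hμ₀⟩ := H.exists_isSolutionCurve μ₀
    exact ⟨μ, ⟨hμ, hμ₀⟩, fun ν ⟨hν, hν₀⟩ => hν.eqOn hμ H (hν₀.trans hμ₀.symm)⟩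
  · rintro _ _ μ ν ⟨hμ, rfl⟩ ⟨hν, rfl⟩ t ht
    exact hμ.gwNorm_sub_le_exp_min hν H ht
  · rintro _ μ ⟨hμ, rfl⟩
    exact ⟨fun t ht => hμ.mass_le H ht,
      fun R' hinit hsource t ht => hμ.supp_subset H hinit hsource ht,
      fun t τ ht hτ htτ => hμ.gwNorm_sub_le_mul H ht hτ htτ⟩

theorem theorem1 (d : ℕ) (a b : ℝ) (ha : 0 < a) (hb : 0 < b)
    (v : SignedTransport.Ms d → EuclideanSpace ℝ (Fin d) → EuclideanSpace ℝ (Fin d))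
    (h : SignedTransport.Ms d → SignedTransport.Ms d)
    (K L M Q P R : ℝ)
    (hv1 : SignedTransport.H1 a b v K)
    (hv2 : SignedTransport.H2 v L M)
    (hh : SignedTransport.H3 a b h Q P R) :
    -- existence and uniqueness on `[0,1]`
    (∀ μ₀ : SignedTransport.Ms d, IsCompact (SignedTransport.supp μ₀) →
      ∃ μ : ℝ → SignedTransport.Ms d, SignedTransport.IsWeakSolution a b v h μ₀ μ ∧
        ∀ ν : ℝ → SignedTransport.Ms d, SignedTransport.IsWeakSolution a b v h μ₀ ν →
          Set.EqOn ν μ (Set.Icc 0 1)) ∧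
    -- continuous dependence on the initial datum
    (∀ (μ₀ ν₀ : SignedTransport.Ms d) (μ ν : ℝ → SignedTransport.Ms d),
      SignedTransport.IsWeakSolution a b v h μ₀ μ →
      SignedTransport.IsWeakSolution a b v h ν₀ ν →
      ∀ t ∈ Set.Icc (0 : ℝ) 1,
        SignedTransport.gwNorm a b (μ t - ν t) ≤
          SignedTransport.gwNorm a b (μ₀ - ν₀) *
            Real.exp ((2 * L + 2 * b * K *
              (P + min (SignedTransport.mass μ₀) (SignedTransport.mass ν₀)) + Q) * t)) ∧
    -- mass, support and time regularity of the solution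
    (∀ μ₀ : SignedTransport.Ms d, IsCompact (SignedTransport.supp μ₀) →
      ∀ μ : ℝ → SignedTransport.Ms d, SignedTransport.IsWeakSolution a b v h μ₀ μ →
        (∀ t ∈ Set.Icc (0 : ℝ) 1,
          SignedTransport.mass (μ t) ≤ SignedTransport.mass μ₀ + P * t) ∧
        (∀ R' : ℝ,
          SignedTransport.supp μ₀ ∪ Metric.closedBall 0 R ⊆ Metric.closedBall 0 R' →
          ∀ t ∈ Set.Icc (0 : ℝ) 1,
            SignedTransport.supp (μ t) ⊆ Metric.closedBall 0 (R' + t * M)) ∧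
        (∀ t τ : ℝ, 0 ≤ t → 0 ≤ τ → t + τ ≤ 1 →
          SignedTransport.gwNorm a b (μ (t + τ) - μ t) ≤
            (a * P + b * M * (P * (t + τ) + SignedTransport.mass μ₀)) * τ)) := by
  have H := SignedTransport.LipschitzCoefficients.of_forall_le ha hb hv2.1 hv1
    (fun μ => (hv2.2 μ).1) (fun μ => (hv2.2 μ).2) hh.1 (fun μ => (hh.2 μ).1)
  simp only [SignedTransport.isWeakSolution_iff]
  obtain ⟨hexists, hstable, hbounds⟩ := theorem1_general H
  refine ⟨fun μ₀ _ => hexists μ₀, hstable, fun μ₀ _ μ hμ => ?_⟩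
  obtain ⟨hmass, hsupp, htime⟩ := hbounds μ₀ μ hμ
  exact ⟨hmass, fun R' hR' => hsupp R' (union_subset_iff.1 hR').1
    fun ρ => (hh.2 ρ).2.trans (union_subset_iff.1 hR').2, htime⟩
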